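/- **Theorem 1.4 (tensor monadicity).** Let $k$ be a commutative ring. A *$k$-linear tensor category* is a $k$-linear category with a symmetric monoidal structure whose tensor product is $k$-bilinear on morphisms; it is *rigid* if every object has a dual (with evaluation and coevaluation satisfying the triangle identities). A *tensor functor* is a strong symmetric monoidal functor. Let $\mathcal C,\mathcal D$ be essentially small $k$-linear tensor categories (with $k$ and all morphism modules small) and let $F:\mathcal C\to\mathcal D$ be a $k$-linear tensor functor. Let $\mathrm{Rep}\,\mathcal C$ denote the category of $k$-linear functors $\mathcal C\to k\text{-}\mathrm{Mod}$ with the Day convolution $$M\otimes N=\int^{u,v\in\mathcal C}\mathcal C(u\otimes v,-)\otimes_k M(u)\otimes_k N(v),\qquad \mathbb 1=\mathcal C(\mathbb 1,-),$$ and similarly $\mathrm{Rep}\,\mathcal D$. Restriction along $F$ is a functor $F^*:\mathrm{Rep}\,\mathcal D\to\mathrm{Rep}\,\mathcal C$. It is lax symmetric monoidal, with unit $\mathcal C(\mathbb 1,-)\to\mathcal D(F\mathbb 1,F-)\cong\mathcal D(\mathbb 1,F-)$ given by $F$ and multiplication $\lambda_{N,N'}:F^*N\otimes F^*N'\to F^*(N\otimes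 N')$, $[f,n,n']_{u,v}\mapsto[F f,n,n']_{Fu,Fv}$ (identifying $F(u\otimes v)$ with $Fu\otimes Fv$). The functor $F^*$ has a left adjoint $F_!$, which is $k$-linear, and the lax structure of $F^*$ is the one induced by a strong symmetric monoidal structure on $F_!$. Let $A=F^*(\mathbb 1)$, a commutative monoid in $\mathrm{Rep}\,\mathcal C$ through the lax structure of $F^*$ and the isomorphism $\mathbb 1\otimes\mathbb 1\cong\mathbb 1$. Let $A\text{-}\mathrm{Mod}$ be the category of left $A$-modules in $\mathrm{Rep}\,\mathcal C$ with the $k$-linear tensor structure with unit $A$ and $$M\otimes_A M'=\mathrm{coeq}\bigl(M\otimes A\otimes M'\rightrightarrows M\otimes M'\bigr),$$ the two maps being given by the action on $M'$ and by the symmetry followed by the action on $M$; write $\omega_{M,M'}:M\otimes M'\to M\otimes_AM'$ for the projection. Let $U:A\text{-}\mathrm{Mod}\to\mathrm{Rep}\,\mathcal C$ be the forgetful functor and $\mathrm{Free}=A\otimes-$ its left adjoint. Let $E:\mathrm{Rep}\,\mathcal D\to A\text{-}\mathrm{Mod}$ be the comparison functor, with $U E=F^*$, where $A$ acts on $F^*N$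 by $$A\otimes F^*N\xrightarrow{\lambda_{\mathbb 1,N}}F^*(\mathbb 1\otimes N)\cong F^*N.$$ Equivalently, this action is $F^*(\varepsilon_N)\circ\pi_{F^*N}$, where $\eta,\varepsilon$ are the unit and counit of $F_!\dashv F^*$ and $\pi_M$ is the composite $A\otimes M\xrightarrow{A\otimes\eta_M}A\otimes F^*F_!M\xrightarrow{\lambda}F^*(\mathbb 1\otimes F_!M)\cong F^*F_!M$. If $\mathcal C$ and $\mathcal D$ are rigid, the maps $\pi_M$ define an isomorphism $\mathrm{Free}\cong E F_!$, and $E$ is characterized, up to an isomorphism which is unique over $\mathrm{Rep}\,\mathcal C$, by isomorphisms $UE\cong F^*$ and $EF_!\cong\mathrm{Free}$ that are compatible through $\pi$. Then: 1. If $F$ is essentially surjective and $\mathcal C$ and $\mathcal D$ are rigid, then $E$ is an equivalence of $k$-linear categories. 2. If moreover $F$ is full, then: - $E$ is an equivalence of tensor categories: it has a strong symmetric monoidal structure whose unit $A\to E(\mathbb 1)$ is the identity of $A$ and whose multiplication $\varphi_{N,N'}:E(N)\otimes_AE(N')\to E(N\otimes N')$ satisfies $\varphi_{N,N'}\circ\omega_{E(N),E(N')}=\lambda_{N,N'}$;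 - $F^*$ and $U$ are fully faithful and have the same essential image $\mathrm{Im}(F^*)=\mathrm{Im}(U)$ in $\mathrm{Rep}\,\mathcal C$; all maps $\lambda_{N,N'}$ (for $N,N'\in\mathrm{Rep}\,\mathcal D$) and $\omega_{M,M'}$ (for $M,M'\in A\text{-}\mathrm{Mod}$) are isomorphisms, so that $F^*$ and $U$ identify the tensor products of their sources with that of $\mathrm{Rep}\,\mathcal C$ on this image; - $\mathrm{Im}(F^*)$ is a full reflective subcategory and a tensor ideal of $\mathrm{Rep}\,\mathcal C$: if $M\in\mathrm{Rep}\,\mathcal C$ and $N\in\mathrm{Im}(F^*)$, then $M\otimes N\in\mathrm{Im}(F^*)$. -/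

import Mathlib

open CategoryTheory MonoidalCategory Limits
open scoped TensorProduct

universe w v u u₁ u₂ v₁ v₂ u₃ u₄

noncomputable section

namespace LinRep

set_option linter.unusedSectionVars false

/-- The property of a functor `C ⥤ Mod k` of being `k`-linear. -/
def isLinear (k : Type w) [CommRing k] (C : Type u₁) [Category.{w} C] [Preadditive C]
    [Linear k C] : ObjectProperty (C ⥤ ModuleCat.{w} k) :=
  fun M => M.Additive ∧ M.Linear k

/-- The category of representations of a `k`-linear category `C`: the `k`-linear functors from
`C` to `k`-modules, and all natural transformations between them. -/
abbrev Rep (k : Type w) [CommRing k] (C : Type u₁) [Category.{w} C] [Preadditive C]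
    [Linear k C] :=
  (isLinear k C).FullSubcategory

section Basic

variable {k : Type w} [CommRing k] {C : Type u₁} [Category.{w} C] [Preadditive C] [Linear k C]

/-- The value of a representation at an object. -/
abbrev Rep.val (M : Rep k C) (c : C) : Type w := M.obj.obj c

/-- The action of a morphism of `C` on a representation. -/
def Rep.act (M : Rep k C) {c d : C} (f : c ⟶ d) : M.val c →ₗ[k] M.val d := (M.obj.map f).hom

/-- The components of a morphism of representations. -/
def Rep.app {M N : Rep k C} (φ : M ⟶ N) (c : C) : M.val c →ₗ[k] N.val c := (φ.hom.app c).hom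

namespace Rep

variable (M N : Rep k C)

instance : M.obj.Additive := M.property.1
instance : M.obj.Linear k := M.property.2

@[simp] lemma act_id (c : C) (m : M.val c) : M.act (𝟙 c) m = m := by
  simp [act]

@[simp] lemma act_act {c d e : C} (f : c ⟶ d) (g : d ⟶ e) (m : M.val c) :
    M.act g (M.act f m) = M.act (f ≫ g) m := by
  simp [act]

lemma act_add {c d : C} (f g : c ⟶ d) (m : M.val c) :
    M.act (f + g) m = M.act f m + M.act g m := by
  simp [act, M.obj.map_add]

lemma act_smul {c d : C} (r : k) (f : c ⟶ d) (m : M.val c) :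
    M.act (r • f) m = r • M.act f m := by
  simp [act, M.obj.map_smul]

variable {M N}

@[simp] lemma app_act (φ : M ⟶ N) {c d : C} (f : c ⟶ d) (m : M.val c) :
    app φ d (M.act f m) = N.act f (app φ c m) := by
  have := congrArg (fun t => t.hom m) (φ.hom.naturality f)
  simp [app, act] at this ⊢

@[simp] lemma app_id (c : C) (m : M.val c) : app (𝟙 M) c m = m := rfl

@[simp] lemma app_comp {P : Rep k C} (φ : M ⟶ N) (ψ : N ⟶ P) (c : C) (m : M.val c) :
    app (φ ≫ ψ) c m = app ψ c (app φ c m) := rfl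

@[simp] lemma app_add (φ ψ : M ⟶ N) (c : C) (m : M.val c) :
    app (φ + ψ) c m = app φ c m + app ψ c m := rfl

@[simp] lemma app_zero (c : C) (m : M.val c) :
    app (0 : M ⟶ N) c m = 0 := rfl

@[simp] lemma app_smul (r : k) (φ : M ⟶ N) (c : C) (m : M.val c) :
    app (r • φ) c m = r • app φ c m := rfl

lemma hom_ext' {φ ψ : M ⟶ N} (h : ∀ c m, app φ c m = app ψ c m) : φ = ψ := by
  apply ObjectProperty.hom_ext
  ext c m
  exact h c m

/-- Constructor for morphisms of representations. -/
def mkHom (φ : ∀ c, M.val c →ₗ[k] N.val c)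
    (h : ∀ {c d : C} (f : c ⟶ d) (m : M.val c), φ d (M.act f m) = N.act f (φ c m)) : M ⟶ N :=
  ObjectProperty.homMk
    { app := fun c => ModuleCat.ofHom (φ c)
      naturality := fun c d f => by
        ext m
        exact h f m }

@[simp] lemma app_mkHom (φ : ∀ c, M.val c →ₗ[k] N.val c)
    (h : ∀ {c d : C} (f : c ⟶ d) (m : M.val c), φ d (M.act f m) = N.act f (φ c m)) (c : C)
    (m : M.val c) : app (mkHom φ h) c m = φ c m := rfl

/-- Constructor for representations. -/
def mkObj (X : C → Type w) [∀ c, AddCommGroup (X c)] [∀ c, Module k (X c)]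
    (a : ∀ {c d : C}, (c ⟶ d) → (X c →ₗ[k] X d))
    (a_id : ∀ c x, a (𝟙 c) x = x)
    (a_comp : ∀ {c d e : C} (f : c ⟶ d) (g : d ⟶ e) x, a (f ≫ g) x = a g (a f x))
    (a_add : ∀ {c d : C} (f g : c ⟶ d) x, a (f + g) x = a f x + a g x)
    (a_smul : ∀ {c d : C} (r : k) (f : c ⟶ d) x, a (r • f) x = r • a f x) : Rep k C where
  obj :=
    { obj := fun c => ModuleCat.of k (X c)
      map := fun f => ModuleCat.ofHom (a f)
      map_id := fun c => by
        ext x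
        exact a_id c x
      map_comp := fun f g => by
        ext x
        exact a_comp f g x }
  property :=
    ⟨⟨fun {_ _ f g} => by
        ext x
        exact a_add f g x⟩,
     ⟨fun {_ _} f r => by
        ext x
        exact a_smul r f x⟩⟩

end Rep

end Basic

section Day

variable {k : Type w} [CommRing k] {C : Type u₁} [Category.{w} C] [Preadditive C] [Linear k C]
  [MonoidalCategory C]

open Classical in
/-- The direct sum `⨁_{u,v} C(u ⊗ v, c) ⊗ M(u) ⊗ N(v)`. -/
abbrev DaySum (M N : Rep k C) (c : C) : Type (max u₁ w) :=
  DirectSum (C × C) fun p => (p.1 ⊗ p.2 ⟶ c) ⊗[k] (M.val p.1 ⊗[k] N.val p.2)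

open Classical in
/-- The summand inclusion `C(u ⊗ v, c) ⊗ M(u) ⊗ N(v) → ⨁_{u,v} C(u ⊗ v, c) ⊗ M(u) ⊗ N(v)` on
elementary tensors. -/
def DaySum.of (M N : Rep k C) {c u v : C} (f : u ⊗ v ⟶ c) (m : M.val u) (n : N.val v) :
    DaySum M N c :=
  DirectSum.lof k (C × C) (fun p => (p.1 ⊗ p.2 ⟶ c) ⊗[k] (M.val p.1 ⊗[k] N.val p.2)) (u, v)
    (f ⊗ₜ[k] (m ⊗ₜ[k] n))

/-- The relations defining the coend, imposed by the morphisms `(a, b)` of `C × C`. -/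
def dayRel (M N : Rep k C) (c : C) : Submodule k (DaySum M N c) :=
  Submodule.span k
    { x | ∃ (u v u' v' : C) (a : u ⟶ u') (b : v ⟶ v') (f : u' ⊗ v' ⟶ c) (m : M.val u)
        (n : N.val v), x = DaySum.of M N ((a ⊗ₘ b) ≫ f) m n
          - DaySum.of M N f (M.act a m) (N.act b n) }

/-- The `k`-linear coend `∫^{u,v} C(u ⊗ v, c) ⊗ M(u) ⊗ N(v)`. -/
def DayCoend (M N : Rep k C) (c : C) : Type (max u₁ w) := DaySum M N c ⧸ dayRel M N c

instance (M N : Rep k C) (c : C) : AddCommGroup (DayCoend M N c) :=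
  inferInstanceAs (AddCommGroup (DaySum M N c ⧸ dayRel M N c))

instance (M N : Rep k C) (c : C) : Module k (DayCoend M N c) :=
  inferInstanceAs (Module k (DaySum M N c ⧸ dayRel M N c))

namespace DayCoend

variable {M N : Rep k C} {c : C}

variable (M N c) in
/-- The quotient map onto the coend. -/
def proj : DaySum M N c →ₗ[k] DayCoend M N c := (dayRel M N c).mkQ

lemma proj_surjective : Function.Surjective (proj M N c) := Submodule.mkQ_surjective _

/-- The generators `[f, m, n]_{u,v}` of the coend. -/
def mk {u v : C} (f : u ⊗ v ⟶ c) (m : M.val u) (n : N.val v) : DayCoend M N c :=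
  proj M N c (DaySum.of M N f m n)

lemma mk_act {u v u' v' : C} (a : u ⟶ u') (b : v ⟶ v') (f : u' ⊗ v' ⟶ c) (m : M.val u)
    (n : N.val v) : mk ((a ⊗ₘ b) ≫ f) m n = mk f (M.act a m) (N.act b n) := by
  rw [← sub_eq_zero]
  unfold mk
  rw [← map_sub]
  exact (Submodule.Quotient.mk_eq_zero _).2 (Submodule.subset_span ⟨u, v, u', v', a, b, f, m, n, rfl⟩)

section
variable {u v : C} (f f' : u ⊗ v ⟶ c) (m m' : M.val u) (n n' : N.val v) (r : k)

lemma add_mk : mk (f + f') m n = mk f m n + mk f' m n := by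
  simp [mk, DaySum.of, TensorProduct.add_tmul]

lemma smul_mk : mk (r • f) m n = r • mk f m n := by
  simp only [mk, DaySum.of, ← TensorProduct.smul_tmul', map_smul]

lemma mk_add_mk : mk f (m + m') n = mk f m n + mk f m' n := by
  simp [mk, DaySum.of, TensorProduct.add_tmul, TensorProduct.tmul_add]

lemma mk_smul_mk : mk f (r • m) n = r • mk f m n := by
  simp only [mk, DaySum.of, ← TensorProduct.smul_tmul', TensorProduct.tmul_smul, map_smul]

lemma mk_add : mk f m (n + n') = mk f m n + mk f m n' := by
  simp [mk, DaySum.of, TensorProduct.tmul_add]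

lemma mk_smul : mk f m (r • n) = r • mk f m n := by
  simp [mk, DaySum.of]

end

lemma induction {p : DayCoend M N c → Prop}
    (mk : ∀ (u v : C) (f : u ⊗ v ⟶ c) (m : M.val u) (n : N.val v), p (mk f m n))
    (zero : p 0) (add : ∀ x y, p x → p y → p (x + y)) (x : DayCoend M N c) : p x := by
  classical
  obtain ⟨y, rfl⟩ := proj_surjective x
  induction y using DirectSum.induction_on with
  | zero => simpa using zero
  | add x y hx hy => rw [map_add]; exact add _ _ hx hy
  | of i t =>
    induction t using TensorProduct.induction_on with
    | zero => simpa using zero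
    | add x y hx hy => rw [map_add, map_add]; exact add _ _ hx hy
    | tmul f t =>
      induction t using TensorProduct.induction_on with
      | zero => simpa using zero
      | add x y hx hy => rw [TensorProduct.tmul_add, map_add, map_add]; exact add _ _ hx hy
      | tmul m n => exact mk i.1 i.2 f m n

section
variable {X : Type*} [AddCommGroup X] [Module k X]

/-- The universal property of the coend. -/
def desc (φ : ∀ u v : C, (u ⊗ v ⟶ c) →ₗ[k] M.val u →ₗ[k] N.val v →ₗ[k] X)
    (h : ∀ {u v u' v' : C} (a : u ⟶ u') (b : v ⟶ v') (f : u' ⊗ v' ⟶ c) (m : M.val u)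
      (n : N.val v), φ u v ((a ⊗ₘ b) ≫ f) m n = φ u' v' f (M.act a m) (N.act b n)) :
    DayCoend M N c →ₗ[k] X := by
  classical
  exact (dayRel M N c).liftQ
    (DirectSum.toModule k _ _ fun p => TensorProduct.lift
      (TensorProduct.uncurry (.id k) (M.val p.1) (N.val p.2) X ∘ₗ φ p.1 p.2))
    (by
      rw [dayRel, Submodule.span_le]
      rintro _ ⟨u, v, u', v', a, b, f, m, n, rfl⟩
      simp [DaySum.of, h])

lemma desc_mk (φ : ∀ u v : C, (u ⊗ v ⟶ c) →ₗ[k] M.val u →ₗ[k] N.val v →ₗ[k] X)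
    (h : ∀ {u v u' v' : C} (a : u ⟶ u') (b : v ⟶ v') (f : u' ⊗ v' ⟶ c) (m : M.val u)
      (n : N.val v), φ u v ((a ⊗ₘ b) ≫ f) m n = φ u' v' f (M.act a m) (N.act b n))
    {u v : C} (f : u ⊗ v ⟶ c) (m : M.val u) (n : N.val v) :
    desc φ h (mk f m n) = φ u v f m n := by
  change Submodule.liftQ _ _ _ (Submodule.Quotient.mk _) = _
  simp [DaySum.of]

end

/-- If `C` is essentially small then the coend is a small module: it is generated by the
`[f, m, n]_{u,v}` with `u, v` in a small skeleton. -/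
instance [EssentiallySmall.{w} C] : Small.{w} (DayCoend M N c) := by
  let e := equivSmallModel.{w} C
  let S := Σ p : SmallModel.{w} C × SmallModel.{w} C,
    (e.inverse.obj p.1 ⊗ e.inverse.obj p.2 ⟶ c) × M.val (e.inverse.obj p.1) ×
      N.val (e.inverse.obj p.2)
  let T : (S →₀ k) →ₗ[k] DayCoend M N c :=
    Finsupp.linearCombination k (fun s : S => mk s.2.1 s.2.2.1 s.2.2.2)
  apply small_of_surjective (f := T)
  intro x
  change x ∈ LinearMap.range T
  induction x using induction with
  | zero => exact Submodule.zero_mem _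
  | add x y hx hy => exact Submodule.add_mem _ hx hy
  | mk u v f m n =>
    let a := e.unitIso.app u
    let b := e.unitIso.app v
    refine ⟨Finsupp.single ⟨(e.functor.obj u, e.functor.obj v), ((a.inv ⊗ₘ b.inv) ≫ f,
      M.act a.hom m, N.act b.hom n)⟩ 1, ?_⟩
    simp only [T, Finsupp.linearCombination_single, one_smul]
    rw [mk_act]
    simp

end DayCoend

variable [EssentiallySmall.{w} C]

/-- The coend `∫^{u,v} C(u ⊗ v, c) ⊗ M(u) ⊗ N(v)`, as a module in the universe of small sets. -/
def DayObj (M N : Rep k C) (c : C) : Type w := Shrink.{w} (DayCoend M N c)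

instance (M N : Rep k C) (c : C) : AddCommGroup (DayObj M N c) :=
  inferInstanceAs (AddCommGroup (Shrink.{w} (DayCoend M N c)))

instance (M N : Rep k C) (c : C) : Module k (DayObj M N c) :=
  inferInstanceAs (Module k (Shrink.{w} (DayCoend M N c)))

/-- The canonical identification of `DayObj` with the coend. -/
def dayEquiv (M N : Rep k C) (c : C) : DayCoend M N c ≃ₗ[k] DayObj M N c :=
  (Shrink.linearEquiv k (DayCoend M N c)).symm

/-- The functoriality of the coend in `c`. -/
def DayObj.act (M N : Rep k C) {c d : C} (g : c ⟶ d) : DayObj M N c →ₗ[k] DayObj M N d :=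
  (dayEquiv M N d).toLinearMap ∘ₗ
    DayCoend.desc (fun u v => LinearMap.mk₂ k (fun f m =>
      { toFun := fun n => DayCoend.mk (f ≫ g) m n
        map_add' := fun n n' => DayCoend.mk_add _ _ _ _
        map_smul' := fun r n => DayCoend.mk_smul _ _ _ _ })
      (fun f f' m => by ext n; simp [DayCoend.add_mk])
      (fun r f m => by ext n; simp [DayCoend.smul_mk])
      (fun f m m' => by ext n; simp [DayCoend.mk_add_mk])
      (fun r f m => by ext n; simp [DayCoend.mk_smul_mk]))
      (fun a b f m n => by simp [← DayCoend.mk_act]) ∘ₗ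
    (dayEquiv M N c).symm.toLinearMap

lemma DayObj.act_mk {M N : Rep k C} {u v c d : C} (g : c ⟶ d) (f : u ⊗ v ⟶ c) (m : M.val u)
    (n : N.val v) : DayObj.act M N g (dayEquiv M N c (DayCoend.mk f m n)) =
      dayEquiv M N d (DayCoend.mk (f ≫ g) m n) := by
  simp only [DayObj.act, LinearMap.comp_apply, LinearEquiv.coe_coe, LinearEquiv.symm_apply_apply]
  exact congrArg _ (DayCoend.desc_mk _ (fun a b f m n => by simp [← DayCoend.mk_act]) f m n)

lemma DayObj.induction {M N : Rep k C} {c : C} {p : DayObj M N c → Prop}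
    (mk : ∀ (u v : C) (f : u ⊗ v ⟶ c) (m : M.val u) (n : N.val v),
      p (dayEquiv M N c (DayCoend.mk f m n)))
    (zero : p 0) (add : ∀ x y, p x → p y → p (x + y)) (x : DayObj M N c) : p x := by
  obtain ⟨x, rfl⟩ := (dayEquiv M N c).surjective x
  induction x using DayCoend.induction with
  | zero => simpa using zero
  | add x y hx hy => rw [map_add]; exact add _ _ hx hy
  | mk u v f m n => exact mk u v f m n

/-- The Day convolution of representations, given by
`(M ⊗ N)(c) = ∫^{u,v} C(u ⊗ v, c) ⊗ M(u) ⊗ N(v)`. -/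
def day (M N : Rep k C) : Rep k C :=
  Rep.mkObj (fun c => DayObj M N c) (fun {c d} g => DayObj.act M N g)
    (fun c x => by
      induction x using DayObj.induction with
      | zero => simp
      | add x y hx hy => simp only [map_add, hx, hy]
      | mk u v f m n => simp [DayObj.act_mk])
    (fun {c d e} g h x => by
      induction x using DayObj.induction with
      | zero => simp
      | add x y hx hy => simp only [map_add, hx, hy]
      | mk u v f m n => simp [DayObj.act_mk])
    (fun {c d} g h x => by
      induction x using DayObj.induction with
      | zero => simp
      | add x y hx hy => simp only [map_add, hx, hy]; abel
      | mk u v f m n => simp [DayObj.act_mk, DayCoend.add_mk])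
    (fun {c d} r g x => by
      induction x using DayObj.induction with
      | zero => simp
      | add x y hx hy => simp only [map_add, hx, hy, smul_add]
      | mk u v f m n => simp [DayObj.act_mk, DayCoend.smul_mk])

namespace Day

variable {M N P : Rep k C} {c u v : C}

/-- The universal family `M(u) × N(v) → (M ⊗ N)(u ⊗ v)`, `(m, n) ↦ [id, m, n]_{u,v}`. -/
def gen (m : M.val u) (n : N.val v) : (day M N).val (u ⊗ v) :=
  dayEquiv M N (u ⊗ v) (DayCoend.mk (𝟙 _) m n)

lemma act_gen (f : u ⊗ v ⟶ c) (m : M.val u) (n : N.val v) :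
    (day M N).act f (gen m n) =
      dayEquiv M N c (DayCoend.mk f m n) := by
  change DayObj.act M N f (dayEquiv M N _ _) = _
  simp [DayObj.act_mk]

@[simp] lemma gen_add (m : M.val u) (n n' : N.val v) : gen m (n + n') = gen m n + gen m n' := by
  simp only [gen, DayCoend.mk_add, map_add]
  rfl

@[simp] lemma add_gen (m m' : M.val u) (n : N.val v) : gen (m + m') n = gen m n + gen m' n := by
  simp only [gen, DayCoend.mk_add_mk, map_add]
  rfl

@[simp] lemma gen_smul (r : k) (m : M.val u) (n : N.val v) : gen m (r • n) = r • gen m n := by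
  simp only [gen, DayCoend.mk_smul, map_smul]
  rfl

@[simp] lemma smul_gen (r : k) (m : M.val u) (n : N.val v) : gen (r • m) n = r • gen m n := by
  simp only [gen, DayCoend.mk_smul_mk, map_smul]
  rfl

@[simp] lemma gen_zero (m : M.val u) : gen m (0 : N.val v) = 0 := by
  simpa using gen_smul (0 : k) m (0 : N.val v)

@[simp] lemma zero_gen (n : N.val v) : gen (0 : M.val u) n = 0 := by
  simpa using smul_gen (0 : k) (0 : M.val u) n

@[simp] lemma gen_act {v' : C} (b : v ⟶ v') (m : M.val u) (n : N.val v) :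
    gen m (N.act b n) = (day M N).act (u ◁ b) (gen m n) := by
  rw [act_gen, gen]
  have := DayCoend.mk_act (𝟙 u) b (𝟙 _) m n
  simp at this
  rw [this]

@[simp] lemma gen_act_left {u' : C} (a : u ⟶ u') (m : M.val u) (n : N.val v) :
    gen (M.act a m) n = (day M N).act (a ▷ v) (gen m n) := by
  rw [act_gen, gen]
  have := DayCoend.mk_act a (𝟙 v) (𝟙 _) m n
  simp at this
  rw [this]

lemma induction {p : (day M N).val c → Prop}
    (gen : ∀ (u v : C) (f : u ⊗ v ⟶ c) (m : M.val u) (n : N.val v), p ((day M N).act f (gen m n)))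
    (zero : p 0) (add : ∀ x y, p x → p y → p (x + y)) (x : (day M N).val c) : p x := by
  induction x using DayObj.induction with
  | zero => exact zero
  | add x y hx hy => exact add _ _ hx hy
  | mk u v f m n => rw [← act_gen]; exact gen u v f m n

/-- Objectwise universal property of the Day convolution. -/
def descAt {X : Type*} [AddCommGroup X] [Module k X]
    (φ : ∀ u v : C, (u ⊗ v ⟶ c) →ₗ[k] M.val u →ₗ[k] N.val v →ₗ[k] X)
    (h : ∀ {u v u' v' : C} (a : u ⟶ u') (b : v ⟶ v') (f : u' ⊗ v' ⟶ c) (m : M.val u)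
      (n : N.val v), φ u v ((a ⊗ₘ b) ≫ f) m n = φ u' v' f (M.act a m) (N.act b n)) :
    (day M N).val c →ₗ[k] X :=
  DayCoend.desc φ h ∘ₗ (dayEquiv M N c).symm.toLinearMap

@[simp] lemma descAt_gen {X : Type*} [AddCommGroup X] [Module k X]
    (φ : ∀ u v : C, (u ⊗ v ⟶ c) →ₗ[k] M.val u →ₗ[k] N.val v →ₗ[k] X)
    (h : ∀ {u v u' v' : C} (a : u ⟶ u') (b : v ⟶ v') (f : u' ⊗ v' ⟶ c) (m : M.val u)
      (n : N.val v), φ u v ((a ⊗ₘ b) ≫ f) m n = φ u' v' f (M.act a m) (N.act b n))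
    (f : u ⊗ v ⟶ c) (m : M.val u) (n : N.val v) :
    descAt φ h ((day M N).act f (gen m n)) = φ u v f m n := by
  rw [act_gen]
  change DayCoend.desc φ h ((dayEquiv M N c).symm (dayEquiv M N c _)) = _
  rw [LinearEquiv.symm_apply_apply]
  exact DayCoend.desc_mk φ h f m n

end Day

variable (M N P : Rep k C)

/-- Natural families of bilinear maps `M(u) × N(v) → P(u ⊗ v)`. -/
structure Bil where
  /-- the components -/
  map : ∀ u v : C, M.val u →ₗ[k] N.val v →ₗ[k] P.val (u ⊗ v)
  map_act_left : ∀ {u u' : C} (v : C) (a : u ⟶ u') (m : M.val u) (n : N.val v),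
    map u' v (M.act a m) n = P.act (a ▷ v) (map u v m n)
  map_act_right : ∀ {v v' : C} (u : C) (b : v ⟶ v') (m : M.val u) (n : N.val v),
    map u v' m (N.act b n) = P.act (u ◁ b) (map u v m n)

namespace Day

variable {M N P}

/-- Morphisms out of the Day convolution are natural families of bilinear maps. -/
def desc (b : Bil M N P) : day M N ⟶ P :=
  Rep.mkHom (fun c => descAt (fun u v => LinearMap.mk₂ k
      (fun f m => P.act f ∘ₗ b.map u v m)
      (fun f f' m => by ext n; simp [Rep.act_add])
      (fun r f m => by ext n; simp [Rep.act_smul])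
      (fun f m m' => by ext n; simp)
      (fun r f m => by ext n; simp))
      (fun a a' f m n => by
        simp [b.map_act_left, b.map_act_right, MonoidalCategory.tensorHom_def']))
    (fun {c d} f x => by
      induction x using Day.induction with
      | zero => simp
      | add x y hx hy => simp only [map_add, hx, hy]
      | gen u v g m n => simp)

@[simp] lemma app_desc (b : Bil M N P) {u v : C} (m : M.val u) (n : N.val v) :
    Rep.app (desc b) (u ⊗ v) (gen m n) = b.map u v m n := by
  have := descAt_gen (M := M) (N := N) (c := u ⊗ v) (fun u v => LinearMap.mk₂ k
      (fun f m => P.act f ∘ₗ b.map u v m)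
      (fun f f' m => by ext n; simp [Rep.act_add])
      (fun r f m => by ext n; simp [Rep.act_smul])
      (fun f m m' => by ext n; simp)
      (fun r f m => by ext n; simp))
      (fun a a' f m n => by
        simp [b.map_act_left, b.map_act_right, MonoidalCategory.tensorHom_def']) (𝟙 _) m n
  simp only [Rep.act_id, LinearMap.mk₂_apply, LinearMap.comp_apply] at this
  exact this

lemma hom_ext {φ ψ : day M N ⟶ P}
    (h : ∀ (u v : C) (m : M.val u) (n : N.val v),
      Rep.app φ (u ⊗ v) (gen m n) = Rep.app ψ (u ⊗ v) (gen m n)) : φ = ψ := by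
  apply Rep.hom_ext'
  intro c x
  induction x using Day.induction with
  | zero => simp
  | add x y hx hy => simp only [map_add, hx, hy]
  | gen u v f m n => simp [h]

end Day

end Day

section Monoidal

variable {k : Type w} [CommRing k] {C : Type u₁} [Category.{w} C] [Preadditive C] [Linear k C]
  [MonoidalCategory C] [EssentiallySmall.{w} C]

/-- A map of three variables which is linear in each of them, as an iterated linear map. -/
def mkLinear₃ {X Y Z W : Type*} [AddCommGroup X] [AddCommGroup Y] [AddCommGroup Z]
    [AddCommGroup W] [Module k X] [Module k Y] [Module k Z] [Module k W] (f : X → Y → Z → W)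
    (add₁ : ∀ x x' y z, f (x + x') y z = f x y z + f x' y z)
    (smul₁ : ∀ (r : k) x y z, f (r • x) y z = r • f x y z)
    (add₂ : ∀ x y y' z, f x (y + y') z = f x y z + f x y' z)
    (smul₂ : ∀ (r : k) x y z, f x (r • y) z = r • f x y z)
    (add₃ : ∀ x y z z', f x y (z + z') = f x y z + f x y z')
    (smul₃ : ∀ (r : k) x y z, f x y (r • z) = r • f x y z) : X →ₗ[k] Y →ₗ[k] Z →ₗ[k] W :=
  LinearMap.mk₂ k (fun x y =>
      { toFun := fun z => f x y z
        map_add' := add₃ x y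
        map_smul' := fun r z => smul₃ r x y z })
    (fun x x' y => by ext z; exact add₁ x x' y z)
    (fun r x y => by ext z; exact smul₁ r x y z)
    (fun x y y' => by ext z; exact add₂ x y y' z)
    (fun r x y => by ext z; exact smul₂ r x y z)

@[simp] lemma mkLinear₃_apply {X Y Z W : Type*} [AddCommGroup X] [AddCommGroup Y] [AddCommGroup Z]
    [AddCommGroup W] [Module k X] [Module k Y] [Module k Z] [Module k W] (f : X → Y → Z → W)
    (add₁ : ∀ x x' y z, f (x + x') y z = f x y z + f x' y z)
    (smul₁ : ∀ (r : k) x y z, f (r • x) y z = r • f x y z)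
    (add₂ : ∀ x y y' z, f x (y + y') z = f x y z + f x y' z)
    (smul₂ : ∀ (r : k) x y z, f x (r • y) z = r • f x y z)
    (add₃ : ∀ x y z z', f x y (z + z') = f x y z + f x y z')
    (smul₃ : ∀ (r : k) x y z, f x y (r • z) = r • f x y z) (x : X) (y : Y) (z : Z) :
    mkLinear₃ f add₁ smul₁ add₂ smul₂ add₃ smul₃ x y z = f x y z := rfl

/-- Natural families of trilinear maps `M(u) × N(v) × P(w) → Q((u ⊗ v) ⊗ w)`. -/
structure Tri (M N P Q : Rep k C) where
  /-- the components -/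
  map : ∀ u v w : C, M.val u →ₗ[k] N.val v →ₗ[k] P.val w →ₗ[k] Q.val ((u ⊗ v) ⊗ w)
  map_act₁ : ∀ {u u' : C} (v w : C) (a : u ⟶ u') (m : M.val u) (n : N.val v) (p : P.val w),
    map u' v w (M.act a m) n p = Q.act (a ▷ v ▷ w) (map u v w m n p)
  map_act₂ : ∀ {v v' : C} (u w : C) (a : v ⟶ v') (m : M.val u) (n : N.val v) (p : P.val w),
    map u v' w m (N.act a n) p = Q.act ((u ◁ a) ▷ w) (map u v w m n p)
  map_act₃ : ∀ {w w' : C} (u v : C) (a : w ⟶ w') (m : M.val u) (n : N.val v) (p : P.val w),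
    map u v w' m n (P.act a p) = Q.act ((u ⊗ v) ◁ a) (map u v w m n p)

/-- Natural families of trilinear maps `M(u) × N(v) × P(w) → Q(u ⊗ (v ⊗ w))`. -/
structure Tri' (M N P Q : Rep k C) where
  /-- the components -/
  map : ∀ u v w : C, M.val u →ₗ[k] N.val v →ₗ[k] P.val w →ₗ[k] Q.val (u ⊗ (v ⊗ w))
  map_act₁ : ∀ {u u' : C} (v w : C) (a : u ⟶ u') (m : M.val u) (n : N.val v) (p : P.val w),
    map u' v w (M.act a m) n p = Q.act (a ▷ (v ⊗ w)) (map u v w m n p)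
  map_act₂ : ∀ {v v' : C} (u w : C) (a : v ⟶ v') (m : M.val u) (n : N.val v) (p : P.val w),
    map u v' w m (N.act a n) p = Q.act (u ◁ a ▷ w) (map u v w m n p)
  map_act₃ : ∀ {w w' : C} (u v : C) (a : w ⟶ w') (m : M.val u) (n : N.val v) (p : P.val w),
    map u v w' m n (P.act a p) = Q.act (u ◁ v ◁ a) (map u v w m n p)

namespace Day

variable {M N P Q : Rep k C}

/-- The bilinear family out of `M ⊗ N` and `P` induced by a trilinear family. -/
def bilOfTri [MonoidalPreadditive C] [MonoidalLinear k C] (t : Tri M N P Q) :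
    Bil (day M N) P Q where
  map c w := descAt (fun u v => mkLinear₃ (fun f m n => Q.act (f ▷ w) ∘ₗ t.map u v w m n)
      (fun f f' m n => by ext; simp [Rep.act_add])
      (fun r f m n => by ext; simp [Rep.act_smul])
      (fun f m m' n => by ext; simp)
      (fun r f m n => by ext; simp)
      (fun f m n n' => by ext; simp)
      (fun r f m n => by ext; simp))
    (fun a b f m n => by
      ext p
      simp [t.map_act₁, t.map_act₂, MonoidalCategory.tensorHom_def'])
  map_act_left v a x p := by
    induction x using Day.induction with
    | zero => simp
    | add x y hx hy => simp only [map_add, LinearMap.add_apply, hx, hy]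
    | gen u v g m n => simp
  map_act_right c b x p := by
    induction x using Day.induction with
    | zero => simp
    | add x y hx hy => simp only [map_add, LinearMap.add_apply, hx, hy]
    | gen u v g m n => simp [t.map_act₃, ← whisker_exchange]

@[simp] lemma bilOfTri_gen [MonoidalPreadditive C] [MonoidalLinear k C] (t : Tri M N P Q)
    {u v w : C} (m : M.val u) (n : N.val v) (p : P.val w) :
    (bilOfTri t).map (u ⊗ v) w (gen m n) p = t.map u v w m n p := by
  have := descAt_gen (fun u' v' => mkLinear₃ (fun (f : u' ⊗ v' ⟶ u ⊗ v) m n =>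
      Q.act (f ▷ w) ∘ₗ t.map u' v' w m n)
      (fun f f' m n => by ext; simp [Rep.act_add])
      (fun r f m n => by ext; simp [Rep.act_smul])
      (fun f m m' n => by ext; simp)
      (fun r f m n => by ext; simp)
      (fun f m n n' => by ext; simp)
      (fun r f m n => by ext; simp))
    (fun a b f m n => by
      ext p
      simp [t.map_act₁, t.map_act₂, MonoidalCategory.tensorHom_def']) (𝟙 _) m n
  simp only [Rep.act_id] at this
  refine (LinearMap.congr_fun this p).trans ?_
  simp

/-- The bilinear family out of `M` and `N ⊗ P` induced by a trilinear family. -/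
def bilOfTri' [MonoidalPreadditive C] [MonoidalLinear k C] (t : Tri' M N P Q) :
    Bil M (day N P) Q where
  map u c := (descAt (fun v w => mkLinear₃ (fun f n p => Q.act (u ◁ f) ∘ₗ
        ((t.map u v w).flip n).flip p)
      (fun f f' m n => by ext; simp [Rep.act_add])
      (fun r f m n => by ext; simp [Rep.act_smul])
      (fun f m m' n => by ext; simp)
      (fun r f m n => by ext; simp)
      (fun f m n n' => by ext; simp)
      (fun r f m n => by ext; simp))
    (fun a b f m n => by
      ext p
      simp [t.map_act₂, t.map_act₃, MonoidalCategory.tensorHom_def'])).flip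
  map_act_left v a m x := by
    induction x using Day.induction with
    | zero => simp
    | add x y hx hy => simp only [map_add, hx, hy]
    | gen u v g m n => simp [t.map_act₁, whisker_exchange]
  map_act_right u b m x := by
    induction x using Day.induction with
    | zero => simp
    | add x y hx hy => simp only [map_add, hx, hy]
    | gen u v g m n => simp

@[simp] lemma bilOfTri'_gen [MonoidalPreadditive C] [MonoidalLinear k C] (t : Tri' M N P Q)
    {u v w : C} (m : M.val u) (n : N.val v) (p : P.val w) :
    (bilOfTri' t).map u (v ⊗ w) m (gen n p) = t.map u v w m n p := by
  have := descAt_gen (fun v' w' => mkLinear₃ (fun (f : v' ⊗ w' ⟶ v ⊗ w) n p => Q.act (u ◁ f) ∘ₗ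
        ((t.map u v' w').flip n).flip p)
      (fun f f' m n => by ext; simp [Rep.act_add])
      (fun r f m n => by ext; simp [Rep.act_smul])
      (fun f m m' n => by ext; simp)
      (fun r f m n => by ext; simp)
      (fun f m n n' => by ext; simp)
      (fun r f m n => by ext; simp))
    (fun a b f m n => by
      ext p
      simp [t.map_act₂, t.map_act₃, MonoidalCategory.tensorHom_def']) (𝟙 _) n p
  simp only [Rep.act_id] at this
  refine (LinearMap.congr_fun this m).trans ?_
  simp

lemma hom_ext₃ {φ ψ : day (day M N) P ⟶ Q}
    (h : ∀ (u v w : C) (m : M.val u) (n : N.val v) (p : P.val w),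
      Rep.app φ ((u ⊗ v) ⊗ w) (gen (gen m n) p) = Rep.app ψ ((u ⊗ v) ⊗ w) (gen (gen m n) p)) :
    φ = ψ := by
  apply hom_ext
  intro c w x p
  induction x using Day.induction with
  | zero => simp
  | add x y hx hy => simp only [map_add, hx, hy, add_gen]
  | gen u v f m n => simp [h]

lemma hom_ext₃' {φ ψ : day M (day N P) ⟶ Q}
    (h : ∀ (u v w : C) (m : M.val u) (n : N.val v) (p : P.val w),
      Rep.app φ (u ⊗ (v ⊗ w)) (gen m (gen n p)) = Rep.app ψ (u ⊗ (v ⊗ w)) (gen m (gen n p))) :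
    φ = ψ := by
  apply hom_ext
  intro c w x p
  induction p using Day.induction with
  | zero => simp
  | add x y hx hy => simp only [map_add, hx, hy, gen_add]
  | gen u v f m n => simp [h]

lemma hom_ext₄ {R : Rep k C} {φ ψ : day (day (day M N) P) R ⟶ Q}
    (h : ∀ (u v w x : C) (m : M.val u) (n : N.val v) (p : P.val w) (r : R.val x),
      Rep.app φ (((u ⊗ v) ⊗ w) ⊗ x) (gen (gen (gen m n) p) r) =
        Rep.app ψ (((u ⊗ v) ⊗ w) ⊗ x) (gen (gen (gen m n) p) r)) :
    φ = ψ := by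
  apply hom_ext₃
  intro c w x y p r
  induction y using Day.induction with
  | zero => simp
  | add x y hx hy => simp only [map_add, hx, hy, add_gen]
  | gen u v f m n => simp [h]

/-- The functoriality of the Day convolution. -/
def map {M' N' : Rep k C} (φ : M ⟶ M') (ψ : N ⟶ N') : day M N ⟶ day M' N' :=
  desc
    { map := fun u v => LinearMap.mk₂ k (fun m n => gen (Rep.app φ u m) (Rep.app ψ v n))
        (by simp) (by simp) (by simp) (by simp)
      map_act_left := by simp
      map_act_right := by simp }

@[simp] lemma app_map {M' N' : Rep k C} (φ : M ⟶ M') (ψ : N ⟶ N') {u v : C} (m : M.val u)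
    (n : N.val v) :
    Rep.app (map φ ψ) (u ⊗ v) (gen m n) = gen (Rep.app φ u m) (Rep.app ψ v n) := by
  simp [map]

variable [MonoidalPreadditive C] [MonoidalLinear k C]

variable (k C) in
/-- The unit of the Day convolution: the representation `C(𝟙, -)`. -/
def unit : Rep k C :=
  ⟨(linearCoyoneda k C).obj (Opposite.op (𝟙_ C)), inferInstance,
    ⟨fun {_ _} f r => by ext x; exact Linear.comp_smul _ _ _ _ _ _⟩⟩

/-- An element of the unit representation `C(𝟙, -)` at `c` is a morphism `𝟙 ⟶ c`. -/
def unit.mk {c : C} (f : 𝟙_ C ⟶ c) : (unit k C).val c := f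

/-- An element of the unit representation `C(𝟙, -)` at `c` is a morphism `𝟙 ⟶ c`. -/
def unit.hom {c : C} (x : (unit k C).val c) : 𝟙_ C ⟶ c := x

@[simp] lemma unit.hom_add {c : C} (x y : (unit k C).val c) :
    unit.hom (x + y) = unit.hom x + unit.hom y := rfl
@[simp] lemma unit.hom_smul {c : C} (r : k) (x : (unit k C).val c) :
    unit.hom (r • x) = r • unit.hom x := rfl
@[simp] lemma unit.hom_act {c d : C} (f : c ⟶ d) (x : (unit k C).val c) :
    unit.hom ((unit k C).act f x) = unit.hom x ≫ f := rfl
@[simp] lemma unit.hom_mk {c : C} (f : 𝟙_ C ⟶ c) : unit.hom (k := k) (unit.mk f) = f := rfl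
lemma unit.mk_hom {c : C} (x : (unit k C).val c) :
    x = (unit k C).act (unit.hom x) (unit.mk (𝟙 _)) := (Category.id_comp (unit.hom x)).symm

variable (M N P) in
/-- The left unitor of the Day convolution. -/
def leftUnitor : day (unit k C) M ≅ M where
  hom := desc
    { map := fun u v => LinearMap.mk₂ k (fun f m => M.act ((λ_ v).inv ≫ unit.hom f ▷ v) m)
        (by simp [Rep.act_add]) (by simp [Rep.act_smul]) (by simp) (by simp)
      map_act_left := by simp
      map_act_right := by simp [← whisker_exchange] }
  inv := Rep.mkHom (fun c =>
      { toFun := fun m => (day (unit k C) M).act (λ_ c).hom (gen (unit.mk (𝟙 _)) m)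
        map_add' := by simp
        map_smul' := by simp })
      (fun f m => by simp)
  hom_inv_id := by
    apply hom_ext
    intro u v x m
    rw [unit.mk_hom x]
    simp
  inv_hom_id := by
    apply Rep.hom_ext'
    intro c m
    simp

variable (M N P) in
/-- The right unitor of the Day convolution. -/
def rightUnitor : day M (unit k C) ≅ M where
  hom := desc
    { map := fun u v => LinearMap.mk₂ k (fun m f => M.act ((ρ_ u).inv ≫ u ◁ unit.hom f) m)
        (by simp) (by simp) (by simp [Rep.act_add]) (by simp [Rep.act_smul])
      map_act_left := by simp [whisker_exchange]
      map_act_right := by simp }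
  inv := Rep.mkHom (fun c =>
      { toFun := fun m => (day M (unit k C)).act (ρ_ c).hom (gen m (unit.mk (𝟙 _)))
        map_add' := by simp
        map_smul' := by simp })
      (fun f m => by simp)
  hom_inv_id := by
    apply hom_ext
    intro u v m x
    rw [unit.mk_hom x]
    simp
  inv_hom_id := by
    apply Rep.hom_ext'
    intro c m
    simp

variable (M N P) in
/-- The associator of the Day convolution. -/
def associator : day (day M N) P ≅ day M (day N P) where
  hom := desc (bilOfTri
    { map := fun u v w => mkLinear₃
        (fun m n p => (day M (day N P)).act (α_ u v w).inv (gen m (gen n p)))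
        (by simp) (by simp) (by simp) (by simp) (by simp) (by simp)
      map_act₁ := by simp
      map_act₂ := by simp
      map_act₃ := by simp })
  inv := desc (bilOfTri'
    { map := fun u v w => mkLinear₃
        (fun m n p => (day (day M N) P).act (α_ u v w).hom (gen (gen m n) p))
        (by simp) (by simp) (by simp) (by simp) (by simp) (by simp)
      map_act₁ := by simp
      map_act₂ := by simp
      map_act₃ := by simp })
  hom_inv_id := by
    apply hom_ext₃
    simp
  inv_hom_id := by
    apply hom_ext₃'
    simp

@[simp] lemma app_associator_hom {u v w : C} (m : M.val u) (n : N.val v) (p : P.val w) :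
    Rep.app (associator M N P).hom _ (gen (gen m n) p) =
      (day M (day N P)).act (α_ u v w).inv (gen m (gen n p)) := by
  simp [associator]

@[simp] lemma app_leftUnitor_hom {u v : C} (x : (unit k C).val u) (m : M.val v) :
    Rep.app (leftUnitor M).hom _ (gen x m) = M.act ((λ_ v).inv ≫ unit.hom x ▷ v) m := by
  simp [leftUnitor]

@[simp] lemma app_rightUnitor_hom {u v : C} (x : (unit k C).val u) (m : M.val v) :
    Rep.app (rightUnitor M).hom _ (gen m x) = M.act ((ρ_ v).inv ≫ v ◁ unit.hom x) m := by
  simp [rightUnitor]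

end Day

variable [MonoidalPreadditive C] [MonoidalLinear k C]

/-- The Day convolution monoidal structure on representations. -/
instance : MonoidalCategory (Rep k C) where
  tensorObj M N := day M N
  whiskerLeft M _ _ ψ := Day.map (𝟙 M) ψ
  whiskerRight φ N := Day.map φ (𝟙 N)
  tensorHom φ ψ := Day.map φ ψ
  tensorUnit := Day.unit k C
  associator M N P := Day.associator M N P
  leftUnitor M := Day.leftUnitor M
  rightUnitor M := Day.rightUnitor M
  tensorHom_def _ _ := Day.hom_ext (by simp)
  id_tensorHom_id _ _ := Day.hom_ext (by simp)
  tensorHom_comp_tensorHom _ _ _ _ := Day.hom_ext (by simp)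
  whiskerLeft_id _ _ := Day.hom_ext (by simp)
  id_whiskerRight _ _ := Day.hom_ext (by simp)
  associator_naturality _ _ _ := Day.hom_ext₃ (by simp)
  leftUnitor_naturality _ := Day.hom_ext (by simp)
  rightUnitor_naturality _ := Day.hom_ext (by simp)
  pentagon _ _ _ _ := Day.hom_ext₄ (by
    intros
    simp)
  triangle _ _ := Day.hom_ext₃ (by
    intros
    simp)

end Monoidal

section Symmetric

variable {k : Type w} [CommRing k] {C : Type u₁} [Category.{w} C] [Preadditive C] [Linear k C]
  [MonoidalCategory C] [EssentiallySmall.{w} C] [MonoidalPreadditive C] [MonoidalLinear k C]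

namespace Day

variable {M M' N N' P Q : Rep k C} {u v x : C}

/-- The universal family `M(u) × N(v) → (M ⊗ N)(u ⊗ v)`, `(m, n) ↦ [id, m, n]_{u,v}`. -/
def tmul (m : M.val u) (n : N.val v) : (M ⊗ N).val (u ⊗ v) := gen m n

section
variable (m m' : M.val u) (n n' : N.val v) (r : k)

@[simp] lemma tmul_add : tmul m (n + n') = tmul m n + tmul m n' := gen_add m n n'
@[simp] lemma add_tmul : tmul (m + m') n = tmul m n + tmul m' n := add_gen m m' n
@[simp] lemma tmul_smul : tmul m (r • n) = r • tmul m n := gen_smul r m n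
@[simp] lemma smul_tmul : tmul (r • m) n = r • tmul m n := smul_gen r m n
@[simp] lemma tmul_zero : tmul m (0 : N.val v) = 0 := gen_zero m
@[simp] lemma zero_tmul : tmul (0 : M.val u) n = 0 := zero_gen n

@[simp] lemma tmul_act {v' : C} (b : v ⟶ v') :
    tmul m (N.act b n) = (M ⊗ N).act (u ◁ b) (tmul m n) := gen_act b m n

@[simp] lemma act_tmul {u' : C} (a : u ⟶ u') :
    tmul (M.act a m) n = (M ⊗ N).act (a ▷ v) (tmul m n) := gen_act_left a m n

end

lemma tensor_hom_ext {φ ψ : M ⊗ N ⟶ P}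
    (h : ∀ (u v : C) (m : M.val u) (n : N.val v),
      Rep.app φ (u ⊗ v) (tmul m n) = Rep.app ψ (u ⊗ v) (tmul m n)) : φ = ψ :=
  hom_ext h

lemma tensor_hom_ext₃ {φ ψ : (M ⊗ N) ⊗ P ⟶ Q}
    (h : ∀ (u v w : C) (m : M.val u) (n : N.val v) (p : P.val w),
      Rep.app φ ((u ⊗ v) ⊗ w) (tmul (tmul m n) p) =
        Rep.app ψ ((u ⊗ v) ⊗ w) (tmul (tmul m n) p)) : φ = ψ :=
  hom_ext₃ h

lemma tensor_hom_ext₃' {φ ψ : M ⊗ (N ⊗ P) ⟶ Q}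
    (h : ∀ (u v w : C) (m : M.val u) (n : N.val v) (p : P.val w),
      Rep.app φ (u ⊗ (v ⊗ w)) (tmul m (tmul n p)) =
        Rep.app ψ (u ⊗ (v ⊗ w)) (tmul m (tmul n p))) : φ = ψ :=
  hom_ext₃' h

/-- Morphisms out of `M ⊗ N` are natural families of bilinear maps. -/
def tensorDesc (b : Bil M N P) : M ⊗ N ⟶ P := desc b

@[simp] lemma app_tensorDesc (b : Bil M N P) (m : M.val u) (n : N.val v) :
    Rep.app (tensorDesc b) (u ⊗ v) (tmul m n) = b.map u v m n := app_desc b m n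

@[simp] lemma app_whiskerRight (φ : M ⟶ M') (m : M.val u) (n : N.val v) :
    Rep.app (φ ▷ N) (u ⊗ v) (tmul m n) = tmul (Rep.app φ u m) n :=
  (app_map φ (𝟙 N) m n).trans (by simp; rfl)

@[simp] lemma app_whiskerLeft (ψ : N ⟶ N') (m : M.val u) (n : N.val v) :
    Rep.app (M ◁ ψ) (u ⊗ v) (tmul m n) = tmul m (Rep.app ψ v n) :=
  (app_map (𝟙 M) ψ m n).trans (by simp; rfl)

@[simp] lemma app_α_hom (m : M.val u) (n : N.val v) (p : P.val x) :
    Rep.app (α_ M N P).hom ((u ⊗ v) ⊗ x) (tmul (tmul m n) p) =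
      (M ⊗ (N ⊗ P)).act (α_ u v x).inv (tmul m (tmul n p)) :=
  app_associator_hom m n p

@[simp] lemma app_α_inv (m : M.val u) (n : N.val v) (p : P.val x) :
    Rep.app (α_ M N P).inv (u ⊗ v ⊗ x) (tmul m (tmul n p)) =
      ((M ⊗ N) ⊗ P).act (α_ u v x).hom (tmul (tmul m n) p) := by
  have h : Rep.app (α_ M N P).inv _ (Rep.app (α_ M N P).hom _
      (((M ⊗ N) ⊗ P).act (α_ u v x).hom (tmul (tmul m n) p))) =
        ((M ⊗ N) ⊗ P).act (α_ u v x).hom (tmul (tmul m n) p) := by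
    rw [← Rep.app_comp, Iso.hom_inv_id, Rep.app_id]
  rw [Rep.app_act, app_α_hom, Rep.act_act, Iso.inv_hom_id, Rep.act_id] at h
  exact h

@[simp] lemma app_lambda_hom (y : (𝟙_ (Rep k C)).val u) (m : M.val v) :
    Rep.app (λ_ M).hom (u ⊗ v) (tmul y m) = M.act ((λ_ v).inv ≫ unit.hom y ▷ v) m :=
  app_leftUnitor_hom y m

@[simp] lemma app_rho_hom (y : (𝟙_ (Rep k C)).val u) (m : M.val v) :
    Rep.app (ρ_ M).hom (v ⊗ u) (tmul m y) = M.act ((ρ_ v).inv ≫ v ◁ unit.hom y) m :=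
  app_rightUnitor_hom y m

variable (M N) in
/-- The symmetry of the Day convolution, in one direction. -/
def braidingHom [SymmetricCategory C] : M ⊗ N ⟶ N ⊗ M :=
  tensorDesc
    { map := fun u v => LinearMap.mk₂ k (fun m n => (N ⊗ M).act (β_ v u).hom (tmul n m))
        (by simp) (by simp) (by simp) (by simp)
      map_act_left := by simp
      map_act_right := by simp }

@[simp] lemma app_braidingHom [SymmetricCategory C] (m : M.val u) (n : N.val v) :
    Rep.app (braidingHom M N) (u ⊗ v) (tmul m n) = (N ⊗ M).act (β_ v u).hom (tmul n m) := by
  simp [braidingHom]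

end Day

instance : MonoidalPreadditive (Rep k C) where
  whiskerLeft_zero := Day.tensor_hom_ext (by simp)
  zero_whiskerRight := Day.tensor_hom_ext (by simp)
  whiskerLeft_add _ _ := Day.tensor_hom_ext (by simp)
  add_whiskerRight _ _ := Day.tensor_hom_ext (by simp)

instance : MonoidalLinear k (Rep k C) where
  whiskerLeft_smul _ _ _ _ _ := Day.tensor_hom_ext (by simp)
  smul_whiskerRight _ _ _ _ _ := Day.tensor_hom_ext (by simp)

/-- The symmetric structure on representations. -/
instance [SymmetricCategory C] : SymmetricCategory (Rep k C) where
  braiding M N :=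
    { hom := Day.braidingHom M N
      inv := Day.braidingHom N M
      hom_inv_id := Day.tensor_hom_ext (by simp)
      inv_hom_id := Day.tensor_hom_ext (by simp) }
  braiding_naturality_right _ _ _ _ := Day.tensor_hom_ext (by simp)
  braiding_naturality_left _ _ := Day.tensor_hom_ext (by simp)
  hexagon_forward _ _ _ := Day.tensor_hom_ext₃ (by intros; simp)
  hexagon_reverse _ _ _ := Day.tensor_hom_ext₃' (by intros; simp)
  symmetry _ _ := Day.tensor_hom_ext (by simp)

@[simp] lemma Day.app_β_hom [SymmetricCategory C] {M N : Rep k C} {u v : C} (m : M.val u)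
    (n : N.val v) :
    Rep.app (β_ M N).hom (u ⊗ v) (tmul m n) = (N ⊗ M).act (β_ v u).hom (tmul n m) :=
  Day.app_braidingHom m n

end Symmetric

section Colimits

variable {k : Type w} [CommRing k] {C : Type u₁} [Category.{w} C] [Preadditive C] [Linear k C]

instance (J : Type*) [Category* J] [HasColimitsOfShape J (ModuleCat.{w} k)] :
    (isLinear k C).IsClosedUnderColimitsOfShape J where
  colimitsOfShape_le := by
    rintro M ⟨h⟩
    have hh (c : C) := isColimitOfPreserves ((evaluation C (ModuleCat.{w} k)).obj c) h.isColimit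
    have (j : J) : (h.diag.obj j).Additive := (h.prop_diag_obj j).1
    have (j : J) : (h.diag.obj j).Linear k := (h.prop_diag_obj j).2
    constructor
    · constructor
      intro c d f g
      apply (hh c).hom_ext
      intro j
      have e (f : c ⟶ d) := ((h.ι.app j).naturality f).symm
      dsimp at e ⊢
      rw [Preadditive.comp_add, e, e, e, Functor.map_add, Preadditive.add_comp]
    · constructor
      intro c d f r
      apply (hh c).hom_ext
      intro j
      have e (f : c ⟶ d) := ((h.ι.app j).naturality f).symm
      dsimp at e ⊢
      rw [Linear.comp_smul, e, e, Functor.map_smul, Linear.smul_comp]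

instance : HasColimitsOfSize.{0, 0} (ModuleCat.{w} k) :=
  hasColimitsOfSizeShrink.{0, 0, w, w} _


/-- The representation `P(u ⊗ -)`. -/
def shiftLeft [MonoidalCategory C] [MonoidalPreadditive C] [MonoidalLinear k C] (P : Rep k C)
    (u : C) : Rep k C :=
  ⟨tensorLeft u ⋙ P.obj, inferInstance, inferInstance⟩

end Colimits

section Preserves

variable {k : Type w} [CommRing k] {C : Type u₁} [Category.{w} C] [Preadditive C] [Linear k C]
  [MonoidalCategory C] [EssentiallySmall.{w} C] [MonoidalPreadditive C] [MonoidalLinear k C]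

variable {M N P : Rep k C}

/-- For `m ∈ M(u)`, the morphism `N ⟶ P(u ⊗ -)` obtained by currying `M ⊗ N ⟶ P`. -/
def curryAt (φ : M ⊗ N ⟶ P) {u : C} (m : M.val u) : N ⟶ shiftLeft P u :=
  Rep.mkHom (fun v =>
      { toFun := fun n => Rep.app φ (u ⊗ v) (Day.tmul m n)
        map_add' := fun n n' => by rw [Day.tmul_add]; exact map_add _ _ _
        map_smul' := fun r n => by rw [Day.tmul_smul]; exact map_smul _ _ _ })
    (fun f n => by
      change Rep.app φ _ (Day.tmul m (N.act f n)) = P.act (u ◁ f) (Rep.app φ _ (Day.tmul m n))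
      simp)

lemma app_curryAt (φ : M ⊗ N ⟶ P) {u v : C} (m : M.val u) (n : N.val v) :
    Rep.app (curryAt φ m) v n = Rep.app φ (u ⊗ v) (Day.tmul m n) := rfl

lemma curryAt_add (φ : M ⊗ N ⟶ P) {u : C} (m m' : M.val u) :
    curryAt φ (m + m') = curryAt φ m + curryAt φ m' :=
  Rep.hom_ext' fun c n => by
    simp only [Rep.app_add, app_curryAt, Day.add_tmul]
    exact map_add _ _ _

lemma curryAt_smul (φ : M ⊗ N ⟶ P) {u : C} (r : k) (m : M.val u) :
    curryAt φ (r • m) = r • curryAt φ m :=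
  Rep.hom_ext' fun c n => by
    simp only [Rep.app_smul, app_curryAt, Day.smul_tmul]
    exact map_smul _ _ _

/-- The morphism `P(u ⊗ -) ⟶ P(u' ⊗ -)` induced by `u ⟶ u'`. -/
def shiftMap (P : Rep k C) {u u' : C} (a : u ⟶ u') : shiftLeft P u ⟶ shiftLeft P u' :=
  Rep.mkHom (fun v => P.act (a ▷ v)) (fun f p => by
    refine (Rep.act_act P (u ◁ f) (a ▷ _) p).trans ?_
    rw [whisker_exchange]
    exact (Rep.act_act P (a ▷ _) (u' ◁ f) p).symm)

lemma app_shiftMap {u u' v : C} (a : u ⟶ u') (p : P.val (u ⊗ v)) :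
    Rep.app (shiftMap P a) v p = P.act (a ▷ v) p := rfl

lemma curryAt_act (φ : M ⊗ N ⟶ P) {u u' : C} (a : u ⟶ u') (m : M.val u) :
    curryAt φ (M.act a m) = curryAt φ m ≫ shiftMap P a :=
  Rep.hom_ext' fun c n => by
    rw [Rep.app_comp, app_curryAt, app_curryAt, Day.act_tmul]
    exact Rep.app_act _ _ _

/-- The Day convolution preserves colimits in the second variable. -/
instance (J : Type*) [Category* J] (M : Rep k C) : PreservesColimitsOfShape J (tensorLeft M) where
  preservesColimit {K} :=
    { preserves := fun {c} hc => ⟨by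
        let φ (s : Cocone (K ⋙ tensorLeft M)) {u : C} (m : M.val u) : c.pt ⟶ shiftLeft s.pt u :=
          hc.desc
            { pt := shiftLeft s.pt u
              ι :=
                { app := fun j => curryAt (s.ι.app j) m
                  naturality := fun j j' f => by
                    apply Rep.hom_ext'
                    intro c n
                    have := congrArg (fun t => Rep.app t _ (Day.tmul m n)) (s.w f)
                    refine Eq.trans ?_ this
                    change Rep.app (s.ι.app j') _ (Day.tmul m (Rep.app (K.map f) c n)) =
                      Rep.app (s.ι.app j') _ (Rep.app (M ◁ K.map f) _ (Day.tmul m n))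
                    rw [Day.app_whiskerLeft] } }
        have hφ (s : Cocone (K ⋙ tensorLeft M)) {u : C} (m : M.val u) (j : J) :
            c.ι.app j ≫ φ s m = curryAt (s.ι.app j) m := hc.fac _ j
        let b (s : Cocone (K ⋙ tensorLeft M)) : Bil M c.pt s.pt :=
          { map := fun u v => LinearMap.mk₂ k (fun m n => Rep.app (φ s m) v n)
              (fun m m' n => by
                have : φ s (m + m') = φ s m + φ s m' := hc.hom_ext fun j => by
                  rw [Preadditive.comp_add, hφ, hφ, hφ, curryAt_add]
                rw [this]; rfl)
              (fun r m n => by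
                have : φ s (r • m) = r • φ s m := hc.hom_ext fun j => by
                  rw [Linear.comp_smul, hφ, hφ, curryAt_smul]
                rw [this]; rfl)
              (fun m n n' => map_add _ _ _)
              (fun r m n => map_smul _ _ _)
            map_act_left := fun v a m n => by
              have : φ s (M.act a m) = φ s m ≫ shiftMap s.pt a := hc.hom_ext fun j => by
                rw [← Category.assoc, hφ, hφ, curryAt_act]
                rfl
              exact congrArg (fun t => Rep.app t v n) this
            map_act_right := fun u b m n => Rep.app_act (φ s m) b n }
        let ψ (s : Cocone (K ⋙ tensorLeft M)) : M ⊗ c.pt ⟶ s.pt := Day.tensorDesc (b s)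
        exact
        { desc := ψ
          fac := fun s j => by
            apply Day.tensor_hom_ext
            intro u v m n
            have h1 := congrArg (fun t => Rep.app t v n) (hφ s m j)
            refine Eq.trans ?_ h1
            refine (Rep.app_comp _ _ _ _).trans ?_
            refine (congrArg (Rep.app (ψ s) (u ⊗ v)) (Day.app_whiskerLeft (c.ι.app j) m n)).trans ?_
            exact Day.app_tensorDesc (b s) m (Rep.app (c.ι.app j) v n)
          uniq := fun s t ht => by
            apply Day.tensor_hom_ext
            intro u v m n
            have : curryAt t m = φ s m := hc.hom_ext fun j => by
              rw [hφ]
              apply Rep.hom_ext'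
              intro x y
              rw [← ht]
              simp only [Rep.app_comp, app_curryAt]
              exact congrArg (Rep.app t _) (Day.app_whiskerLeft (c.ι.app j) m y).symm
            have h1 := congrArg (fun t => Rep.app t v n) this
            refine Eq.trans h1 ?_
            exact (Day.app_tensorDesc (b s) m n).symm }⟩ }

instance (J : Type*) [Category* J] [SymmetricCategory C] (M : Rep k C) :
    PreservesColimitsOfShape J (tensorRight M) :=
  preservesColimitsOfShape_of_natIso (BraidedCategory.tensorLeftIsoTensorRight M)

end Preserves

section Modules

open scoped MonObj

variable {V : Type u} [Category.{v} V] [MonoidalCategory V] {A : V} [MonObj A]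

namespace Modu

lemma smul_hom' {M N : Mod V A} (f : M ⟶ N) :
    γ[A, M.X] ≫ f.hom = A ◁ f.hom ≫ γ[A, N.X] := IsModHom.smul_hom (A := A) (f := f.hom)

section
variable [Preadditive V] [MonoidalPreadditive V] {M N : Mod V A}

instance : Zero (M ⟶ N) := ⟨Mod.Hom.mk' 0 (by
  change _ = A ◁ (0 : M.X ⟶ N.X) ≫ _
  simp)⟩

instance : Add (M ⟶ N) := ⟨fun f g => Mod.Hom.mk' (f.hom + g.hom) (by
  change _ = A ◁ (f.hom + g.hom) ≫ _
  rw [Preadditive.comp_add, smul_hom', smul_hom', MonoidalPreadditive.whiskerLeft_add,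
    Preadditive.add_comp])⟩

instance : Neg (M ⟶ N) := ⟨fun f => Mod.Hom.mk' (-f.hom) (by
  have h : A ◁ (-f.hom) = -(A ◁ f.hom) := (tensorLeft A).map_neg
  change _ = A ◁ (-f.hom) ≫ _
  rw [Preadditive.comp_neg, smul_hom', h, Preadditive.neg_comp])⟩

instance : AddCommGroup (M ⟶ N) where
  nsmul := nsmulRec
  zsmul := zsmulRec
  add_assoc _ _ _ := Mod.hom_ext _ _ (add_assoc _ _ _)
  zero_add _ := Mod.hom_ext _ _ (zero_add _)
  add_zero _ := Mod.hom_ext _ _ (add_zero _)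
  neg_add_cancel _ := Mod.hom_ext _ _ (neg_add_cancel _)
  add_comm _ _ := Mod.hom_ext _ _ (add_comm _ _)

end

/-- Modules over a monoid in a preadditive monoidal category form a preadditive category. -/
instance [Preadditive V] [MonoidalPreadditive V] : Preadditive (Mod V A) where
  add_comp _ _ _ _ _ _ := Mod.hom_ext _ _ (Preadditive.add_comp _ _ _ _ _ _)
  comp_add _ _ _ _ _ _ := Mod.hom_ext _ _ (Preadditive.comp_add _ _ _ _ _ _)

@[simp] lemma add_hom [Preadditive V] [MonoidalPreadditive V] {M N : Mod V A} (f g : M ⟶ N) :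
    (f + g).hom = f.hom + g.hom := rfl

/-- Modules over a monoid in a linear monoidal category form a linear category. -/
instance {k : Type w} [CommRing k] [Preadditive V] [MonoidalPreadditive V] [Linear k V]
    [MonoidalLinear k V] : Linear k (Mod V A) where
  homModule M N :=
    { smul := fun r f => Mod.Hom.mk' (r • f.hom) (by
        change _ = A ◁ (r • f.hom) ≫ _
        rw [Linear.comp_smul, smul_hom', MonoidalLinear.whiskerLeft_smul, Linear.smul_comp])
      one_smul := fun _ => Mod.hom_ext _ _ (one_smul _ _)
      mul_smul := fun _ _ _ => Mod.hom_ext _ _ (mul_smul _ _ _)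
      smul_zero := fun _ => Mod.hom_ext _ _ (smul_zero _)
      smul_add := fun _ _ _ => Mod.hom_ext _ _ (smul_add _ _ _)
      add_smul := fun _ _ _ => Mod.hom_ext _ _ (add_smul _ _ _)
      zero_smul := fun _ => Mod.hom_ext _ _ (zero_smul _ _) }
  smul_comp _ _ _ _ _ _ := Mod.hom_ext _ _ (Linear.smul_comp _ _ _ _ _ _)
  comp_smul _ _ _ _ _ _ := Mod.hom_ext _ _ (Linear.comp_smul _ _ _ _ _ _)

@[simp] lemma smul_hom {k : Type w} [CommRing k] [Preadditive V] [MonoidalPreadditive V]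
    [Linear k V] [MonoidalLinear k V] {M N : Mod V A} (r : k) (f : M ⟶ N) :
    (r • f).hom = r • f.hom := rfl

/-- The action of a module, as a morphism in the ambient category. -/
abbrev la (M : Mod V A) : A ⊗ M.X ⟶ M.X := γ[A, M.X]

lemma one_la (M : Mod V A) : η ▷ M.X ≫ la M = (λ_ M.X).hom := ModObj.one_smul_self A M.X

lemma mul_la (M : Mod V A) : μ ▷ M.X ≫ la M = (α_ A A M.X).hom ≫ A ◁ la M ≫ la M :=
  ModObj.mul_smul_self A M.X

/-- Constructor for modules. -/
abbrev mkMod (X : V) (a : A ⊗ X ⟶ X) (one : η ▷ X ≫ a = (λ_ X).hom)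
    (mul : μ ▷ X ≫ a = (α_ A A X).hom ≫ A ◁ a ≫ a) : Mod V A :=
  { X := X
    mod := { smul := a, one_smul := one, mul_smul := mul } }

/-- Constructor for morphisms of modules. -/
abbrev mkHom {M N : Mod V A} (f : M.X ⟶ N.X) (h : la M ≫ f = A ◁ f ≫ la N) : M ⟶ N :=
  Mod.Hom.mk' f h

/-- Isomorphisms of modules from isomorphisms of the underlying objects. -/
def mkIso {M N : Mod V A} (f : M.X ≅ N.X) (h : la M ≫ f.hom = A ◁ f.hom ≫ la N) : M ≅ N where
  hom := mkHom f.hom h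
  inv := mkHom f.inv (by
    rw [Iso.comp_inv_eq, Category.assoc, h, ← whiskerLeft_comp_assoc, Iso.inv_hom_id]
    simp)
  hom_inv_id := Mod.hom_ext _ _ f.hom_inv_id
  inv_hom_id := Mod.hom_ext _ _ f.inv_hom_id

variable (A) in
/-- The free module functor `X ↦ A ⊗ X`. -/
def free : V ⥤ Mod V A where
  obj X := mkMod (A ⊗ X) ((α_ A A X).inv ≫ μ ▷ X)
    (by
      rw [associator_inv_naturality_left_assoc, ← comp_whiskerRight, MonObj.one_mul]
      simp)
    (by
      rw [associator_inv_naturality_left_assoc, ← comp_whiskerRight, MonObj.mul_assoc]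
      simp)
  map {X Y} f := mkHom (A ◁ f) (by
    change ((α_ A A X).inv ≫ μ ▷ X) ≫ _ = _ ≫ ((α_ A A Y).inv ≫ μ ▷ Y)
    rw [Category.assoc, ← whisker_exchange, associator_inv_naturality_right_assoc])
  map_id X := Mod.hom_ext _ _ (by simp)
  map_comp f g := Mod.hom_ext _ _ (by simp)

section Tensor

variable [SymmetricCategory V] (M N P : Mod V A)

/-- The right action `M ⊗ A → M` of a commutative monoid on a left module. -/
def ra : M.X ⊗ A ⟶ M.X := (β_ M.X A).hom ≫ la M

variable {M N} in
lemma ra_nat (f : M ⟶ N) : ra M ≫ f.hom = f.hom ▷ A ≫ ra N := by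
  rw [ra, ra, Category.assoc, smul_hom', BraidedCategory.braiding_naturality_left_assoc]

/-- The left and right actions commute. -/
lemma la_ra [IsCommMonObj A] :
    la M ▷ A ≫ ra M = (α_ A M.X A).hom ≫ A ◁ ra M ≫ la M := by
  have h1 : A ◁ la M ≫ la M = (α_ A A M.X).inv ≫ μ ▷ M.X ≫ la M := by rw [mul_la]; simp
  rw [ra, BraidedCategory.braiding_naturality_left_assoc, h1, whiskerLeft_comp, Category.assoc, h1,
    BraidedCategory.braiding_tensor_left_hom]
  simp only [Category.assoc, Iso.hom_inv_id_assoc]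
  rw [← comp_whiskerRight_assoc, IsCommMonObj.mul_comm]

/-- One of the two morphisms `M ⊗ A ⊗ N ⇉ M ⊗ N`. -/
def relL : (M.X ⊗ A) ⊗ N.X ⟶ M.X ⊗ N.X := ra M ▷ N.X

/-- The other of the two morphisms `M ⊗ A ⊗ N ⇉ M ⊗ N`. -/
def relR : (M.X ⊗ A) ⊗ N.X ⟶ M.X ⊗ N.X := (α_ M.X A N.X).hom ≫ M.X ◁ la N

variable [HasCoequalizers V]

/-- The underlying object of the tensor product over `A`. -/
def tensX : V := coequalizer (relL M N) (relR M N)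

/-- The projection `M ⊗ N → M ⊗_A N`. -/
def proj : M.X ⊗ N.X ⟶ tensX M N := coequalizer.π (relL M N) (relR M N)

instance : Epi (proj M N) := inferInstanceAs (Epi (coequalizer.π (relL M N) (relR M N)))

lemma proj_cond : ra M ▷ N.X ≫ proj M N = (α_ M.X A N.X).hom ≫ M.X ◁ la N ≫ proj M N := by
  have := coequalizer.condition (relL M N) (relR M N)
  rw [relR, Category.assoc] at this
  exact this

section desc
variable {M N} {Q : V}

/-- Morphisms out of `M ⊗_A N`. -/
def desc (φ : M.X ⊗ N.X ⟶ Q) (h : ra M ▷ N.X ≫ φ = (α_ M.X A N.X).hom ≫ M.X ◁ la N ≫ φ) :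
    tensX M N ⟶ Q :=
  coequalizer.desc φ (h.trans (Category.assoc _ _ _).symm)

lemma proj_desc (φ : M.X ⊗ N.X ⟶ Q)
    (h : ra M ▷ N.X ≫ φ = (α_ M.X A N.X).hom ≫ M.X ◁ la N ≫ φ) :
    proj M N ≫ desc φ h = φ := coequalizer.π_desc _ _

variable {X : V}

/-- Morphisms out of `X ⊗ (M ⊗_A N)`. -/
def descL [PreservesColimitsOfShape WalkingParallelPair (tensorLeft X)]
    (φ : X ⊗ (M.X ⊗ N.X) ⟶ Q)
    (h : X ◁ (ra M ▷ N.X) ≫ φ = X ◁ ((α_ M.X A N.X).hom ≫ M.X ◁ la N) ≫ φ) :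
    X ⊗ tensX M N ⟶ Q :=
  (Cofork.IsColimit.desc'
    (isColimitOfHasCoequalizerOfPreservesColimit (tensorLeft X) (relL M N) (relR M N)) φ h).1

lemma proj_descL [PreservesColimitsOfShape WalkingParallelPair (tensorLeft X)]
    (φ : X ⊗ (M.X ⊗ N.X) ⟶ Q)
    (h : X ◁ (ra M ▷ N.X) ≫ φ = X ◁ ((α_ M.X A N.X).hom ≫ M.X ◁ la N) ≫ φ) :
    X ◁ proj M N ≫ descL φ h = φ :=
  (Cofork.IsColimit.desc'
    (isColimitOfHasCoequalizerOfPreservesColimit (tensorLeft X) (relL M N) (relR M N)) φ h).2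

/-- Morphisms out of `(M ⊗_A N) ⊗ X`. -/
def descR [PreservesColimitsOfShape WalkingParallelPair (tensorRight X)]
    (φ : (M.X ⊗ N.X) ⊗ X ⟶ Q)
    (h : (ra M ▷ N.X) ▷ X ≫ φ = ((α_ M.X A N.X).hom ≫ M.X ◁ la N) ▷ X ≫ φ) :
    tensX M N ⊗ X ⟶ Q :=
  (Cofork.IsColimit.desc'
    (isColimitOfHasCoequalizerOfPreservesColimit (tensorRight X) (relL M N) (relR M N)) φ h).1

lemma proj_descR [PreservesColimitsOfShape WalkingParallelPair (tensorRight X)]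
    (φ : (M.X ⊗ N.X) ⊗ X ⟶ Q)
    (h : (ra M ▷ N.X) ▷ X ≫ φ = ((α_ M.X A N.X).hom ≫ M.X ◁ la N) ▷ X ≫ φ) :
    proj M N ▷ X ≫ descR φ h = φ :=
  (Cofork.IsColimit.desc'
    (isColimitOfHasCoequalizerOfPreservesColimit (tensorRight X) (relL M N) (relR M N)) φ h).2

end desc


section Monoidal

variable [IsCommMonObj A] [∀ X : V, PreservesColimitsOfSize.{0, 0} (tensorLeft X)]
  [∀ X : V, PreservesColimitsOfSize.{0, 0} (tensorRight X)]

instance epi_whiskerLeft (X : V) {Y Z : V} (f : Y ⟶ Z) [Epi f] : Epi (X ◁ f) :=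
  inferInstanceAs (Epi ((tensorLeft X).map f))

instance epi_whiskerRight (X : V) {Y Z : V} (f : Y ⟶ Z) [Epi f] : Epi (f ▷ X) :=
  inferInstanceAs (Epi ((tensorRight X).map f))

set_option linter.unusedSectionVars false in
lemma smul_wd : A ◁ (ra M ▷ N.X) ≫ (α_ A M.X N.X).inv ≫ la M ▷ N.X ≫ proj M N =
    A ◁ ((α_ M.X A N.X).hom ≫ M.X ◁ la N) ≫ (α_ A M.X N.X).inv ≫ la M ▷ N.X ≫ proj M N := by
  rw [associator_inv_naturality_middle_assoc, ← comp_whiskerRight_assoc]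
  have h : A ◁ ra M ≫ la M = (α_ A M.X A).inv ≫ la M ▷ A ≫ ra M := by rw [la_ra]; simp
  rw [h, comp_whiskerRight, comp_whiskerRight]
  simp only [Category.assoc]
  rw [proj_cond, associator_naturality_left_assoc, ← whisker_exchange_assoc, whiskerLeft_comp,
    Category.assoc, associator_inv_naturality_right_assoc]
  simp

/-- The action of `A` on `M ⊗_A N`. -/
def tensSmul : A ⊗ tensX M N ⟶ tensX M N :=
  descL ((α_ A M.X N.X).inv ≫ la M ▷ N.X ≫ proj M N) (smul_wd M N)

lemma proj_tensSmul :
    A ◁ proj M N ≫ tensSmul M N = (α_ A M.X N.X).inv ≫ la M ▷ N.X ≫ proj M N :=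
  proj_descL _ _

/-- The tensor product `M ⊗_A N`, with the action induced by that of `M`. -/
def tens : Mod V A := mkMod (tensX M N) (tensSmul M N)
  (by
    rw [← cancel_epi (𝟙_ V ◁ proj M N), whisker_exchange_assoc, proj_tensSmul,
      associator_inv_naturality_left_assoc, ← comp_whiskerRight_assoc, one_la]
    simp)
  (by
    rw [← cancel_epi ((A ⊗ A) ◁ proj M N), whisker_exchange_assoc, proj_tensSmul,
      associator_inv_naturality_left_assoc, ← comp_whiskerRight_assoc, mul_la]
    have h : (A ⊗ A) ◁ proj M N ≫ (α_ A A (tensX M N)).hom ≫ A ◁ tensSmul M N =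
        (α_ A A (M.X ⊗ N.X)).hom ≫ A ◁ ((α_ A M.X N.X).inv ≫ la M ▷ N.X ≫ proj M N) := by
      rw [associator_naturality_right_assoc, ← whiskerLeft_comp, proj_tensSmul]
    rw [← Category.assoc (α_ A A (tensX M N)).hom, ← Category.assoc ((A ⊗ A) ◁ proj M N),
      h]
    simp only [Category.assoc, whiskerLeft_comp, comp_whiskerRight, proj_tensSmul]
    rw [associator_inv_naturality_middle_assoc, ← comp_whiskerRight_assoc]
    simp)

/-- The projection, with target the module `M ⊗_A N`. -/
def pr : M.X ⊗ N.X ⟶ (tens M N).X := proj M N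

instance : Epi (pr M N) := inferInstanceAs (Epi (proj M N))

lemma pr_la : A ◁ pr M N ≫ la (tens M N) = (α_ A M.X N.X).inv ≫ la M ▷ N.X ≫ pr M N :=
  proj_tensSmul M N

lemma pr_cond : ra M ▷ N.X ≫ pr M N = (α_ M.X A N.X).hom ≫ M.X ◁ la N ≫ pr M N :=
  proj_cond M N

lemma pr_ra : pr M N ▷ A ≫ ra (tens M N) = (α_ M.X N.X A).hom ≫ M.X ◁ ra N ≫ pr M N := by
  rw [ra, BraidedCategory.braiding_naturality_left_assoc, pr_la,
    BraidedCategory.braiding_tensor_left_hom]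
  simp only [Category.assoc, Iso.hom_inv_id_assoc]
  rw [← comp_whiskerRight_assoc]
  change _ ≫ _ ≫ _ ≫ ra M ▷ _ ≫ _ = _
  rw [pr_cond]
  simp [ra]

variable {M N} in
lemma tens_hom_ext {Q : V} {φ ψ : (tens M N).X ⟶ Q} (h : pr M N ≫ φ = pr M N ≫ ψ) : φ = ψ :=
  (cancel_epi (pr M N)).1 h

variable {M N} in
/-- Morphisms out of `M ⊗_A N`. -/
def tensDesc {Q : V} (φ : M.X ⊗ N.X ⟶ Q)
    (h : ra M ▷ N.X ≫ φ = (α_ M.X A N.X).hom ≫ M.X ◁ la N ≫ φ) : (tens M N).X ⟶ Q := desc φ h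

variable {M N} in
lemma pr_tensDesc {Q : V} (φ : M.X ⊗ N.X ⟶ Q)
    (h : ra M ▷ N.X ≫ φ = (α_ M.X A N.X).hom ≫ M.X ◁ la N ≫ φ) :
    pr M N ≫ tensDesc φ h = φ := proj_desc φ h

variable {M N P} in
/-- Morphisms of modules out of `M ⊗_A N`. -/
def tensLift (φ : M.X ⊗ N.X ⟶ P.X)
    (h : ra M ▷ N.X ≫ φ = (α_ M.X A N.X).hom ≫ M.X ◁ la N ≫ φ)
    (h' : A ◁ φ ≫ la P = (α_ A M.X N.X).inv ≫ la M ▷ N.X ≫ φ) : tens M N ⟶ P :=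
  mkHom (tensDesc φ h) (by
    rw [← cancel_epi (A ◁ pr M N), ← Category.assoc, pr_la, ← whiskerLeft_comp_assoc,
      pr_tensDesc, h']
    simp only [Category.assoc, pr_tensDesc])

variable {M N P} in
lemma pr_tensLift (φ : M.X ⊗ N.X ⟶ P.X)
    (h : ra M ▷ N.X ≫ φ = (α_ M.X A N.X).hom ≫ M.X ◁ la N ≫ φ)
    (h' : A ◁ φ ≫ la P = (α_ A M.X N.X).inv ≫ la M ▷ N.X ≫ φ) :
    pr M N ≫ (tensLift φ h h').hom = φ := pr_tensDesc φ h

variable {M N} {M' N' : Mod V A}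

/-- Functoriality of the tensor product over `A`. -/
def tensMap (f : M ⟶ M') (g : N ⟶ N') : tens M N ⟶ tens M' N' :=
  tensLift ((f.hom ⊗ₘ g.hom) ≫ pr M' N')
    (by
      simp only [MonoidalCategory.tensorHom_def, Category.assoc]
      rw [← comp_whiskerRight_assoc, ra_nat, comp_whiskerRight, Category.assoc,
        ← whisker_exchange_assoc, pr_cond, whisker_exchange_assoc f.hom (la N),
        ← whiskerLeft_comp_assoc M'.X (la N), smul_hom', associator_naturality_right_assoc,
        associator_naturality_left_assoc, whiskerLeft_comp, Category.assoc])
    (by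
      rw [whiskerLeft_comp, Category.assoc, pr_la]
      simp only [MonoidalCategory.tensorHom_def, Category.assoc]
      rw [← comp_whiskerRight_assoc (la M), smul_hom', comp_whiskerRight, Category.assoc,
        ← whisker_exchange_assoc]
      simp)

lemma pr_tensMap (f : M ⟶ M') (g : N ⟶ N') :
    pr M N ≫ (tensMap f g).hom = (f.hom ⊗ₘ g.hom) ≫ pr M' N' := pr_tensLift _ _ _


variable {P} in
lemma tens_hom_ext' {φ ψ : tens M N ⟶ P} (h : pr M N ≫ φ.hom = pr M N ≫ ψ.hom) : φ = ψ :=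
  Mod.hom_ext _ _ (tens_hom_ext h)

variable {P} in
lemma tens_hom_ext₃ {Q : V} {φ ψ : (tens (tens M N) P).X ⟶ Q}
    (h : pr M N ▷ P.X ≫ pr (tens M N) P ≫ φ = pr M N ▷ P.X ≫ pr (tens M N) P ≫ ψ) : φ = ψ :=
  tens_hom_ext ((cancel_epi (pr M N ▷ P.X)).1 h)

variable {P} in
lemma tens_hom_ext₃' {Q : V} {φ ψ : (tens M (tens N P)).X ⟶ Q}
    (h : M.X ◁ pr N P ≫ pr M (tens N P) ≫ φ = M.X ◁ pr N P ≫ pr M (tens N P) ≫ ψ) : φ = ψ :=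
  tens_hom_ext ((cancel_epi (M.X ◁ pr N P)).1 h)

variable (M N)

/-- An auxiliary morphism in the construction of the associator. -/
def assocAux : (tens M N).X ⊗ P.X ⟶ (tens M (tens N P)).X :=
  descR ((α_ M.X N.X P.X).hom ≫ M.X ◁ pr N P ≫ pr M (tens N P)) (by
    rw [associator_naturality_left_assoc, ← whisker_exchange_assoc, pr_cond,
      associator_naturality_right_assoc, ← whiskerLeft_comp_assoc, pr_la]
    simp)

lemma assocAux_spec : pr M N ▷ P.X ≫ assocAux M N P =
    (α_ M.X N.X P.X).hom ≫ M.X ◁ pr N P ≫ pr M (tens N P) := proj_descR _ _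

lemma assocAux_bal : ra (tens M N) ▷ P.X ≫ assocAux M N P =
    (α_ (tens M N).X A P.X).hom ≫ (tens M N).X ◁ la P ≫ assocAux M N P := by
  rw [← cancel_epi ((pr M N ▷ A) ▷ P.X), ← comp_whiskerRight_assoc, pr_ra,
    associator_naturality_left_assoc, ← whisker_exchange_assoc, assocAux_spec]
  simp only [comp_whiskerRight, Category.assoc]
  rw [assocAux_spec, associator_naturality_middle_assoc, ← whiskerLeft_comp_assoc, pr_cond]
  simp

/-- The associator, in one direction. -/
def assocHom : tens (tens M N) P ⟶ tens M (tens N P) :=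
  tensLift (assocAux M N P) (assocAux_bal M N P) (by
    rw [← cancel_epi (A ◁ (pr M N ▷ P.X)), ← whiskerLeft_comp_assoc, assocAux_spec,
      associator_inv_naturality_middle_assoc, ← comp_whiskerRight_assoc, pr_la]
    simp only [comp_whiskerRight, Category.assoc, whiskerLeft_comp]
    rw [assocAux_spec, pr_la, associator_inv_naturality_right_assoc, whisker_exchange_assoc]
    simp)

lemma assocHom_spec : pr M N ▷ P.X ≫ pr (tens M N) P ≫ (assocHom M N P).hom =
    (α_ M.X N.X P.X).hom ≫ M.X ◁ pr N P ≫ pr M (tens N P) := by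
  rw [assocHom, pr_tensLift, assocAux_spec]

/-- An auxiliary morphism in the construction of the associator. -/
def assocInvAux : M.X ⊗ (tens N P).X ⟶ (tens (tens M N) P).X :=
  descL ((α_ M.X N.X P.X).inv ≫ pr M N ▷ P.X ≫ pr (tens M N) P) (by
    rw [associator_inv_naturality_middle_assoc, ← comp_whiskerRight_assoc, whiskerLeft_comp,
      Category.assoc, associator_inv_naturality_right_assoc, whisker_exchange_assoc]
    have h : M.X ◁ ra N ≫ pr M N = (α_ M.X N.X A).inv ≫ pr M N ▷ A ≫ ra (tens M N) := by
      rw [pr_ra]; simp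
    rw [h]
    simp only [comp_whiskerRight, Category.assoc]
    rw [pr_cond]
    simp)

lemma assocInvAux_spec : M.X ◁ pr N P ≫ assocInvAux M N P =
    (α_ M.X N.X P.X).inv ≫ pr M N ▷ P.X ≫ pr (tens M N) P := proj_descL _ _

lemma assocInvAux_bal : ra M ▷ (tens N P).X ≫ assocInvAux M N P =
    (α_ M.X A (tens N P).X).hom ≫ M.X ◁ la (tens N P) ≫ assocInvAux M N P := by
  rw [← cancel_epi ((M.X ⊗ A) ◁ pr N P), whisker_exchange_assoc,
    associator_naturality_right_assoc, ← whiskerLeft_comp_assoc, pr_la, assocInvAux_spec]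
  simp only [whiskerLeft_comp, Category.assoc]
  rw [assocInvAux_spec, associator_inv_naturality_left_assoc,
    associator_inv_naturality_middle_assoc, ← comp_whiskerRight_assoc, pr_cond]
  simp

/-- The inverse associator. -/
def assocInv : tens M (tens N P) ⟶ tens (tens M N) P :=
  tensLift (assocInvAux M N P) (assocInvAux_bal M N P) (by
    rw [← cancel_epi (A ◁ (M.X ◁ pr N P)), ← whiskerLeft_comp_assoc, assocInvAux_spec,
      associator_inv_naturality_right_assoc, whisker_exchange_assoc, assocInvAux_spec]
    simp only [Category.assoc, whiskerLeft_comp]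
    rw [pr_la, associator_inv_naturality_middle_assoc, ← comp_whiskerRight_assoc, pr_la]
    simp)

lemma assocInv_spec : M.X ◁ pr N P ≫ pr M (tens N P) ≫ (assocInv M N P).hom =
    (α_ M.X N.X P.X).inv ≫ pr M N ▷ P.X ≫ pr (tens M N) P := by
  rw [assocInv, pr_tensLift, assocInvAux_spec]

/-- The associator of the tensor product over `A`. -/
def assoc : tens (tens M N) P ≅ tens M (tens N P) where
  hom := assocHom M N P
  inv := assocInv M N P
  hom_inv_id := Mod.hom_ext _ _ (tens_hom_ext₃ (by
    rw [Mod.comp_hom', ← Category.assoc, ← Category.assoc, Category.assoc (_ ▷ _),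
      assocHom_spec]
    simp only [Category.assoc]
    rw [assocInv_spec]
    simp))
  inv_hom_id := Mod.hom_ext _ _ (tens_hom_ext₃' (by
    rw [Mod.comp_hom', ← Category.assoc, ← Category.assoc, Category.assoc (_ ◁ _),
      assocInv_spec]
    simp only [Category.assoc]
    rw [assocHom_spec]
    simp))

/-- The projection `A ⊗ M → A ⊗_A M`. -/
def prA : A ⊗ M.X ⟶ (tens (Mod.regular A) M).X := pr (Mod.regular A) M

lemma prA_cond : μ ▷ M.X ≫ prA M = (α_ A A M.X).hom ≫ A ◁ la M ≫ prA M := by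
  have h : ra (Mod.regular A) = μ[A] := IsCommMonObj.mul_comm A
  rw [← h]
  exact pr_cond (Mod.regular A) M

lemma prA_cond' : A ◁ la M ≫ prA M = (α_ A A M.X).inv ≫ μ ▷ M.X ≫ prA M := by
  rw [prA_cond]; simp

/-- The left unitor, in one direction. -/
def lunitHom : tens (Mod.regular A) M ⟶ M :=
  tensLift (M := Mod.regular A) (N := M) (P := M) (la M)
    (by
      have h : ra (Mod.regular A) = μ[A] := IsCommMonObj.mul_comm A
      rw [h]
      exact mul_la M)
    (by
      have h : A ◁ la M ≫ la M = (α_ A A M.X).inv ≫ μ ▷ M.X ≫ la M := by rw [mul_la]; simp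
      exact h)

lemma prA_lunitHom : prA M ≫ (lunitHom M).hom = la M := pr_tensLift (M := Mod.regular A) _ _ _

/-- The left unitor of the tensor product over `A`. -/
def lunit : tens (Mod.regular A) M ≅ M :=
  mkIso
    { hom := (lunitHom M).hom
      inv := (λ_ M.X).inv ≫ η[A] ▷ M.X ≫ prA M
      hom_inv_id := tens_hom_ext (by
        change prA M ≫ (lunitHom M).hom ≫ (λ_ M.X).inv ≫ η[A] ▷ M.X ≫ prA M = prA M ≫ 𝟙 _
        rw [← Category.assoc, prA_lunitHom, leftUnitor_inv_naturality_assoc,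
          whisker_exchange_assoc, prA_cond', associator_inv_naturality_left_assoc,
          ← comp_whiskerRight_assoc, MonObj.one_mul]
        simp)
      inv_hom_id := by
        rw [Category.assoc, Category.assoc, prA_lunitHom, one_la]
        simp }
    (smul_hom' (lunitHom M))

lemma braid_wd : ra M ▷ N.X ≫ (β_ M.X N.X).hom ≫ pr N M =
    (α_ M.X A N.X).hom ≫ M.X ◁ la N ≫ (β_ M.X N.X).hom ≫ pr N M := by
  have h : N.X ◁ la M ≫ pr N M = (α_ N.X A M.X).inv ≫ ra N ▷ M.X ≫ pr N M := by
    rw [pr_cond]; simp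
  rw [BraidedCategory.braiding_naturality_left_assoc,
    BraidedCategory.braiding_naturality_right_assoc, ra, whiskerLeft_comp, Category.assoc, h, ra,
    BraidedCategory.braiding_tensor_left_hom, BraidedCategory.braiding_tensor_right_hom]
  simp only [Category.assoc, comp_whiskerRight, Iso.hom_inv_id_assoc]
  rw [← cancel_epi (α_ M.X A N.X).inv]
  simp only [Iso.inv_hom_id_assoc]
  rw [← BraidedCategory.yang_baxter_assoc, Iso.hom_inv_id_assoc, ← comp_whiskerRight_assoc,
    SymmetricCategory.symmetry]
  simp

/-- The symmetry, in one direction. -/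
def braidHom : tens M N ⟶ tens N M :=
  tensLift ((β_ M.X N.X).hom ≫ pr N M) (braid_wd M N) (by
    have h : N.X ◁ la M ≫ pr N M = (α_ N.X A M.X).inv ≫ ra N ▷ M.X ≫ pr N M := by
      rw [pr_cond]; simp
    rw [whiskerLeft_comp, Category.assoc, pr_la, BraidedCategory.braiding_naturality_left_assoc, h,
      BraidedCategory.braiding_tensor_left_hom, ra]
    simp only [comp_whiskerRight, Category.assoc, Iso.hom_inv_id_assoc, Iso.inv_hom_id_assoc]
    rw [← comp_whiskerRight_assoc, SymmetricCategory.symmetry]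
    simp)

lemma pr_braidHom : pr M N ≫ (braidHom M N).hom = (β_ M.X N.X).hom ≫ pr N M := pr_tensLift _ _ _

/-- The symmetry of the tensor product over `A`. -/
def braid : tens M N ≅ tens N M where
  hom := braidHom M N
  inv := braidHom N M
  hom_inv_id := tens_hom_ext' (by
    rw [Mod.comp_hom', ← Category.assoc, pr_braidHom, Category.assoc, pr_braidHom]
    simp)
  inv_hom_id := tens_hom_ext' (by
    rw [Mod.comp_hom', ← Category.assoc, pr_braidHom, Category.assoc, pr_braidHom]
    simp)

/-- The right unitor of the tensor product over `A`. -/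
def runit : tens M (Mod.regular A) ≅ M := braid M (Mod.regular A) ≪≫ lunit M

lemma pr_runit : pr M (Mod.regular A) ≫ (runit M).hom.hom = ra M := by
  change pr M (Mod.regular A) ≫ (braidHom _ _).hom ≫ (lunitHom M).hom = _
  rw [← Category.assoc, pr_braidHom, Category.assoc]
  change _ ≫ prA M ≫ (lunitHom M).hom = _
  rw [prA_lunitHom]
  rfl


section assocLemmas
variable {M N} {Q : V}

lemma pr_tensMap_assoc (f : M ⟶ M') (g : N ⟶ N') (h : (tens M' N').X ⟶ Q) :
    pr M N ≫ (tensMap f g).hom ≫ h = (f.hom ⊗ₘ g.hom) ≫ pr M' N' ≫ h := by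
  rw [← Category.assoc, pr_tensMap, Category.assoc]

lemma assoc_spec (h : (tens M (tens N P)).X ⟶ Q) :
    pr M N ▷ P.X ≫ pr (tens M N) P ≫ (assoc M N P).hom.hom ≫ h =
    (α_ M.X N.X P.X).hom ≫ M.X ◁ pr N P ≫ pr M (tens N P) ≫ h := by
  have := assocHom_spec M N P
  change _ ≫ _ ≫ (assocHom M N P).hom ≫ h = _
  rw [← Category.assoc (pr (tens M N) P), ← Category.assoc, this]
  simp

lemma assoc_spec_inv (h : (tens (tens M N) P).X ⟶ Q) :
    M.X ◁ pr N P ≫ pr M (tens N P) ≫ (assoc M N P).inv.hom ≫ h =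
    (α_ M.X N.X P.X).inv ≫ pr M N ▷ P.X ≫ pr (tens M N) P ≫ h := by
  have := assocInv_spec M N P
  change _ ≫ _ ≫ (assocInv M N P).hom ≫ h = _
  rw [← Category.assoc (pr M (tens N P)), ← Category.assoc, this]
  simp

lemma pr_braid_assoc (h : (tens N M).X ⟶ Q) :
    pr M N ≫ (braid M N).hom.hom ≫ h = (β_ M.X N.X).hom ≫ pr N M ≫ h := by
  have := pr_braidHom M N
  change _ ≫ (braidHom M N).hom ≫ h = _
  rw [← Category.assoc, this, Category.assoc]

lemma tensMap_pr_left (f : M ⟶ M') (h : (tens (tens M' N') P).X ⟶ Q) (g : N ⟶ N') :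
    pr M N ▷ P.X ≫ (tensMap f g).hom ▷ P.X ≫ pr (tens M' N') P ≫ h =
      (f.hom ⊗ₘ g.hom) ▷ P.X ≫ pr M' N' ▷ P.X ≫ pr (tens M' N') P ≫ h := by
  rw [← comp_whiskerRight_assoc, pr_tensMap, comp_whiskerRight, Category.assoc]

end assocLemmas

section laws
variable {M N} {M'' N'' P' Q : Mod V A}

lemma tensMap_eq (f : M ⟶ M') (g : N ⟶ N') :
    tensMap f g = tensMap f (𝟙 N) ≫ tensMap (𝟙 M') g := by
  apply tens_hom_ext'
  rw [Mod.comp_hom', pr_tensMap_assoc, pr_tensMap, pr_tensMap]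
  simp [MonoidalCategory.tensorHom_def]

lemma tensMap_id : tensMap (𝟙 M) (𝟙 N) = 𝟙 (tens M N) := by
  apply tens_hom_ext'
  rw [pr_tensMap]
  simp

lemma tensMap_comp (f : M ⟶ M') (g : N ⟶ N') (f' : M' ⟶ M'') (g' : N' ⟶ N'') :
    tensMap f g ≫ tensMap f' g' = tensMap (f ≫ f') (g ≫ g') := by
  apply tens_hom_ext'
  rw [Mod.comp_hom', pr_tensMap_assoc, pr_tensMap, pr_tensMap]
  simp

lemma assoc_nat (f : M ⟶ M') (g : N ⟶ N') (h : P ⟶ P') :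
    tensMap (tensMap f g) h ≫ (assoc M' N' P').hom =
      (assoc M N P).hom ≫ tensMap f (tensMap g h) := by
  apply Mod.hom_ext
  apply tens_hom_ext₃
  rw [Mod.comp_hom', Mod.comp_hom', pr_tensMap_assoc, assoc_spec, pr_tensMap,
    ← Category.comp_id (assoc M' N' P').hom.hom]
  have h1 : M.X ◁ pr N P ≫ (f.hom ⊗ₘ (tensMap g h).hom) =
      (f.hom ⊗ₘ (g.hom ⊗ₘ h.hom)) ≫ M'.X ◁ pr N' P' := by
    rw [← id_tensorHom, ← id_tensorHom, tensorHom_comp_tensorHom, tensorHom_comp_tensorHom,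
      pr_tensMap]
    simp
  have h2 : pr M N ▷ P.X ≫ ((tensMap f g).hom ⊗ₘ h.hom) =
      ((f.hom ⊗ₘ g.hom) ⊗ₘ h.hom) ≫ pr M' N' ▷ P'.X := by
    rw [← tensorHom_id, ← tensorHom_id, tensorHom_comp_tensorHom, tensorHom_comp_tensorHom,
      pr_tensMap]
    simp
  rw [← Category.assoc, h2, Category.assoc, assoc_spec, ← Category.assoc (M.X ◁ _) (_ ⊗ₘ _),
    h1]
  simp

lemma lunit_nat (f : M ⟶ N) :
    tensMap (𝟙 (Mod.regular A)) f ≫ (lunit N).hom = (lunit M).hom ≫ f := by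
  refine Mod.hom_ext _ _ (tens_hom_ext ?_)
  change prA M ≫ (tensMap (𝟙 (Mod.regular A)) f).hom ≫ (lunitHom N).hom =
    prA M ≫ (lunitHom M).hom ≫ f.hom
  have h1 : prA M ≫ (tensMap (𝟙 (Mod.regular A)) f).hom = A ◁ f.hom ≫ prA N := by
    refine (pr_tensMap _ _).trans ?_
    rw [← id_tensorHom]
    rfl
  rw [← Category.assoc, h1, Category.assoc, prA_lunitHom, ← Category.assoc, prA_lunitHom,
    smul_hom']

lemma runit_nat (f : M ⟶ N) :
    tensMap f (𝟙 (Mod.regular A)) ≫ (runit N).hom = (runit M).hom ≫ f := by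
  apply tens_hom_ext'
  rw [Mod.comp_hom', Mod.comp_hom', pr_tensMap_assoc, pr_runit, ← Category.assoc, pr_runit]
  refine Eq.trans ?_ (ra_nat f).symm
  rw [← tensorHom_id]
  rfl

lemma triangle_aux :
    (assoc M (Mod.regular A) N).hom ≫ tensMap (𝟙 M) (lunit N).hom =
      tensMap (runit M).hom (𝟙 N) := by
  apply Mod.hom_ext
  apply tens_hom_ext₃
  rw [Mod.comp_hom', assoc_spec, pr_tensMap, pr_tensMap]
  have h1 : M.X ◁ pr (Mod.regular A) N ≫ ((𝟙 M : M ⟶ M).hom ⊗ₘ (lunit N).hom.hom) =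
      M.X ◁ la N := by
    rw [Mod.id_hom', id_tensorHom, ← whiskerLeft_comp]
    exact congrArg _ (prA_lunitHom N)
  have h2 : pr M (Mod.regular A) ▷ N.X ≫ ((runit M).hom.hom ⊗ₘ (𝟙 N : N ⟶ N).hom) =
      ra M ▷ N.X := by
    rw [Mod.id_hom', tensorHom_id, ← comp_whiskerRight, pr_runit]
    rfl
  rw [← Category.assoc (_ ◁ _), h1, ← Category.assoc (_ ▷ _), h2]
  exact (pr_cond M N).symm

lemma pentagon_aux :
    tensMap (assoc M N P).hom (𝟙 Q) ≫ (assoc M (tens N P) Q).hom ≫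
        tensMap (𝟙 M) (assoc N P Q).hom =
      (assoc (tens M N) P Q).hom ≫ (assoc M N (tens P Q)).hom := by
  apply Mod.hom_ext
  apply tens_hom_ext₃
  apply (cancel_epi ((pr M N ▷ P.X) ▷ Q.X)).1
  simp only [Mod.comp_hom']
  have h1 : (pr M N ▷ P.X) ▷ Q.X ≫ pr (tens M N) P ▷ Q.X ≫ (assoc M N P).hom.hom ▷ Q.X =
      (α_ M.X N.X P.X).hom ▷ Q.X ≫ (M.X ◁ pr N P) ▷ Q.X ≫ pr M (tens N P) ▷ Q.X := by
    simp only [← comp_whiskerRight]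
    exact congrArg (fun t => t ▷ Q.X) (assocHom_spec M N P)
  have h2 : M.X ◁ (pr N P ▷ Q.X) ≫ M.X ◁ pr (tens N P) Q ≫ M.X ◁ (assoc N P Q).hom.hom =
      M.X ◁ (α_ N.X P.X Q.X).hom ≫ M.X ◁ (N.X ◁ pr P Q) ≫ M.X ◁ pr N (tens P Q) := by
    simp only [← whiskerLeft_comp]
    exact congrArg (fun t => M.X ◁ t) (assocHom_spec N P Q)
  have h3 := assocHom_spec M N (tens P Q)
  rw [pr_tensMap_assoc, Mod.id_hom', tensorHom_id, assoc_spec,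
    ← Category.assoc (pr (tens M N) P ▷ Q.X), ← Category.assoc, h1]
  simp only [Category.assoc]
  rw [assoc_spec, pr_tensMap, Mod.id_hom', id_tensorHom, associator_naturality_middle_assoc,
    ← Category.assoc (M.X ◁ pr (tens N P) Q), ← Category.assoc (M.X ◁ (pr N P ▷ Q.X)), h2,
    associator_naturality_left_assoc, ← whisker_exchange_assoc]
  change _ = _ ≫ _ ≫ _ ≫ _ ≫ (assocHom M N (tens P Q)).hom
  rw [h3]
  simp

lemma braid_nat (f : M ⟶ M') (g : N ⟶ N') :
    tensMap f g ≫ (braid M' N').hom = (braid M N).hom ≫ tensMap g f := by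
  apply tens_hom_ext'
  have h := pr_braidHom M' N'
  change _ ≫ _ ≫ (braidHom _ _).hom = _
  rw [pr_tensMap_assoc, h, Mod.comp_hom', pr_braid_assoc, pr_tensMap]
  simp

lemma hexagon_aux :
    (assoc M N P).hom ≫ (braid M (tens N P)).hom ≫ (assoc N P M).hom =
      tensMap (braid M N).hom (𝟙 P) ≫ (assoc N M P).hom ≫ tensMap (𝟙 N) (braid M P).hom := by
  apply Mod.hom_ext
  apply tens_hom_ext₃
  simp only [Mod.comp_hom']
  have h1 : pr M N ▷ P.X ≫ (braid M N).hom.hom ▷ P.X =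
      (β_ M.X N.X).hom ▷ P.X ≫ pr N M ▷ P.X := by
    simp only [← comp_whiskerRight]
    exact congrArg (fun t => t ▷ P.X) (pr_braidHom M N)
  have h2 : N.X ◁ pr M P ≫ N.X ◁ (braid M P).hom.hom =
      N.X ◁ (β_ M.X P.X).hom ≫ N.X ◁ pr P M := by
    simp only [← whiskerLeft_comp]
    exact congrArg (fun t => N.X ◁ t) (pr_braidHom M P)
  have h3 := assocHom_spec N P M
  rw [assoc_spec, pr_braid_assoc, BraidedCategory.braiding_naturality_right_assoc,
    pr_tensMap_assoc, Mod.id_hom', tensorHom_id, ← Category.assoc (pr M N ▷ P.X), h1,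
    Category.assoc, assoc_spec, pr_tensMap, Mod.id_hom', id_tensorHom,
    ← Category.assoc (N.X ◁ pr M P), h2]
  change _ ≫ _ ≫ _ ≫ _ ≫ (assocHom N P M).hom = _
  rw [h3]
  simp only [Category.assoc]
  rw [BraidedCategory.hexagon_forward_assoc]

lemma hexagon_aux' :
    (assoc M N P).inv ≫ (braid (tens M N) P).hom ≫ (assoc P M N).inv =
      tensMap (𝟙 M) (braid N P).hom ≫ (assoc M P N).inv ≫ tensMap (braid M P).hom (𝟙 N) := by
  apply Mod.hom_ext
  apply tens_hom_ext₃'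
  simp only [Mod.comp_hom']
  have h1 : M.X ◁ pr N P ≫ M.X ◁ (braid N P).hom.hom =
      M.X ◁ (β_ N.X P.X).hom ≫ M.X ◁ pr P N := by
    simp only [← whiskerLeft_comp]
    exact congrArg (fun t => M.X ◁ t) (pr_braidHom N P)
  have h2 : pr M P ▷ N.X ≫ (braid M P).hom.hom ▷ N.X =
      (β_ M.X P.X).hom ▷ N.X ≫ pr P M ▷ N.X := by
    simp only [← comp_whiskerRight]
    exact congrArg (fun t => t ▷ N.X) (pr_braidHom M P)
  have h3 := assocInv_spec P M N
  rw [assoc_spec_inv, pr_braid_assoc, BraidedCategory.braiding_naturality_left_assoc,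
    pr_tensMap_assoc, Mod.id_hom', id_tensorHom, ← Category.assoc (M.X ◁ pr N P), h1,
    Category.assoc, assoc_spec_inv, pr_tensMap, Mod.id_hom', tensorHom_id,
    ← Category.assoc (pr M P ▷ N.X), h2]
  change _ ≫ _ ≫ _ ≫ _ ≫ (assocInv P M N).hom = _
  rw [h3]
  simp only [Category.assoc]
  rw [BraidedCategory.hexagon_reverse_assoc]

end laws

/-- The tensor product over a commutative monoid `A`: its unit is `A`, and its associativity and
unit isomorphisms are induced by those of the ambient category. -/
instance : MonoidalCategoryStruct (Mod V A) where
  tensorObj M N := tens M N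
  whiskerLeft M _ _ g := tensMap (𝟙 M) g
  whiskerRight f N := tensMap f (𝟙 N)
  tensorHom f g := tensMap f g
  tensorUnit := Mod.regular A
  associator M N P := assoc M N P
  leftUnitor M := lunit M
  rightUnitor M := runit M

instance : MonoidalCategory (Mod V A) where
  tensorHom_def := tensMap_eq
  id_tensorHom_id _ _ := tensMap_id
  tensorHom_comp_tensorHom := tensMap_comp
  whiskerLeft_id _ _ := tensMap_id
  id_whiskerRight _ _ := tensMap_id
  associator_naturality := assoc_nat _
  leftUnitor_naturality := lunit_nat
  rightUnitor_naturality := runit_nat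
  pentagon M N P Q := pentagon_aux (M := M) (N := N) (P := P) (Q := Q)
  triangle M N := triangle_aux (M := M) (N := N)

/-- The symmetry of the tensor product over `A`, induced by that of the ambient category. -/
instance : BraidedCategory (Mod V A) where
  braiding M N := braid M N
  braiding_naturality_right M _ _ g := braid_nat (𝟙 M) g
  braiding_naturality_left f N := braid_nat f (𝟙 N)
  hexagon_forward M N P := hexagon_aux (M := M) (N := N) (P := P)
  hexagon_reverse M N P := hexagon_aux' (M := M) (N := N) (P := P)

instance : SymmetricCategory (Mod V A) where
  symmetry M N := (braid M N).hom_inv_id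

instance [Preadditive V] [MonoidalPreadditive V] : MonoidalPreadditive (Mod V A) where
  whiskerLeft_zero {M N P} := tens_hom_ext' (P := tens M P) (by
    refine (pr_tensMap _ _).trans ?_
    change ((𝟙 M : M ⟶ M).hom ⊗ₘ (0 : N.X ⟶ P.X)) ≫ _ = _ ≫ (0 : (tens M N).X ⟶ (tens M P).X)
    simp)
  zero_whiskerRight {M N P} := tens_hom_ext' (P := tens P M) (by
    refine (pr_tensMap _ _).trans ?_
    change ((0 : N.X ⟶ P.X) ⊗ₘ (𝟙 M : M ⟶ M).hom) ≫ _ = _ ≫ (0 : (tens N M).X ⟶ (tens P M).X)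
    simp)
  whiskerLeft_add {M N P} f g := tens_hom_ext' (P := tens M P) (by
    refine (pr_tensMap _ _).trans ?_
    change ((𝟙 M : M ⟶ M).hom ⊗ₘ (f.hom + g.hom)) ≫ _ =
      _ ≫ ((tensMap (𝟙 M) f).hom + (tensMap (𝟙 M) g).hom)
    rw [Preadditive.comp_add, pr_tensMap, pr_tensMap, MonoidalPreadditive.tensor_add,
      Preadditive.add_comp])
  add_whiskerRight {M N P} f g := tens_hom_ext' (P := tens P M) (by
    refine (pr_tensMap _ _).trans ?_
    change ((f.hom + g.hom) ⊗ₘ (𝟙 M : M ⟶ M).hom) ≫ _ =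
      _ ≫ ((tensMap f (𝟙 M)).hom + (tensMap g (𝟙 M)).hom)
    rw [Preadditive.comp_add, pr_tensMap, pr_tensMap, MonoidalPreadditive.add_tensor,
      Preadditive.add_comp])

instance {k : Type w} [CommRing k] [Preadditive V] [MonoidalPreadditive V] [Linear k V]
    [MonoidalLinear k V] : MonoidalLinear k (Mod V A) where
  whiskerLeft_smul M {N P} r f := tens_hom_ext' (P := tens M P) (by
    refine (pr_tensMap _ _).trans ?_
    change ((𝟙 M : M ⟶ M).hom ⊗ₘ (r • f.hom)) ≫ _ = _ ≫ (r • (tensMap (𝟙 M) f).hom)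
    rw [Linear.comp_smul, pr_tensMap, Mod.id_hom', id_tensorHom, id_tensorHom,
      MonoidalLinear.whiskerLeft_smul, Linear.smul_comp])
  smul_whiskerRight r {N P} f M := tens_hom_ext' (P := tens P M) (by
    refine (pr_tensMap _ _).trans ?_
    change ((r • f.hom) ⊗ₘ (𝟙 M : M ⟶ M).hom) ≫ _ = _ ≫ (r • (tensMap f (𝟙 M)).hom)
    rw [Linear.comp_smul, pr_tensMap, Mod.id_hom', tensorHom_id, tensorHom_id,
      MonoidalLinear.smul_whiskerRight, Linear.smul_comp])

end Monoidal

end Tensor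

end Modu
end Modules

section Restriction

variable (k : Type w) [CommRing k]
  {C : Type u₁} [Category.{w} C] [Preadditive C] [Linear k C]
  {D : Type u₂} [Category.{w} D] [Preadditive D] [Linear k D]
  (F : C ⥤ D) [F.Additive] [F.Linear k]

/-- The restriction functor `F^* : Rep D ⥤ Rep C`, given by precomposition with `F`. -/
def restrict : Rep k D ⥤ Rep k C where
  obj N :=
    { obj := F ⋙ N.obj
      property := ⟨inferInstance, inferInstance⟩ }
  map φ := ObjectProperty.homMk (Functor.whiskerLeft F φ.hom)
  map_id _ := rfl
  map_comp _ _ := rfl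

variable {k F} {N N' : Rep k D}

variable (F) in
/-- The identification of `N(F c)` with `(F^* N)(c)`. -/
def inc {c : C} : N.val (F.obj c) ≃ₗ[k] ((restrict k F).obj N).val c := LinearEquiv.refl k _

lemma forall_inc {c : C} {p : ((restrict k F).obj N).val c → Prop} (h : ∀ n, p (inc F n)) :
    ∀ x, p x := h

@[simp] lemma restrict_act {c d : C} (f : c ⟶ d) (n : N.val (F.obj c)) :
    Rep.act ((restrict k F).obj N) f (inc F n) = inc F (N.act (F.map f) n) := rfl

@[simp] lemma restrict_app (φ : N ⟶ N') (c : C) (n : N.val (F.obj c)) :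
    Rep.app ((restrict k F).map φ) c (inc F n) = inc F (Rep.app φ (F.obj c) n) := rfl

instance : (restrict k F).Additive where
instance : (restrict k F).Linear k where

end Restriction

section LaxAction

open Functor.LaxMonoidal

variable {V : Type u₃} [Category.{v₁} V] [MonoidalCategory V] {W : Type u₄} [Category.{v₂} W]
  [MonoidalCategory W] (G : W ⥤ V) [G.LaxMonoidal]

lemma lax_mul_act (N : W) :
    (μ G (𝟙_ W) (𝟙_ W) ≫ G.map (λ_ (𝟙_ W)).hom) ▷ G.obj N ≫ μ G (𝟙_ W) N ≫ G.map (λ_ N).hom =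
      (α_ _ _ _).hom ≫ G.obj (𝟙_ W) ◁ (μ G (𝟙_ W) N ≫ G.map (λ_ N).hom) ≫
        μ G (𝟙_ W) N ≫ G.map (λ_ N).hom := by
  rw [comp_whiskerRight, Category.assoc, μ_natural_left_assoc, whiskerLeft_comp, Category.assoc,
    μ_natural_right_assoc, ← associativity_assoc, ← Functor.map_comp, ← Functor.map_comp,
    ← Functor.map_comp]
  congr 3
  simp

lemma lax_act_nat {N N' : W} (φ : N ⟶ N') :
    (μ G (𝟙_ W) N ≫ G.map (λ_ N).hom) ≫ G.map φ =
      G.obj (𝟙_ W) ◁ G.map φ ≫ μ G (𝟙_ W) N' ≫ G.map (λ_ N').hom := by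
  rw [μ_natural_right_assoc, Category.assoc, ← Functor.map_comp, ← Functor.map_comp,
    leftUnitor_naturality]

end LaxAction

section Lax

variable {k : Type w} [CommRing k]
  {C : Type u₁} [Category.{w} C] [Preadditive C] [Linear k C] [MonoidalCategory C]
  [MonoidalPreadditive C] [MonoidalLinear k C] [SymmetricCategory C] [EssentiallySmall.{w} C]
  {D : Type u₂} [Category.{w} D] [Preadditive D] [Linear k D] [MonoidalCategory D]
  [MonoidalPreadditive D] [MonoidalLinear k D] [SymmetricCategory D] [EssentiallySmall.{w} D]
  {F : C ⥤ D} [F.Additive] [F.Linear k] [F.Braided]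

open Functor.LaxMonoidal

variable (k F) in
/-- The lax unit of `F^*`: it sends `f : 𝟙 ⟶ c` to `F f : 𝟙 ≅ F 𝟙 ⟶ F c`. -/
def resUnit : 𝟙_ (Rep k C) ⟶ (restrict k F).obj (𝟙_ (Rep k D)) :=
  Rep.mkHom (N := (restrict k F).obj (𝟙_ (Rep k D)))
    (fun c => (inc F).toLinearMap ∘ₗ
      { toFun := fun x => Day.unit.mk (ε F ≫ F.map (Day.unit.hom x))
        map_add' := fun x y => by
          rw [Day.unit.hom_add, F.map_add, Preadditive.comp_add]; rfl
        map_smul' := fun r x => by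
          rw [Day.unit.hom_smul, F.map_smul, Linear.comp_smul]; rfl })
    (fun f x => by
      change ε F ≫ F.map (Day.unit.hom x ≫ f) = (ε F ≫ F.map (Day.unit.hom x)) ≫ F.map f
      simp)

section
variable {N N' N'' P : Rep k D} {u v x : C}

@[simp] lemma app_resUnit (y : (𝟙_ (Rep k C)).val u) :
    Rep.app (resUnit k F) u y = inc F (Day.unit.mk (ε F ≫ F.map (Day.unit.hom y))) := rfl

/-- The lax multiplication of `F^*`: it sends `[f, n, n']_{u,v}` to `[F f, n, n']_{F u, F v}`,
where `F (u ⊗ v)` is identified with `F u ⊗ F v`. -/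
def resMul (F : C ⥤ D) [F.Additive] [F.Linear k] [F.Braided] (N N' : Rep k D) :
    (restrict k F).obj N ⊗ (restrict k F).obj N' ⟶ (restrict k F).obj (N ⊗ N') :=
  Day.tensorDesc
    { map := fun u v => LinearMap.mk₂ k
        (fun n n' => inc F ((N ⊗ N').act (μ F u v)
          (Day.tmul ((inc F).symm n) ((inc F).symm n'))))
        (by simp) (by simp) (by simp) (by simp)
      map_act_left := fun {u u'} v a => forall_inc fun n => forall_inc fun n' => by
        simp
      map_act_right := fun {v v'} u b => forall_inc fun n => forall_inc fun n' => by
        simp }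

@[simp] lemma app_resMul (n : N.val (F.obj u)) (n' : N'.val (F.obj v)) :
    Rep.app (resMul F N N') (u ⊗ v) (Day.tmul (inc F n) (inc F n')) =
      inc F ((N ⊗ N').act (μ F u v) (Day.tmul n n')) :=
  Day.app_tensorDesc _ _ _

lemma resMul_nat_left (f : N ⟶ P) (N' : Rep k D) :
    (restrict k F).map f ▷ (restrict k F).obj N' ≫ resMul F P N' =
      resMul F N N' ≫ (restrict k F).map (f ▷ N') := by
  apply Day.tensor_hom_ext
  intro u v
  refine forall_inc fun n => forall_inc fun n' => ?_
  simp

lemma resMul_nat_right (N' : Rep k D) (f : N ⟶ P) :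
    (restrict k F).obj N' ◁ (restrict k F).map f ≫ resMul F N' P =
      resMul F N' N ≫ (restrict k F).map (N' ◁ f) := by
  apply Day.tensor_hom_ext
  intro u v
  refine forall_inc fun n => forall_inc fun n' => ?_
  simp

lemma resMul_assoc (N N' N'' : Rep k D) :
    resMul F N N' ▷ (restrict k F).obj N'' ≫ resMul F (N ⊗ N') N'' ≫
        (restrict k F).map (α_ N N' N'').hom =
      (α_ ((restrict k F).obj N) ((restrict k F).obj N') ((restrict k F).obj N'')).hom ≫
        (restrict k F).obj N ◁ resMul F N' N'' ≫ resMul F N (N' ⊗ N'') := by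
  apply Day.tensor_hom_ext₃
  intro u v x
  refine forall_inc fun n => forall_inc fun n' => forall_inc fun n'' => ?_
  simp

lemma resMul_left_unit (N : Rep k D) :
    (λ_ ((restrict k F).obj N)).hom = resUnit k F ▷ (restrict k F).obj N ≫
      resMul F (𝟙_ (Rep k D)) N ≫ (restrict k F).map (λ_ N).hom := by
  apply Day.tensor_hom_ext
  intro u v y
  refine forall_inc fun n => ?_
  simp

lemma resMul_right_unit (N : Rep k D) :
    (ρ_ ((restrict k F).obj N)).hom = (restrict k F).obj N ◁ resUnit k F ≫
      resMul F N (𝟙_ (Rep k D)) ≫ (restrict k F).map (ρ_ N).hom := by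
  apply Day.tensor_hom_ext
  intro v u
  refine forall_inc fun n => ?_
  intro y
  simp

lemma resMul_braided (N N' : Rep k D) :
    resMul F N N' ≫ (restrict k F).map (β_ N N').hom =
      (β_ ((restrict k F).obj N) ((restrict k F).obj N')).hom ≫ resMul F N' N := by
  apply Day.tensor_hom_ext
  intro u v
  refine forall_inc fun n => forall_inc fun n' => ?_
  simp

end

/-- The lax symmetric monoidal structure of `F^*`. -/
instance : (restrict k F).LaxBraided where
  ε := resUnit k F
  μ N N' := resMul F N N'
  μ_natural_left f N' := resMul_nat_left f N'
  μ_natural_right N' f := resMul_nat_right N' f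
  associativity := resMul_assoc
  left_unitality := resMul_left_unit
  right_unitality := resMul_right_unit
  braided := resMul_braided

instance (M : Rep k C) : PreservesColimitsOfSize.{0, 0} (tensorLeft M) := ⟨inferInstance⟩

instance (M : Rep k C) : PreservesColimitsOfSize.{0, 0} (tensorRight M) := ⟨inferInstance⟩

variable (k F)

/-- The monoid `A = F^*(𝟙)` in `Rep C`. -/
def algA : Rep k C := (restrict k F).obj (𝟙_ (Rep k D))

/-- The multiplication of `A` is induced by the lax monoidal structure of `F^*` and by the
multiplication `𝟙 ⊗ 𝟙 ≅ 𝟙`. -/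
instance : MonObj (algA k F) := (restrict k F).monObjObj (𝟙_ (Rep k D))

open scoped Obj in
instance : IsCommMonObj (algA k F) :=
  inferInstanceAs (IsCommMonObj ((restrict k F).obj (𝟙_ (Rep k D))))

/-- The category of `A`-modules in `Rep C`, with the tensor product over `A`. -/
abbrev AMod := Mod (Rep k C) (algA k F)

variable {k} in
/-- The canonical action `A ⊗ F^* N ⟶ F^* (𝟙 ⊗ N) ≅ F^* N`. -/
def compAct (N : Rep k D) : algA k F ⊗ (restrict k F).obj N ⟶ (restrict k F).obj N :=
  μ (restrict k F) (𝟙_ (Rep k D)) N ≫ (restrict k F).map (λ_ N).hom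

section
variable {k} {F}

lemma one_algA : MonObj.one (X := algA k F) = ε (restrict k F) := by
  refine Eq.trans ?_ (Category.comp_id _)
  exact congrArg (ε (restrict k F) ≫ ·) ((restrict k F).map_id _)

lemma mul_algA : MonObj.mul (X := algA k F) =
    μ (restrict k F) (𝟙_ (Rep k D)) (𝟙_ (Rep k D)) ≫ (restrict k F).map (λ_ (𝟙_ (Rep k D))).hom :=
  rfl

lemma one_compAct (N : Rep k D) : MonObj.one (X := algA k F) ▷ (restrict k F).obj N ≫ compAct F N =
    (λ_ ((restrict k F).obj N)).hom := by
  rw [one_algA, left_unitality]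
  rfl

lemma mul_compAct (N : Rep k D) : MonObj.mul (X := algA k F) ▷ (restrict k F).obj N ≫ compAct F N =
    (α_ (algA k F) (algA k F) ((restrict k F).obj N)).hom ≫
      algA k F ◁ compAct F N ≫ compAct F N := by
  rw [mul_algA]
  exact lax_mul_act (restrict k F) N

lemma compAct_nat {N N' : Rep k D} (φ : N ⟶ N') :
    compAct F N ≫ (restrict k F).map φ = algA k F ◁ (restrict k F).map φ ≫ compAct F N' :=
  lax_act_nat (restrict k F) φ

end

/-- The comparison functor `E : Rep D ⥤ A-Mod`: it sends `N` to `F^* N` with the canonical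
action of `A = F^*(𝟙)`. -/
def comparison : Rep k D ⥤ AMod k F where
  obj N := Modu.mkMod ((restrict k F).obj N) (compAct F N) (one_compAct N) (mul_compAct N)
  map φ := Modu.mkHom ((restrict k F).map φ) (compAct_nat φ)
  map_id N := Mod.hom_ext _ _ ((restrict k F).map_id N)
  map_comp φ ψ := Mod.hom_ext _ _ ((restrict k F).map_comp φ ψ)

variable {k F} in
/-- For an adjunction `L ⊣ F^*` with unit `η`, the morphism
`π : A ⊗ M ⟶ F^*(𝟙) ⊗ F^*(L M) ⟶ F^*(𝟙 ⊗ L M) ≅ F^*(L M)`. -/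
def projMap {L : Rep k C ⥤ Rep k D} (adj : L ⊣ restrict k F) (M : Rep k C) :
    algA k F ⊗ M ⟶ (restrict k F).obj (L.obj M) :=
  algA k F ◁ adj.unit.app M ≫ μ (restrict k F) (𝟙_ (Rep k D)) (L.obj M) ≫
    (restrict k F).map (λ_ (L.obj M)).hom

end Lax

/-- A symmetric monoidal category is rigid if every object `X` has a dual `Y`, with evaluation
`Y ⊗ X ⟶ 𝟙` and coevaluation `𝟙 ⟶ X ⊗ Y` satisfying the triangle identities. -/
def IsRigid (C : Type u₁) [Category.{w} C] [MonoidalCategory C] : Prop :=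
  ∀ X : C, ∃ Y : C, Nonempty (ExactPairing X Y)

end LinRep

end

open LinRep

/-!
Let `F : C ⥤ D` be a linear tensor functor, `F_! ⊣ F^*` the adjunction between the categories of
representations, and `A = F^*(𝟙)`.

The left adjoint is given by the coend `(F_! M)(d) = ∫^c D(F c, d) ⊗ M(c)`, which is small because
`C` is essentially small (`restrict_isRightAdjoint`). For an arbitrary left adjoint, this formula is
recovered as a universal property of the module `(F_! M)(d)`: it is generated by the elements
`g · η(m)` (`Ind.induction`), and linear maps out of it may be defined on these (`Ind.desc`). With
this, the mate `F_!(M ⊗ M') ⟶ F_! M ⊗ F_! M'` of the lax structure of `F^*` has the inverse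
`g · η(m) ⊗ h · η(m') ↦ (g ⊗ h) · η(m ⊗ m')` (`exists_braided`).

If `C` is rigid, the projection formula holds: `π_M : A ⊗ M ⟶ F^* F_! M` is an isomorphism
(`isIso_projMap`). Indeed an element of `A` at `u` is a morphism `𝟙 ⟶ F u`, and by duality a morphism
`g : F x ⟶ F c` has a name `𝟙 ⟶ F (c ⊗ xᘁ)`; the inverse of `π_M` sends `g · η(m)` to the tensor
product of the name of `g` with `m`, followed by the contraction `(c ⊗ xᘁ) ⊗ x ⟶ c`. Hence
`Free ≅ E F_!`. As the counits are split epimorphisms after application of `F^*`, this determines `E`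
(`existsUnique_comparison_iso`).

By the projection formula, an `A`-module `M` is an algebra over the monad `F^* F_!`, and by the coend
formula this amounts to an extension of the action of `C` on `M` to all morphisms `F c ⟶ F c'` of
`D` (`hat`). A representation of `D` is thus the same as an `A`-module if `F` is essentially
surjective: morphisms that respect the extended action come from `D`, and an `A`-module `M` comes
from the representation whose value at `d` is `M(c)` for a chosen `c` with `F c ≅ d`
(`comparison_isEquivalence`).

If `F` is also full, every morphism `F^* N ⟶ F^* N'` respects the action of the morphisms of `D`,
so `F^*` is full, and with it `U`. So an object of `Rep C` has at most one `A`-module structure,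
and the essential image of `F^*` and of `U` consists of the objects that have one. It is a tensor
ideal since `A` acts on `N ⊗ M` through `N` (`essImage_tensor`). As `U` is full, the symmetry `M ⊗
N ≅ N ⊗ M` is linear for the actions through `M` on `M ⊗ N` and through `N` on `N ⊗ M`, so the two
morphisms that define `M ⊗_A N` are equal, and `ω` is an isomorphism (`Modu.isIso_pr_of_full`).
The tensor product `F^* N ⊗ F^* N'` lies in the essential image of `F^*`, so the unit is
invertible on it; as `F_!` is strong monoidal and the counits are invertible, `λ` is an
isomorphism (`isIso_resMul`). The morphism `λ` is `A`-balanced and `A`-linear for every `F`, which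
gives the lax structure of `E` (`comparisonLaxBraided`), and this structure is strong as `λ` and
`ω` are isomorphisms.
-/

noncomputable section

namespace LinRep

set_option linter.unusedSectionVars false

/-! ### Left Kan extension of representations -/

section Induction

variable {k : Type w} [CommRing k]
  {C : Type u₁} [Category.{w} C] [Preadditive C] [Linear k C]
  {D : Type u₂} [Category.{w} D] [Preadditive D] [Linear k D]

section Coend

variable (F : C ⥤ D) (M : Rep k C) (d : D)

open Classical in
/-- The relations defining the coend `∫^c D(F c, d) ⊗ M(c)` as a quotient of the direct sum
of the modules `D(F c, d) ⊗ M(c)`. -/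
def indRel : Submodule k (DirectSum C fun c => (F.obj c ⟶ d) ⊗[k] M.val c) :=
  Submodule.span k
    { x | ∃ (c c' : C) (a : c ⟶ c') (g : F.obj c' ⟶ d) (m : M.val c),
        x = DirectSum.lof k C (fun c => (F.obj c ⟶ d) ⊗[k] M.val c) c ((F.map a ≫ g) ⊗ₜ[k] m)
          - DirectSum.lof k C (fun c => (F.obj c ⟶ d) ⊗[k] M.val c) c' (g ⊗ₜ[k] M.act a m) }

/-- The `k`-linear coend `∫^c D(F c, d) ⊗ M(c)`, the value at `d` of the left Kan extension of
`M` along `F`. -/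
def IndCoend : Type (max u₁ w) :=
  (DirectSum C fun c => (F.obj c ⟶ d) ⊗[k] M.val c) ⧸ indRel F M d

instance : AddCommGroup (IndCoend F M d) :=
  inferInstanceAs (AddCommGroup (_ ⧸ indRel F M d))

instance : Module k (IndCoend F M d) :=
  inferInstanceAs (Module k (_ ⧸ indRel F M d))

end Coend

namespace IndCoend

variable {F : C ⥤ D} {M : Rep k C} {d : D}

open Classical in
/-- The generators `[g, m]` of the coend, as a bilinear map. -/
def mk (c : C) : (F.obj c ⟶ d) →ₗ[k] M.val c →ₗ[k] IndCoend F M d :=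
  (TensorProduct.mk k (F.obj c ⟶ d) (M.val c)).compr₂
    ((indRel F M d).mkQ ∘ₗ DirectSum.lof k C (fun c => (F.obj c ⟶ d) ⊗[k] M.val c) c)

lemma mk_act {c c' : C} (a : c ⟶ c') (g : F.obj c' ⟶ d) (m : M.val c) :
    mk c (F.map a ≫ g) m = mk c' g (M.act a m) := by
  classical
  rw [← sub_eq_zero]
  refine Eq.trans (map_sub (indRel F M d).mkQ _ _).symm ?_
  exact (Submodule.Quotient.mk_eq_zero _).2 (Submodule.subset_span ⟨c, c', a, g, m, rfl⟩)

lemma induction {p : IndCoend F M d → Prop}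
    (mk : ∀ (c : C) (g : F.obj c ⟶ d) (m : M.val c), p (mk c g m))
    (zero : p 0) (add : ∀ x y, p x → p y → p (x + y)) (x : IndCoend F M d) : p x := by
  classical
  obtain ⟨y, rfl⟩ := (indRel F M d).mkQ_surjective x
  induction y using DirectSum.induction_on with
  | zero => rw [map_zero]; exact zero
  | add x y hx hy => rw [map_add]; exact add _ _ hx hy
  | of i t =>
    induction t using TensorProduct.induction_on with
    | zero => rw [map_zero, map_zero]; exact zero
    | add x y hx hy => rw [map_add, map_add]; exact add _ _ hx hy
    | tmul g m => exact mk i g m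

section
variable {X : Type*} [AddCommGroup X] [Module k X]

/-- The universal property of the coend. -/
def desc (φ : ∀ c : C, (F.obj c ⟶ d) →ₗ[k] M.val c →ₗ[k] X)
    (h : ∀ {c c' : C} (a : c ⟶ c') (g : F.obj c' ⟶ d) (m : M.val c),
      φ c (F.map a ≫ g) m = φ c' g (M.act a m)) : IndCoend F M d →ₗ[k] X := by
  classical
  exact (indRel F M d).liftQ (DirectSum.toModule k _ _ fun c => TensorProduct.lift (φ c))
    (by
      rw [indRel, Submodule.span_le]
      rintro _ ⟨c, c', a, g, m, rfl⟩
      simp [h])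

lemma desc_mk (φ : ∀ c : C, (F.obj c ⟶ d) →ₗ[k] M.val c →ₗ[k] X)
    (h : ∀ {c c' : C} (a : c ⟶ c') (g : F.obj c' ⟶ d) (m : M.val c),
      φ c (F.map a ≫ g) m = φ c' g (M.act a m)) {c : C} (g : F.obj c ⟶ d) (m : M.val c) :
    desc φ h (mk c g m) = φ c g m := by
  classical
  change (indRel F M d).liftQ _ _ (Submodule.Quotient.mk _) = _
  simp

end

/-- If `C` is essentially small then the coend is a small module: it is generated by the `[g, m]`
with `m ∈ M(c)` for `c` in a small skeleton. -/
instance [EssentiallySmall.{w} C] : Small.{w} (IndCoend F M d) := by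
  let e := equivSmallModel.{w} C
  let S := Σ p : SmallModel.{w} C, (F.obj (e.inverse.obj p) ⟶ d) × M.val (e.inverse.obj p)
  let T : (S →₀ k) →ₗ[k] IndCoend F M d :=
    Finsupp.linearCombination k (fun s : S => mk _ s.2.1 s.2.2)
  apply small_of_surjective (f := T)
  intro x
  change x ∈ LinearMap.range T
  induction x using induction with
  | zero => exact Submodule.zero_mem _
  | add x y hx hy => exact Submodule.add_mem _ hx hy
  | mk c g m =>
    let a := e.unitIso.app c
    refine ⟨Finsupp.single ⟨e.functor.obj c, F.map a.inv ≫ g, M.act a.hom m⟩ 1, ?_⟩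
    simp only [T, Finsupp.linearCombination_single, one_smul]
    rw [← mk_act, ← Category.assoc, ← F.map_comp]
    simp

/-- The functoriality of the coend in `d`. -/
def act {d' : D} (f : d ⟶ d') : IndCoend F M d →ₗ[k] IndCoend F M d' :=
  desc (fun c => mk c ∘ₗ Linear.rightComp k _ f) (fun a g m => by simp [← mk_act])

@[simp] lemma act_mk {d' : D} (f : d ⟶ d') {c : C} (g : F.obj c ⟶ d) (m : M.val c) :
    act f (mk c g m) = mk c (g ≫ f) m :=
  desc_mk _ (fun a g m => by simp [← mk_act]) _ _

end IndCoend

variable [EssentiallySmall.{w} C] (F : C ⥤ D)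

/-- The canonical identification of the coend with a module in the universe of small sets. -/
def indEquiv (M : Rep k C) (d : D) : IndCoend F M d ≃ₗ[k] Shrink.{w} (IndCoend F M d) :=
  (Shrink.linearEquiv k (IndCoend F M d)).symm

/-- The left Kan extension of a representation, `d ↦ ∫^c D(F c, d) ⊗ M(c)`. -/
def indObj (M : Rep k C) : Rep k D :=
  Rep.mkObj (fun d => Shrink.{w} (IndCoend F M d))
    (fun {d d'} f => (indEquiv F M d').toLinearMap ∘ₗ IndCoend.act f ∘ₗ
      (indEquiv F M d).symm.toLinearMap)
    (fun d x => by
      obtain ⟨x, rfl⟩ := (indEquiv F M d).surjective x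
      induction x using IndCoend.induction with
      | zero => simp
      | add x y hx hy => simp only [map_add, hx, hy]
      | mk c g m => simp)
    (fun {d d' d''} f f' x => by
      obtain ⟨x, rfl⟩ := (indEquiv F M d).surjective x
      induction x using IndCoend.induction with
      | zero => simp
      | add x y hx hy => simp only [map_add, hx, hy]
      | mk c g m => simp)
    (fun {d d'} f f' x => by
      obtain ⟨x, rfl⟩ := (indEquiv F M d).surjective x
      induction x using IndCoend.induction with
      | zero => simp
      | add x y hx hy => simp only [map_add, hx, hy]; abel
      | mk c g m => simp)
    (fun {d d'} r f x => by
      obtain ⟨x, rfl⟩ := (indEquiv F M d).surjective x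
      induction x using IndCoend.induction with
      | zero => simp
      | add x y hx hy => simp only [map_add, hx, hy, smul_add]
      | mk c g m => simp)

/-- The canonical identification of the coend with the values of the left Kan extension. -/
def indVal (M : Rep k C) (d : D) : IndCoend F M d ≃ₗ[k] (indObj F M).val d := indEquiv F M d

variable {F}

lemma act_indVal {M : Rep k C} {d d' : D} (f : d ⟶ d') (x : IndCoend F M d) :
    (indObj F M).act f (indVal F M d x) = indVal F M d' (IndCoend.act f x) := by
  change indEquiv F M d' (IndCoend.act f ((indEquiv F M d).symm (indEquiv F M d x))) = _
  rw [LinearEquiv.symm_apply_apply]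
  rfl

section
variable {M : Rep k C} {c c' : C} {d : D}

lemma indVal_mk_act (a : c ⟶ c') (m : M.val c) :
    indVal F M _ (IndCoend.mk c' (𝟙 _) (M.act a m)) =
      (indObj F M).act (F.map a) (indVal F M _ (IndCoend.mk c (𝟙 _) m)) := by
  rw [← IndCoend.mk_act, act_indVal, IndCoend.act_mk, Category.id_comp, Category.comp_id]

lemma ind_hom_ext {N : Rep k D} {φ ψ : indObj F M ⟶ N}
    (h : ∀ c (m : M.val c), Rep.app φ _ (indVal F M _ (IndCoend.mk c (𝟙 _) m)) =
      Rep.app ψ _ (indVal F M _ (IndCoend.mk c (𝟙 _) m))) :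
    φ = ψ := by
  apply Rep.hom_ext'
  intro d x
  obtain ⟨x, rfl⟩ := (indVal F M d).surjective x
  induction x using IndCoend.induction with
  | zero => simp only [map_zero]
  | add x y hx hy => simp only [map_add, hx, hy]
  | mk c g m =>
    have e : indVal F M d (IndCoend.mk c g m) =
        (indObj F M).act g (indVal F M _ (IndCoend.mk c (𝟙 _) m)) := by
      rw [act_indVal, IndCoend.act_mk, Category.id_comp]
    rw [e, Rep.app_act, Rep.app_act, h]

variable [F.Additive] [F.Linear k]

/-- The pairing `(g, m) ↦ g · φ(m)` defined by a morphism `φ : M ⟶ F^* N`. -/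
def indPairing {N : Rep k D} (φ : M ⟶ (restrict k F).obj N) (d : D) (c : C) :
    (F.obj c ⟶ d) →ₗ[k] M.val c →ₗ[k] N.val d :=
  LinearMap.mk₂ k (fun g m => N.act g ((inc F).symm (Rep.app φ c m)))
    (by simp [Rep.act_add]) (by simp [Rep.act_smul]) (by simp) (by simp)

lemma indPairing_act {N : Rep k D} (φ : M ⟶ (restrict k F).obj N) (d : D) (a : c ⟶ c')
    (g : F.obj c' ⟶ d) (m : M.val c) :
    indPairing φ d c (F.map a ≫ g) m = indPairing φ d c' g (M.act a m) := by
  rw [indPairing, indPairing, LinearMap.mk₂_apply, LinearMap.mk₂_apply, Rep.app_act,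
    ← Rep.act_act]
  rfl

/-- The components of the morphism out of the left Kan extension induced by a morphism
`M ⟶ F^* N`. -/
def indDescAt {N : Rep k D} (φ : M ⟶ (restrict k F).obj N) (d : D) :
    IndCoend F M d →ₗ[k] N.val d :=
  IndCoend.desc (indPairing φ d) (indPairing_act φ d)

lemma indDescAt_mk {N : Rep k D} (φ : M ⟶ (restrict k F).obj N) (g : F.obj c ⟶ d)
    (m : M.val c) :
    indDescAt φ d (IndCoend.mk c g m) = N.act g ((inc F).symm (Rep.app φ c m)) :=
  IndCoend.desc_mk (indPairing φ d) (indPairing_act φ d) g m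

/-- The morphism out of the left Kan extension induced by a morphism `M ⟶ F^* N`. -/
def indDesc {N : Rep k D} (φ : M ⟶ (restrict k F).obj N) : indObj F M ⟶ N :=
  Rep.mkHom (fun d => indDescAt φ d ∘ₗ (indVal F M d).symm.toLinearMap)
    (fun {d d'} f x => by
      obtain ⟨x, rfl⟩ := (indVal F M d).surjective x
      rw [act_indVal]
      simp only [LinearMap.comp_apply, LinearEquiv.coe_coe, LinearEquiv.symm_apply_apply]
      induction x using IndCoend.induction with
      | zero => simp only [map_zero]
      | add x y hx hy => simp only [map_add, hx, hy]
      | mk c g m => rw [IndCoend.act_mk, indDescAt_mk, indDescAt_mk, Rep.act_act])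

lemma app_indDesc {N : Rep k D} (φ : M ⟶ (restrict k F).obj N) (x : IndCoend F M d) :
    Rep.app (indDesc φ) d (indVal F M d x) = indDescAt φ d x := by
  change indDescAt φ d ((indVal F M d).symm (indVal F M d x)) = _
  rw [LinearEquiv.symm_apply_apply]

end

variable (F)

variable [F.Additive] [F.Linear k]

/-- The universal property of the left Kan extension. -/
def indHomEquiv (M : Rep k C) (N : Rep k D) :
    (indObj F M ⟶ N) ≃ (M ⟶ (restrict k F).obj N) where
  toFun ψ := Rep.mkHom (fun c => (inc F).toLinearMap ∘ₗ Rep.app ψ (F.obj c) ∘ₗ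
      (indVal F M _).toLinearMap ∘ₗ IndCoend.mk c (𝟙 _))
    (fun {c c'} f m => by
      simp only [LinearMap.comp_apply, LinearEquiv.coe_coe]
      rw [indVal_mk_act, Rep.app_act, restrict_act])
  invFun φ := indDesc φ
  left_inv ψ := ind_hom_ext fun c m => by
    rw [app_indDesc, indDescAt_mk, Rep.act_id]
    simp
  right_inv φ := Rep.hom_ext' fun c m => by
    rw [Rep.app_mkHom]
    simp only [LinearMap.comp_apply, LinearEquiv.coe_coe]
    rw [app_indDesc, indDescAt_mk, Rep.act_id, LinearEquiv.apply_symm_apply]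

/-- Restriction along `F` has a left adjoint, given by left Kan extension. -/
lemma restrict_isRightAdjoint : (restrict k F).IsRightAdjoint :=
  ⟨_, ⟨Adjunction.adjunctionOfEquivLeft (indHomEquiv F) (fun _ _ _ _ _ => rfl)⟩⟩

end Induction

/-! ### The coend formula for an arbitrary left adjoint -/

section Coinduced

variable {k : Type w} [CommRing k] {D : Type u₂} [Category.{w} D] [Preadditive D] [Linear k D]

/-- The representation `d' ↦ Hom_k(D(d', d), X)`. Morphisms from `N` to it are the `k`-linear
maps `N(d) → X`. -/
def coind (d : D) (X : Type w) [AddCommGroup X] [Module k X] : Rep k D :=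
  Rep.mkObj (fun d' => (d' ⟶ d) →ₗ[k] X)
    (fun f => LinearMap.lcomp k X (Linear.leftComp k d f))
    (fun d' x => by ext g; simp)
    (fun f f' x => by ext g; simp)
    (fun f f' x => by ext g; simp)
    (fun r f x => by ext g; simp)

variable {d : D} {X : Type w} [AddCommGroup X] [Module k X]

/-- An element of `coind d X` at `d'` is a linear map `D(d', d) → X`. -/
def coind.val (d' : D) : ((d' ⟶ d) →ₗ[k] X) ≃ₗ[k] (coind d X : Rep k D).val d' :=
  LinearEquiv.refl k _

lemma coind.act_val {d' d'' : D} (f : d' ⟶ d'') (x : (d' ⟶ d) →ₗ[k] X) :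
    (coind d X : Rep k D).act f (coind.val d' x) =
      coind.val d'' (x ∘ₗ Linear.leftComp k d f) := rfl

lemma coind.symm_act {d' d'' : D} (f : d' ⟶ d'') (x : (coind d X : Rep k D).val d')
    (g : d'' ⟶ d) :
    (coind.val d'').symm ((coind d X : Rep k D).act f x) g = (coind.val d').symm x (f ≫ g) := rfl

/-- The morphism `N ⟶ coind d X` corresponding to a linear map `N(d) → X`. -/
def toCoind {N : Rep k D} (t : N.val d →ₗ[k] X) : N ⟶ coind d X :=
  Rep.mkHom (fun d' => (coind.val d').toLinearMap ∘ₗ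
      (LinearMap.mk₂ k (fun n (g : d' ⟶ d) => t (N.act g n))
        (by simp) (by simp) (by simp [Rep.act_add]) (by simp [Rep.act_smul])))
    (fun {d' d''} f n => by
      simp only [LinearMap.comp_apply, LinearEquiv.coe_coe]
      rw [coind.act_val]
      congr 1
      ext g
      simp)

lemma app_toCoind {N : Rep k D} (t : N.val d →ₗ[k] X) (n : N.val d) :
    (coind.val d).symm (Rep.app (toCoind t) d n) (𝟙 d) = t n := by
  change t (N.act (𝟙 d) n) = t n
  rw [Rep.act_id]

end Coinduced

section Adjoint

variable {k : Type w} [CommRing k]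
  {C : Type u₁} [Category.{w} C] [Preadditive C] [Linear k C]
  {D : Type u₂} [Category.{w} D] [Preadditive D] [Linear k D]
  {F : C ⥤ D} [F.Additive] [F.Linear k] {L : Rep k C ⥤ Rep k D} (adj : L ⊣ restrict k F)

namespace Ind

variable {M : Rep k C}

/-- The unit `M ⟶ F^* F_! M` of the adjunction. -/
def unitHom (M : Rep k C) : M ⟶ (restrict k F).obj (L.obj M) := adj.unit.app M

/-- The counit `F_! F^* N ⟶ N` of the adjunction. -/
def counitHom (N : Rep k D) : L.obj ((restrict k F).obj N) ⟶ N := adj.counit.app N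

lemma unitHom_nat {M' : Rep k C} (φ : M ⟶ M') :
    φ ≫ unitHom adj M' = unitHom adj M ≫ (restrict k F).map (L.map φ) :=
  adj.unit.naturality φ

lemma homEquiv_apply {N : Rep k D} (φ : L.obj M ⟶ N) :
    adj.homEquiv M N φ = unitHom adj M ≫ (restrict k F).map φ := adj.homEquiv_unit _ _ _

lemma unitHom_counitHom (N : Rep k D) :
    unitHom adj ((restrict k F).obj N) ≫ (restrict k F).map (counitHom adj N) = 𝟙 _ :=
  adj.right_triangle_components N

/-- The components `M(c) → (F_! M)(F c)` of the unit of an adjunction `F_! ⊣ F^*`. -/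
def unit {c : C} : M.val c →ₗ[k] (L.obj M).val (F.obj c) :=
  (inc F).symm.toLinearMap ∘ₗ Rep.app (unitHom adj M) c

lemma inc_unit {c : C} (m : M.val c) : inc F (unit adj m) = Rep.app (unitHom adj M) c m := rfl

lemma unit_act {c c' : C} (a : c ⟶ c') (m : M.val c) :
    unit adj (M.act a m) = (L.obj M).act (F.map a) (unit adj m) := by
  apply (inc F).injective
  rw [inc_unit, Rep.app_act, ← inc_unit, restrict_act]

lemma unit_app {M' : Rep k C} (φ : M ⟶ M') {c : C} (m : M.val c) :
    unit adj (Rep.app φ c m) = Rep.app (L.map φ) (F.obj c) (unit adj m) := by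
  apply (inc F).injective
  rw [inc_unit, ← restrict_app, inc_unit, ← Rep.app_comp, ← Rep.app_comp, unitHom_nat]

lemma app_homEquiv_symm {N : Rep k D} (φ : M ⟶ (restrict k F).obj N) {c : C} (m : M.val c) :
    inc F (Rep.app ((adj.homEquiv M N).symm φ) (F.obj c) (unit adj m)) = Rep.app φ c m := by
  rw [← restrict_app, inc_unit, ← Rep.app_comp, ← homEquiv_apply, Equiv.apply_symm_apply]

lemma app_counitHom {N : Rep k D} {c : C} (n : N.val (F.obj c)) :
    Rep.app (counitHom adj N) (F.obj c) (unit adj (inc F n)) = n := by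
  apply (inc F).injective
  rw [← restrict_app, inc_unit, ← Rep.app_comp, unitHom_counitHom, Rep.app_id]

/-- A morphism out of `F_! M` is determined by its values on the elements `η(m)`. -/
lemma hom_ext {N : Rep k D} {φ ψ : L.obj M ⟶ N}
    (h : ∀ c (m : M.val c), Rep.app φ _ (unit adj m) = Rep.app ψ _ (unit adj m)) : φ = ψ := by
  apply (adj.homEquiv M N).injective
  rw [homEquiv_apply, homEquiv_apply]
  apply Rep.hom_ext'
  intro c m
  rw [Rep.app_comp, Rep.app_comp, ← inc_unit, restrict_app, restrict_app, h]

variable {d : D} {X : Type w} [AddCommGroup X] [Module k X]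

/-- A linear map out of `(F_! M)(d)` is determined by its values on the elements `g · η(m)`. Such
a map is the same as a morphism from `F_! M` to a coinduced representation. -/
lemma linearMap_ext {t t' : (L.obj M).val d →ₗ[k] X}
    (h : ∀ c (g : F.obj c ⟶ d) (m : M.val c),
      t ((L.obj M).act g (unit adj m)) = t' ((L.obj M).act g (unit adj m))) : t = t' := by
  have e : toCoind t = toCoind t' := by
    apply hom_ext adj
    intro c m
    apply (coind.val (F.obj c)).symm.injective
    ext g
    exact h c g m
  ext x
  rw [← app_toCoind t, ← app_toCoind t', e]

/-- The `k`-modules `(F_! M)(d)` are generated by the elements `g · η(m)`. -/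
lemma induction {p : (L.obj M).val d → Prop}
    (act : ∀ (c : C) (g : F.obj c ⟶ d) (m : M.val c), p ((L.obj M).act g (unit adj m)))
    (zero : p 0) (add : ∀ x y, p x → p y → p (x + y)) (x : (L.obj M).val d) : p x := by
  let S : Submodule k ((L.obj M).val d) :=
    Submodule.span k { x | ∃ (c : C) (g : F.obj c ⟶ d) (m : M.val c),
      x = (L.obj M).act g (unit adj m) }
  -- The projection to the quotient by the span vanishes on the generators, hence everywhere.
  have hS : S.mkQ = 0 := linearMap_ext adj fun c g m => by
    rw [LinearMap.zero_apply]
    exact (Submodule.Quotient.mk_eq_zero _).2 (Submodule.subset_span ⟨c, g, m, rfl⟩)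
  have hx : x ∈ S := (Submodule.Quotient.mk_eq_zero _).1 (LinearMap.congr_fun hS x)
  -- The property `p` is not assumed to be stable under scalars, which are absorbed in `g`.
  have key : ∀ r : k, p (r • x) := by
    induction hx using Submodule.span_induction with
    | mem x hx =>
      obtain ⟨c, g, m, rfl⟩ := hx
      intro r
      rw [← Rep.act_smul]
      exact act c _ m
    | zero => intro r; rw [smul_zero]; exact zero
    | add x y _ _ hx hy => intro r; rw [smul_add]; exact add _ _ (hx r) (hy r)
    | smul s x _ hx => intro r; rw [smul_smul]; exact hx _
  simpa using key 1

/-- The coend formula `(F_! M)(d) = ∫^c D(F c, d) ⊗ M(c)` as a universal property. A compatible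
family of bilinear maps is a morphism `M ⟶ F^* (coind d X)`, and the linear map is obtained from its
adjoint `F_! M ⟶ coind d X`. -/
def desc (φ : ∀ c : C, (F.obj c ⟶ d) →ₗ[k] M.val c →ₗ[k] X)
    (h : ∀ {c c' : C} (a : c ⟶ c') (g : F.obj c' ⟶ d) (m : M.val c),
      φ c (F.map a ≫ g) m = φ c' g (M.act a m)) : (L.obj M).val d →ₗ[k] X :=
  LinearMap.applyₗ (𝟙 d) ∘ₗ (coind.val d).symm.toLinearMap ∘ₗ
    Rep.app ((adj.homEquiv M (coind d X)).symm
      (Rep.mkHom (N := (restrict k F).obj (coind d X))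
        (fun c => (inc F).toLinearMap ∘ₗ (coind.val (F.obj c)).toLinearMap ∘ₗ (φ c).flip)
        (fun {c c'} a m => by
          simp only [LinearMap.comp_apply, LinearEquiv.coe_coe]
          rw [restrict_act, coind.act_val]
          congr 2
          ext g
          exact (h a g m).symm))) d

lemma desc_act (φ : ∀ c : C, (F.obj c ⟶ d) →ₗ[k] M.val c →ₗ[k] X)
    (h : ∀ {c c' : C} (a : c ⟶ c') (g : F.obj c' ⟶ d) (m : M.val c),
      φ c (F.map a ≫ g) m = φ c' g (M.act a m)) {c : C} (g : F.obj c ⟶ d) (m : M.val c) :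
    desc adj φ h ((L.obj M).act g (unit adj m)) = φ c g m := by
  simp only [desc, LinearMap.comp_apply, LinearEquiv.coe_coe, LinearMap.applyₗ_apply_apply]
  rw [Rep.app_act, coind.symm_act, Category.comp_id]
  exact congrArg (fun t => (coind.val (F.obj c)).symm ((inc F).symm t) g)
    (app_homEquiv_symm adj _ m)

end Ind

/-- The left adjoint of a restriction functor is linear. -/
lemma ind_linear (adj : L ⊣ restrict k F) : L.Linear k where
  map_smul φ r := Ind.hom_ext adj fun c m => by
    rw [← Ind.unit_app, Rep.app_smul, Rep.app_smul, map_smul, Ind.unit_app]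

end Adjoint

/-! ### The strong monoidal structure of the left adjoint -/

section Strong

variable {k : Type w} [CommRing k]
  {C : Type u₁} [Category.{w} C] [Preadditive C] [Linear k C] [MonoidalCategory C]
  [MonoidalPreadditive C] [MonoidalLinear k C] [SymmetricCategory C] [EssentiallySmall.{w} C]
  {D : Type u₂} [Category.{w} D] [Preadditive D] [Linear k D] [MonoidalCategory D]
  [MonoidalPreadditive D] [MonoidalLinear k D] [SymmetricCategory D] [EssentiallySmall.{w} D]
  {F : C ⥤ D} [F.Additive] [F.Linear k] [F.Braided]
  {L : Rep k C ⥤ Rep k D} (adj : L ⊣ restrict k F)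

open Functor.LaxMonoidal Functor.OplaxMonoidal

namespace Ind

variable {M M' : Rep k C}

/-- The pairing `(h, m') ↦ (g ⊗ h) · η(m ⊗ m')`, for fixed `g` and `m`. -/
def mulPairing (M' : Rep k C) {c : C} {d : D} (g : F.obj c ⟶ d) (m : M.val c) (d' : D) (c' : C) :
    (F.obj c' ⟶ d') →ₗ[k] M'.val c' →ₗ[k] (L.obj (M ⊗ M')).val (d ⊗ d') :=
  LinearMap.mk₂ k
    (fun h m' => (L.obj (M ⊗ M')).act (δ F c c' ≫ (g ⊗ₘ h)) (unit adj (Day.tmul m m')))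
    (by simp [Rep.act_add, MonoidalPreadditive.tensor_add])
    (by simp [Rep.act_smul, MonoidalCategory.tensorHom_def]) (by simp) (by simp)

lemma mulPairing_apply {c : C} {d : D} (g : F.obj c ⟶ d) (m : M.val c) {d' : D} {c' : C}
    (h : F.obj c' ⟶ d') (m' : M'.val c') : mulPairing adj M' g m d' c' h m' =
      (L.obj (M ⊗ M')).act (δ F c c' ≫ (g ⊗ₘ h)) (unit adj (Day.tmul m m')) := rfl

lemma mulPairing_act {c : C} {d : D} (g : F.obj c ⟶ d) (m : M.val c) (d' : D) {c' c'' : C}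
    (a : c' ⟶ c'') (h : F.obj c'' ⟶ d') (m' : M'.val c') :
    mulPairing adj M' g m d' c' (F.map a ≫ h) m' =
      mulPairing adj M' g m d' c'' h (M'.act a m') := by
  rw [mulPairing_apply, mulPairing_apply, Day.tmul_act, unit_act, Rep.act_act,
    ← δ_natural_right_assoc, ← id_tensorHom, tensorHom_comp_tensorHom, Category.id_comp]

/-- The map `(F_! M')(d') → (F_!(M ⊗ M'))(d ⊗ d')` given by `h · η(m') ↦ (g ⊗ h) · η(m ⊗ m')`. -/
def mulRight (M' : Rep k C) {c : C} {d : D} (g : F.obj c ⟶ d) (m : M.val c) (d' : D) :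
    (L.obj M').val d' →ₗ[k] (L.obj (M ⊗ M')).val (d ⊗ d') :=
  desc adj (mulPairing adj M' g m d') (mulPairing_act adj g m d')

lemma mulRight_act {c : C} {d : D} (g : F.obj c ⟶ d) (m : M.val c) {d' : D} {c' : C}
    (h : F.obj c' ⟶ d') (m' : M'.val c') :
    mulRight adj M' g m d' ((L.obj M').act h (unit adj m')) =
      (L.obj (M ⊗ M')).act (δ F c c' ≫ (g ⊗ₘ h)) (unit adj (Day.tmul m m')) :=
  desc_act adj (mulPairing adj M' g m d') (mulPairing_act adj g m d') h m'

/-- The assignment `(g, m) ↦ mulRight g m`. -/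
def mulPairing₂ (M M' : Rep k C) (d d' : D) (c : C) :
    (F.obj c ⟶ d) →ₗ[k] M.val c →ₗ[k]
      ((L.obj M').val d' →ₗ[k] (L.obj (M ⊗ M')).val (d ⊗ d')) :=
  LinearMap.mk₂ k (fun g m => mulRight adj M' g m d')
    (fun g g' m => linearMap_ext adj fun c' h m' => by
      simp only [LinearMap.add_apply, mulRight_act]
      rw [MonoidalPreadditive.add_tensor, Preadditive.comp_add, Rep.act_add])
    (fun r g m => linearMap_ext adj fun c' h m' => by
      simp only [LinearMap.smul_apply, mulRight_act]
      rw [← Rep.act_smul]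
      simp [MonoidalCategory.tensorHom_def])
    (fun g m n => linearMap_ext adj fun c' h m' => by
      simp only [LinearMap.add_apply, mulRight_act, Day.add_tmul, map_add])
    (fun r g m => linearMap_ext adj fun c' h m' => by
      simp only [LinearMap.smul_apply, mulRight_act, Day.smul_tmul, map_smul])

lemma mulPairing₂_act (d d' : D) {c c' : C} (a : c ⟶ c') (g : F.obj c' ⟶ d) (m : M.val c) :
    mulPairing₂ adj M M' d d' c (F.map a ≫ g) m =
      mulPairing₂ adj M M' d d' c' g (M.act a m) := by
  refine linearMap_ext adj fun c'' h m' => ?_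
  change mulRight adj M' _ _ d' _ = mulRight adj M' _ _ d' _
  rw [mulRight_act, mulRight_act, Day.act_tmul, unit_act, Rep.act_act,
    ← δ_natural_left_assoc, ← tensorHom_id, tensorHom_comp_tensorHom, Category.id_comp]

/-- The bilinear map `(g · η(m), h · η(m')) ↦ (g ⊗ h) · η(m ⊗ m')`. -/
def mulAt (M M' : Rep k C) (d d' : D) :
    (L.obj M).val d →ₗ[k] (L.obj M').val d' →ₗ[k] (L.obj (M ⊗ M')).val (d ⊗ d') :=
  desc adj (mulPairing₂ adj M M' d d') (mulPairing₂_act adj d d')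

lemma mulAt_act {c : C} {d : D} (g : F.obj c ⟶ d) (m : M.val c) {d' : D} {c' : C}
    (h : F.obj c' ⟶ d') (m' : M'.val c') :
    mulAt adj M M' d d' ((L.obj M).act g (unit adj m)) ((L.obj M').act h (unit adj m')) =
      (L.obj (M ⊗ M')).act (δ F c c' ≫ (g ⊗ₘ h)) (unit adj (Day.tmul m m')) := by
  rw [← mulRight_act]
  exact LinearMap.congr_fun
    (desc_act adj (mulPairing₂ adj M M' d d') (mulPairing₂_act adj d d') g m) _

/-- The multiplication `F_! M ⊗ F_! M' ⟶ F_! (M ⊗ M')`. -/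
def mul (M M' : Rep k C) : L.obj M ⊗ L.obj M' ⟶ L.obj (M ⊗ M') :=
  Day.tensorDesc
    { map := mulAt adj M M'
      map_act_left := fun {d d'} d'' f x y => by
        induction x using induction adj with
        | zero => simp only [map_zero, LinearMap.zero_apply]
        | add x x' hx hx' => simp only [map_add, LinearMap.add_apply, hx, hx']
        | act c g m =>
          induction y using induction adj with
          | zero => simp only [map_zero]
          | add y y' hy hy' => simp only [map_add, hy, hy']
          | act c' h m' =>
            rw [Rep.act_act, mulAt_act, mulAt_act, Rep.act_act, Category.assoc,
              ← tensorHom_id, tensorHom_comp_tensorHom, Category.comp_id]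
      map_act_right := fun {d d'} d'' f x y => by
        induction x using induction adj with
        | zero => simp only [map_zero, LinearMap.zero_apply]
        | add x x' hx hx' => simp only [map_add, LinearMap.add_apply, hx, hx']
        | act c g m =>
          induction y using induction adj with
          | zero => simp only [map_zero]
          | add y y' hy hy' => simp only [map_add, hy, hy']
          | act c' h m' =>
            rw [Rep.act_act, mulAt_act, mulAt_act, Rep.act_act, Category.assoc,
              ← id_tensorHom, tensorHom_comp_tensorHom, Category.comp_id] }

lemma app_mul {c : C} {d : D} (g : F.obj c ⟶ d) (m : M.val c) {d' : D} {c' : C}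
    (h : F.obj c' ⟶ d') (m' : M'.val c') :
    Rep.app (mul adj M M') (d ⊗ d')
        (Day.tmul ((L.obj M).act g (unit adj m)) ((L.obj M').act h (unit adj m'))) =
      (L.obj (M ⊗ M')).act (δ F c c' ≫ (g ⊗ₘ h)) (unit adj (Day.tmul m m')) :=
  (Day.app_tensorDesc _ _ _).trans (mulAt_act adj g m h m')

/-- The comultiplication `F_! (M ⊗ M') ⟶ F_! M ⊗ F_! M'`, the mate of the lax structure. -/
def comul (M M' : Rep k C) : L.obj (M ⊗ M') ⟶ L.obj M ⊗ L.obj M' :=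
  (adj.homEquiv _ _).symm ((unitHom adj M ⊗ₘ unitHom adj M') ≫ μ (restrict k F) _ _)

lemma app_comul {c c' : C} (m : M.val c) (m' : M'.val c') :
    Rep.app (comul adj M M') _ (unit adj (Day.tmul m m')) =
      (L.obj M ⊗ L.obj M').act (μ F c c') (Day.tmul (unit adj m) (unit adj m')) := by
  apply (inc F).injective
  rw [comul, app_homEquiv_symm, MonoidalCategory.tensorHom_def, Rep.app_comp, Rep.app_comp,
    Day.app_whiskerRight, Day.app_whiskerLeft, ← inc_unit, ← inc_unit]
  exact app_resMul _ _

lemma comul_mul (M M' : Rep k C) : comul adj M M' ≫ mul adj M M' = 𝟙 _ := by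
  apply hom_ext adj
  intro c x
  induction x using Day.induction with
  | zero => simp only [map_zero]
  | add x y hx hy => simp only [map_add, hx, hy]
  | gen u v f m n =>
    change Rep.app _ _ (unit adj ((M ⊗ M').act f (Day.tmul m n))) =
      Rep.app _ _ (unit adj ((M ⊗ M').act f (Day.tmul m n)))
    rw [unit_act, Rep.app_act, Rep.app_act, Rep.app_comp, app_comul, Rep.app_act,
      ← Rep.act_id _ _ (unit adj m), ← Rep.act_id _ _ (unit adj n), app_mul]
    simp

lemma mul_comul (M M' : Rep k C) : mul adj M M' ≫ comul adj M M' = 𝟙 _ := by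
  apply Day.tensor_hom_ext
  intro d d' x y
  induction x using induction adj with
  | zero => simp only [Day.zero_tmul, map_zero]
  | add x x' hx hx' => simp only [Day.add_tmul, map_add, hx, hx']
  | act c g m =>
    induction y using induction adj with
    | zero => simp only [Day.tmul_zero, map_zero]
    | add y y' hy hy' => simp only [Day.tmul_add, map_add, hy, hy']
    | act c' h m' =>
      rw [Rep.app_comp, app_mul, Rep.app_act, app_comul, Rep.act_act, Rep.app_id, Day.tmul_act,
        Day.act_tmul, Rep.act_act, ← MonoidalCategory.tensorHom_def]
      simp

/-- The counit `F_! 𝟙 ⟶ 𝟙`, the mate of the lax structure. -/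
def counitUnit : L.obj (𝟙_ (Rep k C)) ⟶ 𝟙_ (Rep k D) :=
  (adj.homEquiv _ _).symm (ε (restrict k F))

lemma app_counitUnit {c : C} (x : (𝟙_ (Rep k C)).val c) :
    Rep.app (counitUnit adj) _ (unit adj x) = Day.unit.mk (ε F ≫ F.map (Day.unit.hom x)) := by
  apply (inc F).injective
  rw [counitUnit, app_homEquiv_symm]
  exact app_resUnit x

/-- The unit `𝟙 ⟶ F_! 𝟙`, given by `f ↦ f · η(id)`. -/
def oneHom : 𝟙_ (Rep k D) ⟶ L.obj (𝟙_ (Rep k C)) :=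
  Rep.mkHom (M := 𝟙_ (Rep k D))
    (fun d =>
      { toFun := fun x => (L.obj (𝟙_ (Rep k C))).act (η F ≫ Day.unit.hom x)
          (unit adj (Day.unit.mk (𝟙 _)))
        map_add' := fun x y => by
          rw [Day.unit.hom_add, Preadditive.comp_add, Rep.act_add]
        map_smul' := fun r x => by
          rw [Day.unit.hom_smul, Linear.comp_smul, Rep.act_smul, RingHom.id_apply] })
    (fun f x => by
      simp only [LinearMap.coe_mk, AddHom.coe_mk]
      rw [Rep.act_act, Category.assoc]
      rfl)

lemma app_oneHom {d : D} (x : (𝟙_ (Rep k D)).val d) :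
    Rep.app (oneHom adj) d x = (L.obj (𝟙_ (Rep k C))).act (η F ≫ Day.unit.hom x)
          (unit adj (Day.unit.mk (𝟙 _))) := rfl

lemma counitUnit_oneHom : counitUnit adj ≫ oneHom adj = 𝟙 _ := by
  apply hom_ext adj
  intro c x
  rw [Rep.app_comp, app_counitUnit, app_oneHom, Day.unit.hom_mk, Functor.Monoidal.η_ε_assoc,
    ← unit_act, Rep.app_id]
  congr 1
  exact (Day.unit.mk_hom x).symm

lemma oneHom_counitUnit : oneHom adj ≫ counitUnit adj = 𝟙 _ := by
  apply Rep.hom_ext'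
  intro d x
  rw [Rep.app_comp, app_oneHom, Rep.app_act, app_counitUnit, Rep.app_id]
  change (ε F ≫ F.map (𝟙 _)) ≫ η F ≫ Day.unit.hom x = Day.unit.hom x
  simp

end Ind

/-- The mate of the lax symmetric monoidal structure of `F^*` is a strong symmetric monoidal
structure on its left adjoint. -/
lemma exists_braided : ∃ h : L.Braided, h.toMonoidal.toOplaxMonoidal =
    adj.leftAdjointOplaxMonoidal := by
  let : L.OplaxMonoidal := adj.leftAdjointOplaxMonoidal
  have : IsIso (η L) := ⟨Ind.oneHom adj, Ind.counitUnit_oneHom adj, Ind.oneHom_counitUnit adj⟩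
  have : ∀ M M', IsIso (δ L M M') := fun M M' =>
    ⟨Ind.mul adj M M', Ind.comul_mul adj M M', Ind.mul_comul adj M M'⟩
  let := Functor.Monoidal.ofOplaxMonoidal L
  have hδ (M M' : Rep k C) : δ L M M' = Ind.comul adj M M' := rfl
  have key (M M' : Rep k C) : L.map (β_ M M').hom ≫ δ L M' M =
      δ L M M' ≫ (β_ (L.obj M) (L.obj M')).hom := by
    apply Ind.hom_ext adj
    intro c x
    induction x using Day.induction with
    | zero => simp only [map_zero]
    | add x y hx hy => simp only [map_add, hx, hy]
    | gen u v f m n =>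
      change Rep.app _ _ (Ind.unit adj ((M ⊗ M').act f (Day.tmul m n))) =
        Rep.app _ _ (Ind.unit adj ((M ⊗ M').act f (Day.tmul m n)))
      rw [Ind.unit_act, Rep.app_act, Rep.app_act, Rep.app_comp, Rep.app_comp, hδ, hδ,
        Ind.app_comul, ← Ind.unit_app, Day.app_β_hom, Ind.unit_act, Rep.app_act, Ind.app_comul,
        Rep.app_act, Day.app_β_hom, Rep.act_act, Rep.act_act]
      simp
  refine ⟨{ braided := fun M M' => ?_ }, rfl⟩
  rw [← cancel_epi (δ L M M'), ← cancel_mono (δ L M' M)]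
  have h₁ (M M' : Rep k C) : δ L M M' ≫ μ L M M' = 𝟙 _ := Functor.Monoidal.δ_μ L M M'
  have h₂ (M M' : Rep k C) : μ L M M' ≫ δ L M M' = 𝟙 _ := Functor.Monoidal.μ_δ L M M'
  simp only [Category.assoc]
  rw [key, reassoc_of% h₁, h₂, Category.comp_id]

end Strong

/-! ### Morphisms named by duals -/

section Duals

variable {C : Type u₁} [Category.{v₁} C] [MonoidalCategory C] [RightRigidCategory C]
  {D : Type u₂} [Category.{v₂} D] [MonoidalCategory D] (F : C ⥤ D) [F.Monoidal]

open Functor.LaxMonoidal Functor.OplaxMonoidal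

/-- The coevaluation `𝟙 ⟶ F x ⊗ F xᘁ` of the dual pair `(F x, F xᘁ)`. -/
def mapCoev (x : C) : 𝟙_ D ⟶ F.obj x ⊗ F.obj xᘁ := ε F ≫ F.map (η_ x xᘁ) ≫ δ F x xᘁ

/-- The evaluation `F xᘁ ⊗ F x ⟶ 𝟙` of the dual pair `(F x, F xᘁ)`. -/
def mapEv (x : C) : F.obj xᘁ ⊗ F.obj x ⟶ 𝟙_ D := μ F xᘁ x ≫ F.map (ε_ x xᘁ) ≫ η F

/-- One of the triangle identities of the dual pair `(F x, F xᘁ)`. -/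
lemma mapCoev_mapEv (x : C) : mapCoev F x ▷ F.obj x ≫ (α_ _ _ _).hom ≫ F.obj x ◁ mapEv F x =
    (λ_ _).hom ≫ (ρ_ _).inv := by
  have h := congrArg F.map (ExactPairing.evaluation_coevaluation x xᘁ)
  rw [← cancel_epi (η F ▷ F.obj x), ← cancel_mono (F.obj x ◁ ε F), ← cancel_epi (δ F _ _),
    ← cancel_mono (μ F _ _)]
  simp only [Functor.map_comp, Functor.Monoidal.map_whiskerRight,
    Functor.Monoidal.map_whiskerLeft, Functor.Monoidal.map_associator,
    Functor.Monoidal.map_leftUnitor, Functor.Monoidal.map_rightUnitor_inv, mapCoev, mapEv] at h ⊢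
  simpa using h

variable {F}

/-- The name `𝟙 ⟶ F (c ⊗ xᘁ)` of a morphism `F x ⟶ F c`. -/
def dualName {x c : C} (g : F.obj x ⟶ F.obj c) : 𝟙_ D ⟶ F.obj (c ⊗ xᘁ) :=
  mapCoev F x ≫ g ▷ F.obj xᘁ ≫ μ F c xᘁ

/-- The morphism `F v ⟶ 𝟙 ⊗ F v ⟶ F u ⊗ F v ≅ F (u ⊗ v)` defined by `a : 𝟙 ⟶ F u`. -/
def mulName {u : C} (a : 𝟙_ D ⟶ F.obj u) (v : C) : F.obj v ⟶ F.obj (u ⊗ v) :=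
  (λ_ _).inv ≫ a ▷ F.obj v ≫ μ F u v

/-- The contraction `(c ⊗ xᘁ) ⊗ x ⟶ c`. -/
def contract (c x : C) : (c ⊗ xᘁ) ⊗ x ⟶ c := (α_ _ _ _).hom ≫ c ◁ ε_ x xᘁ ≫ (ρ_ c).hom

/-- The expansion `u ⟶ (u ⊗ v) ⊗ vᘁ`. -/
def expand (u v : C) : u ⟶ (u ⊗ v) ⊗ vᘁ := (ρ_ u).inv ≫ u ◁ η_ v vᘁ ≫ (α_ _ _ _).inv

lemma mapCoev_mate {x x' : C} (a : x ⟶ x') :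
    mapCoev F x' ≫ F.obj x' ◁ F.map (aᘁ) = mapCoev F x ≫ F.map a ▷ F.obj xᘁ := by
  simp only [mapCoev, Category.assoc, δ_natural_right, δ_natural_left]
  rw [← F.map_comp_assoc, ← F.map_comp_assoc, coevaluation_comp_rightAdjointMate]

/-- Naturality of `dualName` in the source, for morphisms in the image of `F`. -/
lemma dualName_map_comp {x x' c : C} (a : x ⟶ x') (g : F.obj x' ⟶ F.obj c) :
    dualName (F.map a ≫ g) = dualName g ≫ F.map (c ◁ (aᘁ)) := by
  simp only [dualName, comp_whiskerRight, Category.assoc, ← μ_natural_right]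
  rw [← whisker_exchange_assoc, reassoc_of% mapCoev_mate a]

lemma mate_contract {x x' : C} (c : C) (a : x ⟶ x') :
    (c ◁ (aᘁ)) ▷ x ≫ contract c x = (c ⊗ x'ᘁ) ◁ a ≫ contract c x' := by
  simp only [contract]
  rw [associator_naturality_middle_assoc, associator_naturality_right_assoc,
    ← whiskerLeft_comp_assoc, ← whiskerLeft_comp_assoc, rightAdjointMate_comp_evaluation]

/-- Naturality of `dualName` in the target, for morphisms in the image of `F`. -/
lemma dualName_comp_map {x c c' : C} (g : F.obj x ⟶ F.obj c) (f : c ⟶ c') :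
    dualName (g ≫ F.map f) = dualName g ≫ F.map (f ▷ xᘁ) := by
  simp only [dualName, comp_whiskerRight, Category.assoc, ← μ_natural_left]

lemma contract_nat {c c' : C} (x : C) (f : c ⟶ c') :
    (f ▷ xᘁ) ▷ x ≫ contract c' x = contract c x ≫ f := by
  simp only [contract, Category.assoc]
  rw [associator_naturality_left_assoc, ← whisker_exchange_assoc, rightUnitor_naturality]

/-- Together with `expand_contract`, this says that passing from `𝟙 ⟶ F u` to a morphism between
objects in the image of `F` and back gives the original element. -/
lemma dualName_mulName {u v : C} (a : 𝟙_ D ⟶ F.obj u) :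
    dualName (mulName a v) = a ≫ F.map (expand u v) := by
  simp only [dualName, mulName, expand, Functor.map_comp, Functor.Monoidal.map_whiskerLeft,
    Functor.Monoidal.map_associator_inv, Functor.Monoidal.map_rightUnitor_inv, Category.assoc,
    Functor.Monoidal.μ_δ_assoc]
  have h : F.obj u ◁ mapCoev F v =
      F.obj u ◁ ε F ≫ F.obj u ◁ F.map (η_ v vᘁ) ≫ F.obj u ◁ δ F v vᘁ := by
    simp [mapCoev]
  rw [← reassoc_of% h]
  calc _ = (mapCoev F v ≫ (λ_ _).inv) ≫ a ▷ _ ≫ (α_ _ _ _).inv ≫ μ F u v ▷ F.obj vᘁ ≫ μ F _ _ := by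
        simp only [comp_whiskerRight, Category.assoc, leftUnitor_inv_whiskerRight,
          associator_inv_naturality_left_assoc]
    _ = _ := by
        rw [leftUnitor_inv_naturality, Category.assoc, whisker_exchange_assoc, unitors_inv_equal,
          ← rightUnitor_inv_naturality_assoc]

lemma expand_contract (u v : C) : expand u v ▷ v ≫ contract (u ⊗ v) v = 𝟙 _ := by
  have h := ExactPairing.evaluation_coevaluation v vᘁ
  calc _ = 𝟙 _ ⊗≫ u ◁ (η_ v vᘁ ▷ v ≫ (α_ _ _ _).hom ≫ v ◁ ε_ v vᘁ) ⊗≫ 𝟙 _ := by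
        dsimp only [expand, contract]; monoidal
    _ = _ := by rw [h]; monoidal

/-- A morphism `F x ⟶ F c` is recovered from its name by contraction. -/
lemma mulName_dualName {x c : C} (g : F.obj x ⟶ F.obj c) :
    mulName (dualName g) x ≫ F.map (contract c x) = g := by
  have h := mapCoev_mapEv F x
  simp only [dualName, mulName, contract, Functor.map_comp, Functor.Monoidal.map_whiskerLeft,
    Functor.Monoidal.map_associator, Functor.Monoidal.map_rightUnitor, Category.assoc,
    Functor.Monoidal.μ_δ_assoc]
  have h' : F.obj c ◁ mapEv F x =
      F.obj c ◁ μ F xᘁ x ≫ F.obj c ◁ F.map (ε_ x xᘁ) ≫ F.obj c ◁ η F := by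
    simp only [mapEv, whiskerLeft_comp]
  rw [← reassoc_of% h']
  simp only [comp_whiskerRight, Category.assoc]
  rw [← comp_whiskerRight_assoc (μ F c xᘁ), Functor.Monoidal.μ_δ, id_whiskerRight,
    Category.id_comp, associator_naturality_left_assoc, ← whisker_exchange_assoc,
    reassoc_of% h, rightUnitor_naturality]
  simp only [Iso.inv_hom_id_assoc]

end Duals

/-! ### The projection formula -/

/-- A morphism of representations with bijective components is an isomorphism. -/
lemma Rep.isIso_of_bijective {k : Type w} [CommRing k] {C : Type u₁} [Category.{w} C]
    [Preadditive C] [Linear k C] {M N : Rep k C} (φ : M ⟶ N)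
    (h : ∀ c, Function.Bijective (Rep.app φ c)) : IsIso φ := by
  let e (c : C) := LinearEquiv.ofBijective (Rep.app φ c) (h c)
  have he (c : C) (m : M.val c) : e c m = Rep.app φ c m := rfl
  refine ⟨Rep.mkHom (fun c => (e c).symm.toLinearMap) (fun {c d} f n => ?_), ?_, ?_⟩
  · apply (e d).injective
    simp only [LinearEquiv.coe_coe]
    rw [LinearEquiv.apply_symm_apply, he, Rep.app_act, ← he, LinearEquiv.apply_symm_apply]
  · exact Rep.hom_ext' fun c m => (e c).symm_apply_apply m
  · exact Rep.hom_ext' fun c m => (e c).apply_symm_apply m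

section Projection

variable {k : Type w} [CommRing k]
  {C : Type u₁} [Category.{w} C] [Preadditive C] [Linear k C] [MonoidalCategory C]
  [MonoidalPreadditive C] [MonoidalLinear k C] [SymmetricCategory C] [EssentiallySmall.{w} C]
  {D : Type u₂} [Category.{w} D] [Preadditive D] [Linear k D] [MonoidalCategory D]
  [MonoidalPreadditive D] [MonoidalLinear k D] [SymmetricCategory D] [EssentiallySmall.{w} D]
  {F : C ⥤ D} [F.Additive] [F.Linear k] [F.Braided]

open Functor.LaxMonoidal Functor.OplaxMonoidal

variable (k F) in
/-- An element of `A = F^*(𝟙)` at `u` is a morphism `𝟙 ⟶ F u`. -/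
def algVal (u : C) : (𝟙_ D ⟶ F.obj u) ≃ₗ[k] (algA k F).val u := LinearEquiv.refl k _

lemma algA_act {u u' : C} (f : u ⟶ u') (a : 𝟙_ D ⟶ F.obj u) :
    (algA k F).act f (algVal k F u a) = algVal k F u' (a ≫ F.map f) := rfl

/-- The action of `A` on `F^* N` sends `a ⊗ n` to `(𝟙 ⊗ F v ⟶ F u ⊗ F v ≅ F (u ⊗ v)) · n`. -/
lemma app_compAct (N : Rep k D) {u v : C} (a : 𝟙_ D ⟶ F.obj u) (n : N.val (F.obj v)) :
    Rep.app (compAct F N) (u ⊗ v) (Day.tmul (algVal k F u a) (inc F n)) =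
      inc F (N.act (mulName a v) n) := by
  refine (Rep.app_comp (μ (restrict k F) (𝟙_ (Rep k D)) N) _ _ _).trans ?_
  have h := app_resMul (F := F) (N := 𝟙_ (Rep k D)) (N' := N) (Day.unit.mk a) n
  refine (congrArg (Rep.app ((restrict k F).map (λ_ N).hom) (u ⊗ v)) h).trans ?_
  rw [restrict_app, Rep.app_act, Day.app_lambda_hom, Rep.act_act, mulName, Category.assoc]
  rfl

variable {L : Rep k C ⥤ Rep k D} (adj : L ⊣ restrict k F) {M : Rep k C}

lemma projMap_eq (M : Rep k C) :
    projMap adj M = algA k F ◁ Ind.unitHom adj M ≫ compAct F (L.obj M) := rfl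

lemma app_projMap {u v : C} (a : 𝟙_ D ⟶ F.obj u) (m : M.val v) :
    Rep.app (projMap adj M) (u ⊗ v) (Day.tmul (algVal k F u a) m) =
      inc F ((L.obj M).act (mulName a v) (Ind.unit adj m)) := by
  rw [projMap_eq, Rep.app_comp, Day.app_whiskerLeft, ← Ind.inc_unit, app_compAct]

section Inverse

variable [RightRigidCategory C]

/-- The pairing `(g, m) ↦ [contraction, name of g, m]` defining the inverse of `π_M`. -/
def projPairing (M : Rep k C) (c x : C) :
    (F.obj x ⟶ F.obj c) →ₗ[k] M.val x →ₗ[k] (algA k F ⊗ M).val c :=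
  LinearMap.mk₂ k
    (fun g m => (algA k F ⊗ M).act (contract c x) (Day.tmul (algVal k F _ (dualName g)) m))
    (by simp [dualName]) (by simp [dualName]) (by simp) (by simp)

lemma projPairing_apply {c x : C} (g : F.obj x ⟶ F.obj c) (m : M.val x) :
    projPairing M c x g m =
      (algA k F ⊗ M).act (contract c x) (Day.tmul (algVal k F _ (dualName g)) m) := rfl

lemma projPairing_act (c : C) {x x' : C} (a : x ⟶ x') (g : F.obj x' ⟶ F.obj c) (m : M.val x) :
    projPairing M c x (F.map a ≫ g) m = projPairing M c x' g (M.act a m) := by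
  rw [projPairing_apply, projPairing_apply, dualName_map_comp, ← algA_act, Day.act_tmul,
    Day.tmul_act, Rep.act_act, Rep.act_act, mate_contract]

/-- The components of the inverse of `π_M`. -/
def projInv (M : Rep k C) (c : C) : (L.obj M).val (F.obj c) →ₗ[k] (algA k F ⊗ M).val c :=
  Ind.desc adj (projPairing M c) (projPairing_act c)

lemma projInv_act {c x : C} (g : F.obj x ⟶ F.obj c) (m : M.val x) :
    projInv adj M c ((L.obj M).act g (Ind.unit adj m)) =
      (algA k F ⊗ M).act (contract c x) (Day.tmul (algVal k F _ (dualName g)) m) :=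
  Ind.desc_act adj (projPairing M c) (projPairing_act c) g m

lemma projInv_projMap (c : C) (x : (algA k F ⊗ M).val c) :
    projInv adj M c ((inc F).symm (Rep.app (projMap adj M) c x)) = x := by
  induction x using Day.induction with
  | zero => simp only [map_zero]
  | add x y hx hy => simp only [map_add, hx, hy]
  | gen u v f a m =>
    obtain ⟨a, rfl⟩ := (algVal k F u).surjective a
    change projInv adj M c ((inc F).symm (Rep.app _ _ ((algA k F ⊗ M).act f
      (Day.tmul (algVal k F u a) m)))) = (algA k F ⊗ M).act f (Day.tmul (algVal k F u a) m)
    rw [Rep.app_act, app_projMap, restrict_act, LinearEquiv.symm_apply_apply, Rep.act_act,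
      projInv_act, dualName_comp_map, dualName_mulName, Category.assoc, ← F.map_comp,
      ← algA_act, Day.act_tmul, Rep.act_act, comp_whiskerRight, Category.assoc, contract_nat,
      ← Category.assoc, expand_contract, Category.id_comp]

lemma projMap_projInv (c : C) (y : (L.obj M).val (F.obj c)) :
    Rep.app (projMap adj M) c (projInv adj M c y) = inc F y := by
  induction y using Ind.induction adj with
  | zero => simp only [map_zero]
  | add x y hx hy => simp only [map_add, hx, hy]
  | act x g m =>
    rw [projInv_act, Rep.app_act, app_projMap, restrict_act, Rep.act_act, mulName_dualName]

end Inverse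

/-- The projection formula: if `C` is rigid then `π_M : A ⊗ M ⟶ F^* F_! M` is an isomorphism. -/
lemma isIso_projMap (hC : IsRigid C) (M : Rep k C) : IsIso (projMap adj M) := by
  let : RightRigidCategory C :=
    { rightDual := fun X => { rightDual := (hC X).choose, exact := (hC X).choose_spec.some } }
  refine Rep.isIso_of_bijective _ fun c => ⟨?_, ?_⟩
  · intro x y h
    rw [← projInv_projMap adj c x, ← projInv_projMap adj c y, h]
  · intro y
    obtain ⟨y, rfl⟩ := (inc F).surjective y
    exact ⟨_, projMap_projInv adj c y⟩

end Projection

/-! ### Free modules -/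

namespace Modu

section Free

open scoped MonObj

variable {V : Type u} [Category.{v} V] [MonoidalCategory V] {A : V} [MonObj A]

/-- The action `A ⊗ M ⟶ M`, as a morphism of modules out of a free module. -/
def freeCounit (M : Mod V A) : (free A).obj M.X ⟶ M :=
  mkHom (M := (free A).obj M.X) (la M) (by
    change ((α_ A A M.X).inv ≫ μ ▷ M.X) ≫ la M = A ◁ la M ≫ la M
    rw [Category.assoc, mul_la, Iso.inv_hom_id_assoc])

lemma freeCounit_nat {M N : Mod V A} (f : M ⟶ N) :
    freeCounit M ≫ f = (free A).map f.hom ≫ freeCounit N :=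
  Mod.hom_ext _ _ (smul_hom' f)

variable (A) in
/-- Free modules are left adjoint to the forgetful functor. -/
def freeForgetAdj : free A ⊣ Mod.forget (D := V) A :=
  Adjunction.mkOfUnitCounit
    { unit :=
        { app := fun X => (λ_ X).inv ≫ η[A] ▷ X
          naturality := fun X Y f => by
            change f ≫ (λ_ Y).inv ≫ η[A] ▷ Y = ((λ_ X).inv ≫ η[A] ▷ X) ≫ A ◁ f
            rw [leftUnitor_inv_naturality_assoc, whisker_exchange, Category.assoc] }
      counit :=
        { app := freeCounit
          naturality := fun M N f => (freeCounit_nat f).symm }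
      left_triangle := by
        refine NatTrans.ext (funext fun X => Mod.hom_ext _ _ ?_)
        change A ◁ ((λ_ X).inv ≫ η[A] ▷ X) ≫ 𝟙 _ ≫ (α_ A A X).inv ≫ μ ▷ X = 𝟙 _
        have h : A ◁ (η[A] ▷ X) ≫ (α_ A A X).inv ≫ μ ▷ X =
            (α_ A (𝟙_ V) X).inv ≫ (ρ_ A).hom ▷ X := by
          rw [associator_inv_naturality_middle_assoc, ← comp_whiskerRight, MonObj.mul_one]
        rw [Category.id_comp, whiskerLeft_comp, Category.assoc, h]
        simp
      right_triangle := by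
        ext M
        change ((λ_ M.X).inv ≫ η[A] ▷ M.X) ≫ 𝟙 _ ≫ la M = 𝟙 _
        rw [Category.id_comp, Category.assoc, one_la, Iso.inv_hom_id] }

end Free

end Modu

/-! ### The comparison functor is an equivalence -/

section Comparison

variable {k : Type w} [CommRing k]
  {C : Type u₁} [Category.{w} C] [Preadditive C] [Linear k C] [MonoidalCategory C]
  [MonoidalPreadditive C] [MonoidalLinear k C] [SymmetricCategory C] [EssentiallySmall.{w} C]
  {D : Type u₂} [Category.{w} D] [Preadditive D] [Linear k D] [MonoidalCategory D]
  [MonoidalPreadditive D] [MonoidalLinear k D] [SymmetricCategory D] [EssentiallySmall.{w} D]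
  {F : C ⥤ D} [F.Additive] [F.Linear k] [F.Braided]

lemma comparison_additive : (comparison k F).Additive where
  map_add := rfl

lemma comparison_linear : (comparison k F).Linear k where
  map_smul _ _ := rfl

section Adj

variable {L : Rep k C ⥤ Rep k D} (adj : L ⊣ restrict k F)

/-- The action on `E N` is recovered from `π` and the counit. -/
lemma compAct_eq (N : Rep k D) : compAct F N =
    projMap adj ((restrict k F).obj N) ≫ (restrict k F).map (Ind.counitHom adj N) := by
  rw [projMap_eq, Category.assoc, compAct_nat, ← whiskerLeft_comp_assoc,
    Ind.unitHom_counitHom, whiskerLeft_id, Category.id_comp]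

/-- The morphism `π_M`, as a morphism of modules `A ⊗ M ⟶ E (F_! M)`. -/
def projHom (M : Rep k C) : (Modu.free (algA k F)).obj M ⟶ (comparison k F).obj (L.obj M) :=
  Modu.mkHom (M := (Modu.free (algA k F)).obj M) (N := (comparison k F).obj (L.obj M))
    (projMap adj M) (by
      change ((α_ (algA k F) (algA k F) M).inv ≫ MonObj.mul ▷ M) ≫ projMap adj M =
        algA k F ◁ projMap adj M ≫ compAct F (L.obj M)
      rw [projMap_eq, Category.assoc, ← whisker_exchange_assoc, mul_compAct,
        associator_naturality_right_assoc, Iso.inv_hom_id_assoc, whiskerLeft_comp,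
        Category.assoc])

lemma projMap_nat {M M' : Rep k C} (φ : M ⟶ M') :
    algA k F ◁ φ ≫ projMap adj M' = projMap adj M ≫ (restrict k F).map (L.map φ) := by
  rw [projMap_eq, projMap_eq, Category.assoc, compAct_nat, ← whiskerLeft_comp_assoc,
    ← whiskerLeft_comp_assoc, Ind.unitHom_nat]

/-- The unit of `A` followed by `π` is the unit of the adjunction. -/
lemma one_projMap (M : Rep k C) : (λ_ M).inv ≫ MonObj.one (X := algA k F) ▷ M ≫ projMap adj M =
    Ind.unitHom adj M := by
  rw [projMap_eq, ← whisker_exchange_assoc, one_compAct, leftUnitor_naturality,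
    Iso.inv_hom_id_assoc]

variable (hC : IsRigid C)

/-- The isomorphism `Free ≅ E F_!` given by `π`. -/
def projIso : Modu.free (algA k F) ≅ L ⋙ comparison k F :=
  NatIso.ofComponents
    (fun M => Modu.mkIso (M := (Modu.free (algA k F)).obj M) (N := (comparison k F).obj (L.obj M))
        (@asIso _ _ _ _ (projMap adj M) (isIso_projMap adj hC M)) (Modu.smul_hom' (projHom adj M)))
    (fun φ => Mod.hom_ext _ _ (projMap_nat adj φ))

lemma projIso_hom (M : Rep k C) : ((projIso adj hC).hom.app M).hom = projMap adj M := rfl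

/-- The structure of an algebra over the monad `F^* F_!` on an `A`-module `M`: the morphism of
modules `E (F_! M) ≅ A ⊗ M ⟶ M`. -/
def algMap (M : AMod k F) : (comparison k F).obj (L.obj M.X) ⟶ M :=
  (projIso adj hC).inv.app M.X ≫ Modu.freeCounit M

/-- The morphism of representations `F^* F_! M ⟶ M` underlying `algMap`. -/
def algHom (M : AMod k F) : (restrict k F).obj (L.obj M.X) ⟶ M.X := (algMap adj hC M).hom

lemma projMap_algHom (M : AMod k F) : projMap adj M.X ≫ algHom adj hC M = Modu.la M := by
  have h : (projIso adj hC).hom.app M.X ≫ algMap adj hC M = Modu.freeCounit M := by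
    simp [algMap]
  exact congrArg Mod.Hom.hom h

lemma algMap_nat {M M' : AMod k F} (f : M ⟶ M') :
    algMap adj hC M ≫ f = (comparison k F).map (L.map f.hom) ≫ algMap adj hC M' := by
  have h := (projIso adj hC).inv.naturality f.hom
  rw [algMap, Category.assoc, Modu.freeCounit_nat, ← Category.assoc]
  exact ((congrArg (· ≫ Modu.freeCounit M') h).symm.trans (Category.assoc _ _ _))

lemma algHom_nat {M M' : AMod k F} (f : M ⟶ M') :
    algHom adj hC M ≫ f.hom = (restrict k F).map (L.map f.hom) ≫ algHom adj hC M' :=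
  congrArg Mod.Hom.hom (algMap_nat adj hC f)

lemma unitHom_algHom (M : AMod k F) : Ind.unitHom adj M.X ≫ algHom adj hC M = 𝟙 _ := by
  rw [← one_projMap, Category.assoc, Category.assoc, projMap_algHom, Modu.one_la,
    Iso.inv_hom_id]

/-- On an object `E N`, the algebra structure is the one given by the counit. -/
lemma algHom_comparison (N : Rep k D) :
    algHom adj hC ((comparison k F).obj N) = (restrict k F).map (Ind.counitHom adj N) := by
  have := isIso_projMap adj hC ((restrict k F).obj N)
  apply (cancel_epi (projMap adj ((restrict k F).obj N))).1
  exact (projMap_algHom adj hC ((comparison k F).obj N)).trans (compAct_eq adj N)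

/-- The law of an algebra over the monad `F^* F_!`. -/
lemma algHom_algHom (M : AMod k F) :
    (restrict k F).map (Ind.counitHom adj (L.obj M.X)) ≫ algHom adj hC M =
      (restrict k F).map (L.map (algHom adj hC M)) ≫ algHom adj hC M := by
  rw [← algHom_comparison adj hC]
  exact algHom_nat adj hC (algMap adj hC M)

/-- The action on an `A`-module `M` of the morphisms `F c ⟶ F c'` of `D`: the morphism `g` sends
`m ∈ M(c)` to the image of `g · η(m) ∈ (F_! M)(F c')` under the algebra structure. -/
def hat (M : AMod k F) {c c' : C} : (F.obj c ⟶ F.obj c') →ₗ[k] M.X.val c →ₗ[k] M.X.val c' :=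
  LinearMap.mk₂ k (fun g m => Rep.app (algHom adj hC M) c'
      (inc F ((L.obj M.X).act g (Ind.unit adj m))))
    (by simp [Rep.act_add]) (by simp [Rep.act_smul]) (by simp) (by simp)

section
variable (M : AMod k F) {c c' c'' : C}

lemma hat_apply (g : F.obj c ⟶ F.obj c') (m : M.X.val c) :
    hat adj hC M g m = Rep.app (algHom adj hC M) c'
      (inc F ((L.obj M.X).act g (Ind.unit adj m))) := rfl

/-- The action of the morphisms of `D` extends that of the morphisms of `C`. -/
lemma hat_map (f : c ⟶ c') (m : M.X.val c) : hat adj hC M (F.map f) m = M.X.act f m := by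
  rw [hat_apply, ← Ind.unit_act, Ind.inc_unit, ← Rep.app_comp, unitHom_algHom, Rep.app_id]

lemma hat_comp (g : F.obj c ⟶ F.obj c') (g' : F.obj c' ⟶ F.obj c'') (m : M.X.val c) :
    hat adj hC M g' (hat adj hC M g m) = hat adj hC M (g ≫ g') m := by
  have h := congrArg (fun t => Rep.app t c'' (inc F ((L.obj _).act g' (Ind.unit adj (inc F
    ((L.obj M.X).act g (Ind.unit adj m))))))) (algHom_algHom adj hC M)
  simp only [Rep.app_comp] at h
  rw [restrict_app, restrict_app, Rep.app_act, Rep.app_act, ← Ind.unit_app,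
    Ind.app_counitHom, Rep.act_act] at h
  exact h.symm

/-- Morphisms of `A`-modules commute with the action of the morphisms of `D`. -/
lemma hat_app {M M' : AMod k F} (f : M ⟶ M') (g : F.obj c ⟶ F.obj c') (m : M.X.val c) :
    Rep.app f.hom c' (hat adj hC M g m) = hat adj hC M' g (Rep.app f.hom c m) := by
  rw [hat_apply, hat_apply, Ind.unit_app, ← Rep.app_act, ← restrict_app, ← Rep.app_comp,
    ← Rep.app_comp, algHom_nat]

/-- The identification of `N(F c)` with `(E N)(c)`. -/
def compInc {N : Rep k D} {c : C} : N.val (F.obj c) ≃ₗ[k] ((comparison k F).obj N).X.val c :=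
  inc F

lemma hat_comparison (N : Rep k D) (g : F.obj c ⟶ F.obj c') (n : N.val (F.obj c)) :
    hat adj hC ((comparison k F).obj N) g (compInc n) = compInc (N.act g n) := by
  rw [hat_apply, algHom_comparison]
  change inc F (Rep.app (Ind.counitHom adj N) _ ((L.obj _).act g (Ind.unit adj (inc F n)))) = _
  rw [Rep.app_act, Ind.app_counitHom]
  rfl

/-- The action of `A` is determined by the action of the morphisms of `D`. -/
lemma la_tmul (a : 𝟙_ D ⟶ F.obj c) (m : M.X.val c') :
    Rep.app (Modu.la M) (c ⊗ c') (Day.tmul (algVal k F c a) m) =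
      hat adj hC M (mulName a c') m := by
  rw [← projMap_algHom adj hC, hat_apply, ← app_projMap, Rep.app_comp]

end

end Adj

section EssSurj

variable [F.EssSurj]

/-- If `F` is essentially surjective, a morphism `F^* N ⟶ F^* N'` that commutes with the
morphisms of `D` comes from a morphism `N ⟶ N'`. -/
lemma exists_restrict_map {N N' : Rep k D} (φ : (restrict k F).obj N ⟶ (restrict k F).obj N')
    (h : ∀ {c c' : C} (g : F.obj c ⟶ F.obj c') (n : N.val (F.obj c)),
      (inc F).symm (Rep.app φ c' (inc F (N.act g n))) =
        N'.act g ((inc F).symm (Rep.app φ c (inc F n)))) :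
    ∃ ψ : N ⟶ N', (restrict k F).map ψ = φ := by
  let e (d : D) := F.objObjPreimageIso d
  refine ⟨Rep.mkHom (fun d => N'.act (e d).hom ∘ₗ (inc F).symm.toLinearMap ∘ₗ
    Rep.app φ _ ∘ₗ (inc F).toLinearMap ∘ₗ N.act (e d).inv) ?_, ?_⟩
  · intro d d' f n
    simp only [LinearMap.comp_apply, LinearEquiv.coe_coe]
    have h' := h ((e d).hom ≫ f ≫ (e d').inv) (N.act (e d).inv n)
    rw [Rep.act_act] at h'
    simp only [Iso.inv_hom_id_assoc] at h'
    rw [Rep.act_act, h', Rep.act_act, Rep.act_act]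
    simp
  · apply Rep.hom_ext'
    intro c
    refine forall_inc fun n => ?_
    rw [restrict_app, Rep.app_mkHom]
    simp only [LinearMap.comp_apply, LinearEquiv.coe_coe]
    rw [h, Rep.act_act, Iso.inv_hom_id, Rep.act_id, LinearEquiv.apply_symm_apply]

lemma restrict_faithful : (restrict k F).Faithful where
  map_injective {N N'} φ ψ h := by
    apply Rep.hom_ext'
    intro d n
    have h' : Rep.app φ (F.obj (F.objPreimage d)) (N.act (F.objObjPreimageIso d).inv n) =
        Rep.app ψ _ (N.act (F.objObjPreimageIso d).inv n) :=
      congrArg (fun t => Rep.app t (F.objPreimage d)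
        (inc F (N.act (F.objObjPreimageIso d).inv n))) h
    have h'' := congrArg (N'.act (F.objObjPreimageIso d).hom) h'
    rw [← Rep.app_act, ← Rep.app_act, Rep.act_act, Iso.inv_hom_id, Rep.act_id] at h''
    exact h''

lemma comparison_faithful : (comparison k F).Faithful :=
  haveI := restrict_faithful (k := k) (F := F)
  ⟨fun h => (restrict k F).map_injective (congrArg Mod.Hom.hom h)⟩

variable {L : Rep k C ⥤ Rep k D} (adj : L ⊣ restrict k F) (hC : IsRigid C)

include adj hC in
/-- A morphism `E N ⟶ E N'` of `A`-modules commutes with the action of the morphisms of `D`, so it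
comes from a morphism `N ⟶ N'`. -/
lemma comparison_full : (comparison k F).Full where
  map_surjective {N N'} f := by
    obtain ⟨ψ, hψ⟩ := exists_restrict_map (N := N) (N' := N') f.hom (fun {c c'} g n => by
      apply (inc F).injective
      rw [LinearEquiv.apply_symm_apply]
      have h := hat_app adj hC f g (compInc n)
      rw [hat_comparison] at h
      exact h.trans (hat_comparison adj hC N' g _))
    exact ⟨ψ, Mod.hom_ext _ _ hψ⟩

/-- The representation of `D` defined by an `A`-module `M`, for `F` essentially surjective:
its value at `d` is the value of `M` at a chosen preimage of `d`. -/
def descend (M : AMod k F) : Rep k D :=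
  Rep.mkObj (fun d => M.X.val (F.objPreimage d))
    (fun {d d'} g => hat adj hC M ((F.objObjPreimageIso d).hom ≫ g ≫
      (F.objObjPreimageIso d').inv))
    (fun d m => by
      rw [Category.id_comp, Iso.hom_inv_id, ← F.map_id, hat_map, Rep.act_id])
    (fun g g' m => by
      rw [hat_comp]
      simp)
    (fun g g' m => by
      rw [Preadditive.add_comp, Preadditive.comp_add, map_add, LinearMap.add_apply])
    (fun r g m => by
      rw [Linear.smul_comp, Linear.comp_smul, map_smul, LinearMap.smul_apply])

/-- The identification of the values of `descend M`. -/
def descendVal (M : AMod k F) (d : D) :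
    M.X.val (F.objPreimage d) ≃ₗ[k] (descend adj hC M).val d := LinearEquiv.refl k _

lemma act_descendVal (M : AMod k F) {d d' : D} (g : d ⟶ d') (m : M.X.val (F.objPreimage d)) :
    (descend adj hC M).act g (descendVal adj hC M d m) =
      descendVal adj hC M d' (hat adj hC M ((F.objObjPreimageIso d).hom ≫ g ≫
        (F.objObjPreimageIso d').inv) m) := rfl

/-- The canonical morphism `F^* (descend M) ⟶ M`. -/
def descendHom (M : AMod k F) : (restrict k F).obj (descend adj hC M) ⟶ M.X :=
  Rep.mkHom (fun c => hat adj hC M (F.objObjPreimageIso (F.obj c)).hom ∘ₗ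
      (descendVal adj hC M (F.obj c)).symm.toLinearMap ∘ₗ (inc F).symm.toLinearMap)
    (fun {c c'} f => forall_inc fun n => by
      obtain ⟨m, rfl⟩ := (descendVal adj hC M (F.obj c)).surjective n
      rw [restrict_act, act_descendVal]
      simp only [LinearMap.comp_apply, LinearEquiv.coe_coe, LinearEquiv.symm_apply_apply]
      rw [hat_comp, ← hat_map adj hC, hat_comp]
      simp)

lemma app_descendHom (M : AMod k F) (c : C) (m : M.X.val (F.objPreimage (F.obj c))) :
    Rep.app (descendHom adj hC M) c (inc F (descendVal adj hC M (F.obj c) m)) =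
      hat adj hC M (F.objObjPreimageIso (F.obj c)).hom m := rfl

lemma isIso_descendHom (M : AMod k F) : IsIso (descendHom adj hC M) := by
  apply Rep.isIso_of_bijective
  intro c
  have hb : Function.Bijective (hat adj hC M (F.objObjPreimageIso (F.obj c)).hom) := by
    refine Function.bijective_iff_has_inverse.2
      ⟨hat adj hC M (F.objObjPreimageIso (F.obj c)).inv, fun m => ?_, fun m => ?_⟩
    · rw [hat_comp, Iso.hom_inv_id, ← F.map_id, hat_map, Rep.act_id]
    · rw [hat_comp, Iso.inv_hom_id, ← F.map_id, hat_map, Rep.act_id]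
  exact hb

lemma descendHom_linear (M : AMod k F) :
    compAct F (descend adj hC M) ≫ descendHom adj hC M =
      algA k F ◁ descendHom adj hC M ≫ Modu.la M := by
  apply Day.tensor_hom_ext
  intro u v a
  obtain ⟨a, rfl⟩ := (algVal k F u).surjective a
  refine forall_inc fun n => ?_
  obtain ⟨m, rfl⟩ := (descendVal adj hC M (F.obj v)).surjective n
  rw [Rep.app_comp, Rep.app_comp, app_compAct, act_descendVal, app_descendHom,
    Day.app_whiskerLeft, app_descendHom, la_tmul adj hC, hat_comp, hat_comp]
  simp

include adj hC in
lemma comparison_essSurj : (comparison k F).EssSurj where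
  mem_essImage M :=
    ⟨descend adj hC M, ⟨Modu.mkIso (M := (comparison k F).obj (descend adj hC M))
      (@asIso _ _ _ _ (descendHom adj hC M) (isIso_descendHom adj hC M))
      (descendHom_linear adj hC M)⟩⟩

include adj hC in
lemma comparison_isEquivalence : (comparison k F).IsEquivalence where
  faithful := comparison_faithful
  full := comparison_full adj hC
  essSurj := comparison_essSurj adj hC

end EssSurj

end Comparison

/-! ### Modules over a monoid whose forgetful functor is full -/

namespace Modu

section ActLeft

open scoped MonObj

variable {V : Type u} [Category.{v} V] [MonoidalCategory V] {A : V} [MonObj A]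

/-- The module `M ⊗ X`, on which `A` acts through `M`. -/
def tensorRightMod (M : Mod V A) (X : V) : Mod V A :=
  mkMod (M.X ⊗ X) ((α_ A M.X X).inv ≫ la M ▷ X)
    (by
      rw [associator_inv_naturality_left_assoc, ← comp_whiskerRight, one_la]
      simp)
    (by
      rw [associator_inv_naturality_left_assoc, ← comp_whiskerRight, mul_la]
      simp)

variable [SymmetricCategory V]

/-- If all morphisms between the objects underlying `A`-modules are `A`-linear, the two actions
of `A` on `M ⊗ N` agree. -/
lemma relL_eq_relR [(Mod.forget (D := V) A).Full] (M N : Mod V A) : relL M N = relR M N := by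
  -- The symmetry is linear for the actions of `A` on the first factor of `M ⊗ N` and of `N ⊗ M`.
  obtain ⟨f, hf⟩ := (Mod.forget (D := V) A).map_surjective
    (X := tensorRightMod M N.X) (Y := tensorRightMod N M.X) (β_ M.X N.X).hom
  have h := smul_hom' f
  change f.hom = (β_ M.X N.X).hom at hf
  rw [hf] at h
  change ((α_ A M.X N.X).inv ≫ la M ▷ N.X) ≫ (β_ M.X N.X).hom =
    A ◁ (β_ M.X N.X).hom ≫ (α_ A N.X M.X).inv ≫ la N ▷ M.X at h
  rw [← cancel_mono (β_ M.X N.X).hom, ← cancel_epi ((α_ A M.X N.X).inv ≫ (β_ A M.X).hom ▷ N.X),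
    relL, relR, ra]
  simp only [Category.assoc, comp_whiskerRight] at h ⊢
  rw [← comp_whiskerRight_assoc, SymmetricCategory.symmetry, id_whiskerRight, Category.id_comp,
    h, BraidedCategory.braiding_naturality_right, BraidedCategory.braiding_tensor_right_hom]
  simp only [Category.assoc, Iso.hom_inv_id_assoc]
  rw [← comp_whiskerRight_assoc, SymmetricCategory.symmetry, id_whiskerRight, Category.id_comp,
    Iso.inv_hom_id_assoc]

/-- If the forgetful functor is full, `M ⊗_A N` is the coequalizer of two equal morphisms. -/
lemma isIso_pr_of_full [HasCoequalizers V] [IsCommMonObj A]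
    [∀ X : V, PreservesColimitsOfSize.{0, 0} (tensorLeft X)]
    [∀ X : V, PreservesColimitsOfSize.{0, 0} (tensorRight X)]
    [(Mod.forget (D := V) A).Full] (M N : Mod V A) : IsIso (pr M N) :=
  coequalizer.π_of_eq (relL_eq_relR M N)

end ActLeft

end Modu

/-! ### Uniqueness of the comparison functor -/

section Comparison

variable {k : Type w} [CommRing k]
  {C : Type u₁} [Category.{w} C] [Preadditive C] [Linear k C] [MonoidalCategory C]
  [MonoidalPreadditive C] [MonoidalLinear k C] [SymmetricCategory C] [EssentiallySmall.{w} C]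
  {D : Type u₂} [Category.{w} D] [Preadditive D] [Linear k D] [MonoidalCategory D]
  [MonoidalPreadditive D] [MonoidalLinear k D] [SymmetricCategory D] [EssentiallySmall.{w} D]
  {F : C ⥤ D} [F.Additive] [F.Linear k] [F.Braided]

section Characterization

variable {L : Rep k C ⥤ Rep k D} (adj : L ⊣ restrict k F)
  (E' : Rep k D ⥤ AMod k F) (i : E' ⋙ Mod.forget (algA k F) ≅ restrict k F)

/-- The isomorphism `U E' ≅ F^*` on components. -/
def underIso (N : Rep k D) : (E'.obj N).X ≅ (restrict k F).obj N := i.app N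

lemma underIso_nat {N N' : Rep k D} (f : N ⟶ N') :
    (E'.map f).hom ≫ (underIso E' i N').hom = (underIso E' i N).hom ≫ (restrict k F).map f :=
  i.hom.naturality f

variable (e' : Modu.free (algA k F) ≅ L ⋙ E')

/-- The component at `M` of the isomorphism `Free ≅ E' F_!`, on underlying objects. -/
def freeIso (M : Rep k C) : ((Modu.free (algA k F)).obj M).X ≅ (E'.obj (L.obj M)).X :=
  (Mod.forget (algA k F)).mapIso (e'.app M)

include e' in
lemma freeIso_linear (M : Rep k C) :
    Modu.la ((Modu.free (algA k F)).obj M) ≫ (freeIso E' e' M).hom =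
      algA k F ◁ (freeIso E' e' M).hom ≫ Modu.la (E'.obj (L.obj M)) :=
  Modu.smul_hom' (e'.hom.app M)

/-- The isomorphism `U E' N ≅ F^* N` is linear for `N = F_! M`, where it is determined by `π`. -/
lemma underIso_linear_ind
    (h : ∀ M : Rep k C, (freeIso E' e' M).hom ≫ (underIso E' i (L.obj M)).hom =
      (projHom adj M).hom)
    (M : Rep k C) :
    Modu.la (E'.obj (L.obj M)) ≫ (underIso E' i (L.obj M)).hom =
      algA k F ◁ (underIso E' i (L.obj M)).hom ≫ compAct F (L.obj M) := by
  rw [← cancel_epi (algA k F ◁ (freeIso E' e' M).hom), ← Category.assoc, ← freeIso_linear,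
    Category.assoc, h, ← whiskerLeft_comp_assoc, h]
  exact Modu.smul_hom' (projHom adj M)

/-- The isomorphism `U E' N ≅ F^* N` is linear for the canonical action on `F^* N`: this holds for
`F_! F^* N`, and the counit induces an epimorphism `A ⊗ U E' F_! F^* N ⟶ A ⊗ U E' N`. -/
lemma underIso_linear
    (h : ∀ M : Rep k C, (freeIso E' e' M).hom ≫ (underIso E' i (L.obj M)).hom =
      (projHom adj M).hom)
    (N : Rep k D) :
    Modu.la (E'.obj N) ≫ (underIso E' i N).hom =
      algA k F ◁ (underIso E' i N).hom ≫ compAct F N := by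
  let s := E'.map (Ind.counitHom adj N)
  have hs : s.hom = (underIso E' i _).hom ≫ (restrict k F).map (Ind.counitHom adj N) ≫
      (underIso E' i N).inv := by
    rw [← Category.assoc, Iso.eq_comp_inv, underIso_nat]
  -- `F^*` of the counit is a split epimorphism, by the triangle identity.
  have : IsSplitEpi ((restrict k F).map (Ind.counitHom adj N)) :=
    ⟨⟨⟨Ind.unitHom adj _, Ind.unitHom_counitHom adj N⟩⟩⟩
  have : Epi s.hom := by
    rw [hs]
    infer_instance
  apply (cancel_epi (algA k F ◁ s.hom)).1
  have h1 := Modu.smul_hom' s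
  rw [← Category.assoc, ← h1, Category.assoc, ← whiskerLeft_comp_assoc, underIso_nat,
    ← Category.assoc, underIso_linear_ind adj E' i e' h, whiskerLeft_comp, Category.assoc,
    Category.assoc, compAct_nat]

/-- The comparison functor is characterized by `U E ≅ F^*` and `E F_! ≅ Free`. -/
lemma existsUnique_comparison_iso
    (h : ∀ M : Rep k C, (e'.hom.app M).hom ≫ i.hom.app (L.obj M) = projMap adj M) :
    ∃! j : E' ≅ comparison k F, ∀ N : Rep k D, (j.hom.app N).hom = i.hom.app N := by
  refine ⟨NatIso.ofComponents
    (fun N => Modu.mkIso (M := E'.obj N) (N := (comparison k F).obj N) (underIso E' i N)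
      (underIso_linear adj E' i e' h N))
    (fun f => Mod.hom_ext _ _ (underIso_nat E' i f)), fun N => rfl, fun j hj => ?_⟩
  apply Iso.ext
  apply NatTrans.ext
  funext N
  exact Mod.hom_ext _ _ (hj N)

end Characterization

/-! ### The lax monoidal structure of the comparison functor -/

open Functor.LaxMonoidal

section Lax

lemma mulName_braid {u v : C} (a : 𝟙_ D ⟶ F.obj u) : mulName a v ≫ F.map (β_ u v).hom =
    (ρ_ (F.obj v)).inv ≫ F.obj v ◁ a ≫ μ F v u := by
  simp [mulName]

/-- The right action of `A` on `E N`, on elements. -/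
lemma app_ra_comparison {N : Rep k D} {u v : C} (a : 𝟙_ D ⟶ F.obj u) (n : N.val (F.obj v)) :
    Rep.app ((β_ ((restrict k F).obj N) (algA k F)).hom ≫ compAct F N) (v ⊗ u)
        (Day.tmul (inc F n) (algVal k F u a)) =
      inc F (N.act ((ρ_ (F.obj v)).inv ≫ F.obj v ◁ a ≫ μ F v u) n) := by
  rw [Rep.app_comp, Day.app_β_hom, Rep.app_act, app_compAct, restrict_act, Rep.act_act,
    mulName_braid]

/-- The lax multiplication of `F^*` is balanced over `A`. -/
lemma resMul_balanced (N N' : Rep k D) :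
    ((β_ ((restrict k F).obj N) (algA k F)).hom ≫ compAct F N) ▷ (restrict k F).obj N' ≫
        resMul F N N' =
      (α_ _ _ _).hom ≫ (restrict k F).obj N ◁ compAct F N' ≫ resMul F N N' := by
  apply Day.tensor_hom_ext₃
  intro u v x
  refine forall_inc fun n => fun a => forall_inc fun n' => ?_
  obtain ⟨a, rfl⟩ := (algVal k F v).surjective a
  rw [Rep.app_comp, Rep.app_comp, Rep.app_comp, Day.app_whiskerRight, app_ra_comparison,
    app_resMul, Day.app_α_hom, Rep.app_act, Rep.app_act, Day.app_whiskerLeft, app_compAct,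
    app_resMul, restrict_act, Day.act_tmul, Day.tmul_act, Rep.act_act, Rep.act_act, Rep.act_act]
  congr 2
  simp only [mulName, comp_whiskerRight, whiskerLeft_comp, Category.assoc]
  rw [Functor.LaxMonoidal.associativity_inv, associator_inv_naturality_middle_assoc,
    triangle_assoc_comp_left_inv_assoc]

/-- The lax multiplication of `F^*` is linear over `A`. -/
lemma resMul_linear (N N' : Rep k D) :
    algA k F ◁ resMul F N N' ≫ compAct F (N ⊗ N') =
      (α_ _ _ _).inv ≫ compAct F N ▷ (restrict k F).obj N' ≫ resMul F N N' := by
  apply Day.tensor_hom_ext₃'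
  intro u v x a
  refine forall_inc fun n => forall_inc fun n' => ?_
  obtain ⟨a, rfl⟩ := (algVal k F u).surjective a
  rw [Rep.app_comp, Rep.app_comp, Rep.app_comp, Day.app_whiskerLeft, app_resMul, app_compAct,
    Day.app_α_inv, Rep.app_act, Rep.app_act, Day.app_whiskerRight, app_compAct,
    app_resMul, restrict_act, Day.act_tmul, Rep.act_act, Rep.act_act, Rep.act_act]
  congr 2
  simp only [mulName, comp_whiskerRight, Category.assoc]
  rw [Functor.LaxMonoidal.associativity, associator_naturality_left_assoc,
    ← whisker_exchange_assoc, leftUnitor_inv_whiskerRight, Category.assoc, Iso.inv_hom_id_assoc,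
    leftUnitor_inv_naturality_assoc]

end Lax

end Comparison

section ComparisonMonoidal

variable {k : Type w} [CommRing k]
  {C : Type u₁} [Category.{w} C] [Preadditive C] [Linear k C] [MonoidalCategory C]
  [MonoidalPreadditive C] [MonoidalLinear k C] [SymmetricCategory C] [EssentiallySmall.{w} C]
  {D : Type u₂} [Category.{w} D] [Preadditive D] [Linear k D] [MonoidalCategory D]
  [MonoidalPreadditive D] [MonoidalLinear k D] [SymmetricCategory D] [EssentiallySmall.{w} D]
  {F : C ⥤ D} [F.Additive] [F.Linear k] [F.Braided]

section Lax

variable (k F) in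
/-- The unit isomorphism of the comparison functor, which is the identity of `A`. -/
def compUnitIso : Mod.regular (algA k F) ≅ (comparison k F).obj (𝟙_ (Rep k D)) :=
  Modu.mkIso (M := Mod.regular (algA k F)) (N := (comparison k F).obj (𝟙_ (Rep k D)))
    (Iso.refl (algA k F)) (by
      change MonObj.mul (X := algA k F) ≫ 𝟙 (algA k F) =
        algA k F ◁ 𝟙 (algA k F) ≫ compAct F (𝟙_ (Rep k D))
      rw [whiskerLeft_id]
      exact (Category.comp_id _).trans (mul_algA.trans (Category.id_comp _).symm))

variable (k F) in
lemma compUnitIso_hom : (compUnitIso k F).hom.hom = 𝟙 (algA k F) := rfl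

variable (F) in
/-- The lax multiplication of the comparison functor, induced by that of `F^*`. -/
def compMul (N N' : Rep k D) :
    Modu.tens ((comparison k F).obj N) ((comparison k F).obj N') ⟶
      (comparison k F).obj (N ⊗ N') :=
  Modu.tensLift (M := (comparison k F).obj N) (N := (comparison k F).obj N')
    (P := (comparison k F).obj (N ⊗ N')) (resMul F N N') (resMul_balanced N N')
    (resMul_linear N N')

lemma pr_compMul (N N' : Rep k D) :
    Modu.pr ((comparison k F).obj N) ((comparison k F).obj N') ≫ (compMul F N N').hom =
      resMul F N N' :=
  Modu.pr_tensLift (M := (comparison k F).obj N) (N := (comparison k F).obj N')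
    (P := (comparison k F).obj (N ⊗ N')) _ _ _

lemma pr_compMul_assoc (N N' : Rep k D) {Q : Rep k C}
    (h : (restrict k F).obj (N ⊗ N') ⟶ Q) :
    Modu.pr ((comparison k F).obj N) ((comparison k F).obj N') ≫ (compMul F N N').hom ≫ h =
      resMul F N N' ≫ h := by
  rw [← pr_compMul]
  exact (Category.assoc _ _ _).symm

lemma resMul_nat {N N' P P' : Rep k D} (f : N ⟶ N') (g : P ⟶ P') :
    ((restrict k F).map f ⊗ₘ (restrict k F).map g) ≫ resMul F N' P' =
      resMul F N P ≫ (restrict k F).map (f ⊗ₘ g) := by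
  rw [MonoidalCategory.tensorHom_def, MonoidalCategory.tensorHom_def, Functor.map_comp,
    Category.assoc, resMul_nat_right, ← Category.assoc, resMul_nat_left, Category.assoc]

lemma compMul_nat {N N' P P' : Rep k D} (f : N ⟶ N') (g : P ⟶ P') :
    Modu.tensMap ((comparison k F).map f) ((comparison k F).map g) ≫ compMul F N' P' =
      compMul F N P ≫ (comparison k F).map (f ⊗ₘ g) := by
  apply Modu.tens_hom_ext'
  rw [Mod.comp_hom', Mod.comp_hom', Modu.pr_tensMap_assoc, pr_compMul]
  exact (resMul_nat f g).trans (pr_compMul_assoc N P _).symm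

lemma compMul_assoc (N P Q : Rep k D) :
    Modu.tensMap (compMul F N P) (𝟙 ((comparison k F).obj Q)) ≫ compMul F (N ⊗ P) Q ≫
        (comparison k F).map (α_ N P Q).hom =
      (Modu.assoc ((comparison k F).obj N) ((comparison k F).obj P)
        ((comparison k F).obj Q)).hom ≫
        Modu.tensMap (𝟙 ((comparison k F).obj N)) (compMul F P Q) ≫ compMul F N (P ⊗ Q) := by
  apply Mod.hom_ext
  apply Modu.tens_hom_ext₃
  simp only [Mod.comp_hom']
  rw [Modu.pr_tensMap_assoc, Modu.assoc_spec, Modu.pr_tensMap_assoc, pr_compMul]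
  have h1 : Modu.pr ((comparison k F).obj N) ((comparison k F).obj P) ▷
      ((comparison k F).obj Q).X ≫ ((compMul F N P).hom ⊗ₘ
        (𝟙 ((comparison k F).obj Q) : _ ⟶ _).hom) =
      resMul F N P ▷ (restrict k F).obj Q := by
    rw [Mod.id_hom', tensorHom_id, ← comp_whiskerRight, pr_compMul]
    rfl
  have h2 : ((comparison k F).obj N).X ◁ Modu.pr ((comparison k F).obj P)
      ((comparison k F).obj Q) ≫ ((𝟙 ((comparison k F).obj N) : _ ⟶ _).hom ⊗ₘ
        (compMul F P Q).hom) =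
      (restrict k F).obj N ◁ resMul F P Q := by
    rw [Mod.id_hom', id_tensorHom, ← whiskerLeft_comp, pr_compMul]
    rfl
  rw [← Category.assoc (_ ▷ _), h1]
  refine Eq.trans ?_ ((resMul_assoc N P Q).trans ?_)
  · exact congrArg (resMul F N P ▷ (restrict k F).obj Q ≫ ·) (pr_compMul_assoc (N ⊗ P) Q _)
  · exact congrArg ((α_ ((restrict k F).obj N) ((restrict k F).obj P)
      ((restrict k F).obj Q)).hom ≫ ·)
      ((congrArg (· ≫ resMul F N (P ⊗ Q)) h2.symm).trans (Category.assoc _ _ _))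

lemma compMul_left_unit (N : Rep k D) :
    (Modu.lunit ((comparison k F).obj N)).hom =
      Modu.tensMap (compUnitIso k F).hom (𝟙 ((comparison k F).obj N)) ≫ compMul F (𝟙_ (Rep k D)) N ≫
        (comparison k F).map (λ_ N).hom := by
  refine Mod.hom_ext _ _ (Modu.tens_hom_ext ?_)
  simp only [Mod.comp_hom']
  rw [Modu.pr_tensMap_assoc]
  refine (Modu.prA_lunitHom ((comparison k F).obj N)).trans ?_
  change compAct F N = (𝟙 (algA k F) ⊗ₘ 𝟙 ((restrict k F).obj N)) ≫ _
  rw [id_tensorHom_id]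
  exact (pr_compMul_assoc (𝟙_ (Rep k D)) N _).symm.trans (Category.id_comp _).symm

lemma compMul_braided (N P : Rep k D) :
    compMul F N P ≫ (comparison k F).map (β_ N P).hom =
      (Modu.braid ((comparison k F).obj N) ((comparison k F).obj P)).hom ≫ compMul F P N := by
  apply Modu.tens_hom_ext'
  simp only [Mod.comp_hom']
  rw [Modu.pr_braid_assoc, pr_compMul]
  exact (pr_compMul_assoc N P _).trans (resMul_braided N P)

lemma compMul_right_unit (N : Rep k D) :
    (Modu.runit ((comparison k F).obj N)).hom =
      Modu.tensMap (𝟙 ((comparison k F).obj N)) (compUnitIso k F).hom ≫ compMul F N (𝟙_ (Rep k D)) ≫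
        (comparison k F).map (ρ_ N).hom := by
  rw [← braiding_leftUnitor, Functor.map_comp, ← Category.assoc (compMul F N _), compMul_braided,
    Category.assoc, ← Category.assoc, Modu.braid_nat, Category.assoc, ← compMul_left_unit]
  rfl

variable (k F) in
/-- The lax symmetric monoidal structure of the comparison functor. -/
@[reducible]
def comparisonLaxBraided : (comparison k F).LaxBraided where
  ε := (compUnitIso k F).hom
  μ N N' := compMul F N N'
  μ_natural_left f N' := (congrArg (fun t => Modu.tensMap _ t ≫ _)
    ((comparison k F).map_id N').symm).trans ((compMul_nat f (𝟙 N')).trans (by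
      rw [tensorHom_id]))
  μ_natural_right N' f := (congrArg (fun t => Modu.tensMap t _ ≫ _)
    ((comparison k F).map_id N').symm).trans ((compMul_nat (𝟙 N') f).trans (by
      rw [id_tensorHom]))
  associativity N P Q := compMul_assoc N P Q
  left_unitality N := compMul_left_unit N
  right_unitality N := compMul_right_unit N
  braided N P := compMul_braided N P

end Lax

/-! ### Restriction along a full functor -/

section Full

variable {L : Rep k C ⥤ Rep k D} (adj : L ⊣ restrict k F) (hC : IsRigid C)

variable (k F) in
/-- Every morphism `F^* N ⟶ F^* N'` commutes with the morphisms of `D` if these come from `C`. -/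
lemma restrict_full [F.EssSurj] [F.Full] : (restrict k F).Full where
  map_surjective {N N'} φ := exists_restrict_map (F := F) φ fun {c c'} g n => by
    obtain ⟨f, rfl⟩ := F.map_surjective g
    exact Rep.app_act φ f (inc F n)

include adj in
/-- The essential image of `F^*` is reflective if `F^*` is fully faithful. -/
lemma reflective_essImage [(restrict k F).Full] [(restrict k F).Faithful] :
    Nonempty (Reflective (restrict k F).essImage.ι) :=
  have : (restrict k F).IsRightAdjoint := ⟨L, ⟨adj⟩⟩
  have : (restrict k F).essImage.ι.IsRightAdjoint :=
    Functor.isRightAdjoint_of_iso (Functor.isoWhiskerLeft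
      (restrict k F).toEssImage.inv (restrict k F).toEssImageCompι.symm ≪≫
      (Functor.associator _ _ _).symm ≪≫ Functor.isoWhiskerRight
        (restrict k F).toEssImage.asEquivalence.counitIso _ ≪≫ Functor.leftUnitor _)
  ⟨{ L := _, adj := Adjunction.ofIsRightAdjoint _ }⟩

include adj hC

lemma forget_full [F.EssSurj] [F.Full] : (Mod.forget (D := Rep k C) (algA k F)).Full := by
  have := comparison_essSurj adj hC
  have := restrict_full k F
  refine Functor.full_of_comp_essSurj _ (comparison k F) fun N N' φ => ?_
  obtain ⟨ψ, hψ⟩ := (restrict k F).map_surjective φ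
  exact ⟨(comparison k F).map ψ, hψ⟩

lemma essImage_restrict [F.EssSurj] :
    (restrict k F).essImage = (Mod.forget (D := Rep k C) (algA k F)).essImage := by
  have := comparison_essSurj adj hC
  ext M
  constructor
  · rintro ⟨N, ⟨e⟩⟩
    exact ⟨(comparison k F).obj N, ⟨e⟩⟩
  · rintro ⟨P, ⟨e⟩⟩
    exact ⟨(comparison k F).objPreimage P,
      ⟨(Mod.forget (algA k F)).mapIso ((comparison k F).objObjPreimageIso P) ≪≫ e⟩⟩

/-- The essential image of `F^*` is a tensor ideal: it consists of the objects that carry an action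
of `A`, and `A` acts on `N ⊗ M` as soon as it acts on `N`. -/
lemma essImage_tensor [F.EssSurj] (M N : Rep k C) (hN : (restrict k F).essImage N) :
    (restrict k F).essImage (M ⊗ N) := by
  obtain ⟨P, ⟨e⟩⟩ := hN
  rw [essImage_restrict adj hC]
  exact ⟨Modu.tensorRightMod ((comparison k F).obj P) M,
    ⟨(whiskerRightIso e M : (restrict k F).obj P ⊗ M ≅ N ⊗ M) ≪≫ β_ N M⟩⟩

/-- If `F^*` is fully faithful then its lax multiplication is, up to the isomorphism
`F_! F^* ≅ id`, the unit of the adjunction at `F^* N ⊗ F^* N'`. This unit is invertible because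
`F^* N ⊗ F^* N'` lies in the essential image of `F^*`. -/
lemma isIso_resMul [F.EssSurj] [F.Full] (N N' : Rep k D) : IsIso (resMul F N N') := by
  have := restrict_full k F
  have := restrict_faithful (k := k) (F := F)
  have hη (P : Rep k C) (hP : (restrict k F).essImage P) : IsIso (adj.unit.app P) :=
    (adj.isIso_unit_app_iff_mem_essImage).2 hP
  have hN (P : Rep k D) : IsIso (adj.unit.app ((restrict k F).obj P)) :=
    hη _ ((restrict k F).obj_mem_essImage P)
  let X := (restrict k F).obj N
  let X' := (restrict k F).obj N'
  have hX : IsIso (adj.unit.app (X ⊗ X')) :=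
    hη _ (essImage_tensor adj hC X X' ((restrict k F).obj_mem_essImage N'))
  have hc : IsIso (Ind.comul adj X X') :=
    ⟨Ind.mul adj X X', Ind.comul_mul adj X X', Ind.mul_comul adj X X'⟩
  have h1 : (adj.unit.app X ⊗ₘ adj.unit.app X') ≫ resMul F (L.obj X) (L.obj X') =
      adj.unit.app (X ⊗ X') ≫ (restrict k F).map (Ind.comul adj X X') :=
    ((adj.homEquiv _ _).apply_symm_apply _).symm.trans (adj.homEquiv_unit _ _ _)
  have h2 : IsIso ((adj.unit.app X ⊗ₘ adj.unit.app X') ≫ resMul F (L.obj X) (L.obj X')) := by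
    rw [h1]
    infer_instance
  have h3 : IsIso (resMul F (L.obj X) (L.obj X')) :=
    IsIso.of_isIso_comp_left (adj.unit.app X ⊗ₘ adj.unit.app X') _
  have hc (P : Rep k D) : IsIso (Ind.counitHom adj P) :=
    inferInstanceAs (IsIso (adj.counit.app P))
  have h4 : IsIso (((restrict k F).map (Ind.counitHom adj N) ⊗ₘ
      (restrict k F).map (Ind.counitHom adj N')) ≫ resMul F N N') := by
    rw [resMul_nat]
    infer_instance
  exact IsIso.of_isIso_comp_left ((restrict k F).map (Ind.counitHom adj N) ⊗ₘ
    (restrict k F).map (Ind.counitHom adj N')) _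

/-- The multiplication `φ` of the comparison functor satisfies `φ ∘ ω = λ`, where `ω` and `λ` are
isomorphisms if `F` is full. -/
lemma isIso_compMul [F.EssSurj] [F.Full] (N N' : Rep k D) : IsIso (compMul F N N') := by
  have := forget_full adj hC
  have h1 := Modu.isIso_pr_of_full ((comparison k F).obj N) ((comparison k F).obj N')
  have h2 : IsIso (Modu.pr ((comparison k F).obj N) ((comparison k F).obj N') ≫
      (compMul F N N').hom) := by
    rw [pr_compMul]
    exact isIso_resMul adj hC N N'
  have h3 : IsIso (compMul F N N').hom := IsIso.of_isIso_comp_left (Modu.pr _ _) _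
  let e := Modu.mkIso (asIso (compMul F N N').hom) (Modu.smul_hom' (compMul F N N'))
  have : compMul F N N' = e.hom := Mod.hom_ext _ _ rfl
  rw [this]
  infer_instance

/-- The comparison functor is a strong symmetric monoidal functor if `F` is full. -/
lemma exists_comparison_braided [F.EssSurj] [F.Full] : ∃ _ : (comparison k F).Braided,
    (Functor.LaxMonoidal.ε (comparison k F)).hom = 𝟙 (algA k F) ∧
      ∀ N N' : Rep k D, Modu.pr ((comparison k F).obj N) ((comparison k F).obj N') ≫
        (Functor.LaxMonoidal.μ (comparison k F) N N').hom =
          Functor.LaxMonoidal.μ (restrict k F) N N' := by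
  let := comparisonLaxBraided k F
  have : IsIso (Functor.LaxMonoidal.ε (comparison k F)) :=
    inferInstanceAs (IsIso (compUnitIso k F).hom)
  have (N N' : Rep k D) : IsIso (Functor.LaxMonoidal.μ (comparison k F) N N') :=
    isIso_compMul adj hC N N'
  let := Functor.Monoidal.ofLaxMonoidal (comparison k F)
  exact ⟨{ braided := compMul_braided }, compUnitIso_hom k F, pr_compMul⟩

end Full

end ComparisonMonoidal

end LinRep

end

theorem theorem1p4 {k : Type w} [CommRing k]
    {C : Type u₁} [Category.{w} C] [Preadditive C] [Linear k C] [MonoidalCategory C]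
    [MonoidalPreadditive C] [MonoidalLinear k C] [SymmetricCategory C] [EssentiallySmall.{w} C]
    {D : Type u₂} [Category.{w} D] [Preadditive D] [Linear k D] [MonoidalCategory D]
    [MonoidalPreadditive D] [MonoidalLinear k D] [SymmetricCategory D] [EssentiallySmall.{w} D]
    (F : C ⥤ D) [F.Additive] [F.Linear k] [F.Braided] :
    -- The diagram. The restriction functor `F^*` has a left adjoint `F_!`; for each choice of it,
    -- the mate of the lax structure of `F^*` is a strong symmetric monoidal structure on `F_!`.
    ((restrict k F).IsRightAdjoint ∧
      ∀ (L : LinRep.Rep k C ⥤ LinRep.Rep k D) (adj : L ⊣ restrict k F),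
        L.Additive ∧ L.Linear k ∧
        ∃ h : L.Braided, h.toMonoidal.toOplaxMonoidal = adj.leftAdjointOplaxMonoidal) ∧
    -- The free module functor is left adjoint to the forgetful functor, and `U ∘ E = F^*`.
    (Nonempty (Modu.free (algA k F) ⊣ Mod.forget (D := LinRep.Rep k C) (algA k F)) ∧
      comparison k F ⋙ Mod.forget (algA k F) = restrict k F) ∧
    -- The action on `E N` is `A ⊗ F^* N ⟶ F^* F_! F^* N ⟶ F^* N`, given by `π` and the counit.
    (∀ (L : LinRep.Rep k C ⥤ LinRep.Rep k D) (adj : L ⊣ restrict k F) (N : LinRep.Rep k D),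
      Modu.la ((comparison k F).obj N) =
        projMap adj ((restrict k F).obj N) ≫ (restrict k F).map (adj.counit.app N)) ∧
    -- In the rigid case, `π` is an isomorphism of functors `Free ≅ E ∘ F_!`, and `E` is the
    -- only functor, up to a unique isomorphism, with `U ∘ E = F^*` and `E ∘ F_! ≅ Free` via `π`.
    (IsRigid C → IsRigid D → ∀ (L : LinRep.Rep k C ⥤ LinRep.Rep k D) (adj : L ⊣ restrict k F),
      (∃ e : Modu.free (algA k F) ≅ L ⋙ comparison k F,
        ∀ M : LinRep.Rep k C, (e.hom.app M).hom = projMap adj M) ∧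
      ∀ (E' : LinRep.Rep k D ⥤ AMod k F) (i : E' ⋙ Mod.forget (algA k F) ≅ restrict k F)
        (e' : Modu.free (algA k F) ≅ L ⋙ E'),
        (∀ M : LinRep.Rep k C, (e'.hom.app M).hom ≫ i.hom.app (L.obj M) = projMap adj M) →
        ∃! j : E' ≅ comparison k F, ∀ N : LinRep.Rep k D, (j.hom.app N).hom = i.hom.app N) ∧
    -- (1)
    (F.EssSurj → IsRigid C → IsRigid D →
      (comparison k F).IsEquivalence ∧ (comparison k F).Additive ∧ (comparison k F).Linear k) ∧
    -- (2)
    (F.EssSurj → F.Full → IsRigid C → IsRigid D →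
      -- `E` is a strong symmetric monoidal functor, with structure induced by that of `F^*`
      (∃ _ : (comparison k F).Braided,
        (Functor.LaxMonoidal.ε (comparison k F)).hom = 𝟙 (algA k F) ∧
        ∀ N N' : LinRep.Rep k D,
          Modu.pr ((comparison k F).obj N) ((comparison k F).obj N') ≫
              (Functor.LaxMonoidal.μ (comparison k F) N N').hom =
            Functor.LaxMonoidal.μ (restrict k F) N N') ∧
      -- `F^*` and `U` are fully faithful, with the same essential image
      ((restrict k F).Full ∧ (restrict k F).Faithful) ∧
      ((Mod.forget (D := LinRep.Rep k C) (algA k F)).Full ∧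
        (Mod.forget (D := LinRep.Rep k C) (algA k F)).Faithful) ∧
      (restrict k F).essImage = (Mod.forget (D := LinRep.Rep k C) (algA k F)).essImage ∧
      -- they identify the tensor products of their sources with that of `Rep C`
      (∀ N N' : LinRep.Rep k D, IsIso (Functor.LaxMonoidal.μ (restrict k F) N N')) ∧
      (∀ M M' : AMod k F, IsIso (Modu.pr M M')) ∧
      -- the essential image is a reflective tensor ideal
      Nonempty (Reflective (restrict k F).essImage.ι) ∧
      (∀ M N : LinRep.Rep k C, (restrict k F).essImage N → (restrict k F).essImage (M ⊗ N))) := by 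
  refine ⟨⟨restrict_isRightAdjoint F, fun L adj => ?_⟩, ⟨⟨Modu.freeForgetAdj _⟩, rfl⟩,
    fun L adj N => compAct_eq adj N, fun hC _ L adj => ?_, fun _ hC _ => ?_, fun _ _ hC _ => ?_⟩
  · have := adj.left_adjoint_additive
    exact ⟨this, ind_linear adj, exists_braided adj⟩
  · exact ⟨⟨projIso adj hC, projIso_hom adj hC⟩, existsUnique_comparison_iso adj⟩
  · have := restrict_isRightAdjoint (k := k) F
    exact ⟨comparison_isEquivalence (Adjunction.ofIsRightAdjoint (restrict k F)) hC,
      comparison_additive, comparison_linear⟩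
  · have := restrict_isRightAdjoint (k := k) F
    let adj := Adjunction.ofIsRightAdjoint (restrict k F)
    have h₁ := restrict_full k F
    have h₂ : (restrict k F).Faithful := restrict_faithful
    have h₃ := forget_full adj hC
    exact ⟨exists_comparison_braided adj hC, ⟨h₁, h₂⟩, ⟨h₃, ⟨fun h => Mod.hom_ext _ _ h⟩⟩,
      essImage_restrict adj hC, isIso_resMul adj hC, Modu.isIso_pr_of_full,
      reflective_essImage adj, essImage_tensor adj hC⟩
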